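/- **Theorem 1.3 (Mnëv–Sturmfels Universality Theorem for Schemes).** *Singularity types.* A pointed scheme is a pair $(X,P)$ with $X$ a scheme and $P\in X$ a point. Let $\sim$ be the equivalence relation on pointed schemes generated by: $(X,P)\sim(Y,Q)$ whenever there is a smooth morphism $\pi:X\to Y$ with $\pi(P)=Q$. Equivalence classes are called singularity types. Murphy's Law holds for a scheme $M$ if for every scheme $Y$ of finite type over $\mathbb{Z}$ and every point $Q\in Y$ there is a point $P\in M$ with $(M,P)\sim(Y,Q)$. *Incidence schemes.* Let $M\ge 4$ and $N\ge 0$ be integers and let $I\subseteq\{1,\dots,M\}\times\{1,\dots,N\}$ be a set of required incidences such that - for any two distinct $j,j'$ there is an $i$ with $(i,j)\in I$ and $(i,j')\in I$; - for each $j$ there are at least three $i$ with $(i,j)\in I$. The incidence scheme $X_{M,N,I}$ is the locally closed subscheme of $(\mathbb{P}^2_{\mathbb{Z}})^M\times_{\mathbb{Z}}(\mathbb{P}^{2\vee}_{\mathbb{Z}})^N=\{(p_1,\dots,p_M,l_1,\dots,l_N)\}$ of $M$ labeled points and $N$ labeled lines, given by the closed conditions - $p_1=[0,0,1]$, $p_2=[0,1,0]$,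 $p_3=[1,0,0]$, $p_4=[1,1,1]$; - $p_i$ lies on $l_j$ for all $(i,j)\in I$ (imposed scheme-theoretically, where "$[x_0,x_1,x_2]$ lies on $[y_0,y_1,y_2]$" is the closed subscheme $\sum_i x_iy_i=0$ of $\mathbb{P}^2_{\mathbb{Z}}\times_{\mathbb{Z}}\mathbb{P}^{2\vee}_{\mathbb{Z}}$), and the open conditions - $p_i$ does not lie on $l_j$ for all $(i,j)\notin I$; - the points $p_1,\dots,p_M$ are pairwise distinct, and the lines $l_1,\dots,l_N$ are pairwise distinct. *Theorem.* The disjoint union $\coprod_{(M,N,I)}X_{M,N,I}$ of all incidence schemes, over all $M$, $N$ and $I$ as above, satisfies Murphy's Law. -/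

import Mathlib

open CategoryTheory CategoryTheory.Limits AlgebraicGeometry

noncomputable section

namespace MnevSturmfels

attribute [local instance] MvPolynomial.gradedAlgebra

/-! ## Singularity types and Murphy's Law -/

/-- A pointed scheme, also called a singularity. -/
structure PointedScheme where
  /-- the underlying scheme -/
  scheme : Scheme.{0}
  /-- the marked point -/
  point : scheme

/-- There is a smooth morphism of pointed schemes from `A` to `B`. -/
def SmoothCovers (A B : PointedScheme) : Prop :=
  ∃ f : A.scheme ⟶ B.scheme, Smooth f ∧ f A.point = B.point

/-- The equivalence relation on pointed schemes generated by smooth pointed morphisms.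
Its classes are the singularity types. -/
def SameSingularityType : PointedScheme → PointedScheme → Prop :=
  Relation.EqvGen SmoothCovers

/-- Murphy's Law holds for `M`: every singularity type appearing on a scheme of finite type
over `ℤ` also appears on `M`. -/
def MurphysLaw (M : Scheme.{0}) : Prop :=
  ∀ (Y : Scheme.{0}) (s : Y ⟶ Spec (CommRingCat.of ℤ)),
    LocallyOfFiniteType s → QuasiCompact s →
      ∀ Q : Y, ∃ P : M, SameSingularityType ⟨M, P⟩ ⟨Y, Q⟩

/-! ## The projective plane, its dual, and the incidence correspondence -/

/-- The projective plane over `ℤ`, as `Proj ℤ[x₀, x₁, x₂]`. -/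
abbrev Plane : Scheme.{0} :=
  Proj (MvPolynomial.homogeneousSubmodule (Fin 3) ℤ)

/-- The dual projective plane over `ℤ`: the point `[b₀, b₁, b₂]` stands for the line
`b₀ x₀ + b₁ x₁ + b₂ x₂ = 0`. -/
abbrev DualPlane : Scheme.{0} :=
  Proj (MvPolynomial.homogeneousSubmodule (Fin 3) ℤ)

/-- The map from `ℤ[x₀, x₁, x₂]` to the global sections of `Spec R` sending `xᵢ` to `c i`. -/
def coordHom {R : Type} [CommRing R] (c : Fin 3 → R) :
    MvPolynomial (Fin 3) ℤ →+* Γ(Spec (CommRingCat.of R), ⊤) :=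
  (Scheme.ΓSpecIso (CommRingCat.of R)).inv.hom.comp
    (MvPolynomial.eval₂Hom (Int.castRingHom R) c)

theorem map_coordHom_irrelevant {R : Type} [CommRing R] (c : Fin 3 → R)
    (hc : Ideal.span (Set.range c) = ⊤) :
    (HomogeneousIdeal.irrelevant
      (MvPolynomial.homogeneousSubmodule (Fin 3) ℤ)).toIdeal.map (coordHom c) = ⊤ := by
  have h1 : (HomogeneousIdeal.irrelevant
      (MvPolynomial.homogeneousSubmodule (Fin 3) ℤ)).toIdeal.map
        (MvPolynomial.eval₂Hom (Int.castRingHom R) c) = ⊤ := by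
    rw [eq_top_iff, ← hc, Ideal.span_le]
    rintro _ ⟨i, rfl⟩
    have hX : (MvPolynomial.X i : MvPolynomial (Fin 3) ℤ) ∈ (HomogeneousIdeal.irrelevant
        (MvPolynomial.homogeneousSubmodule (Fin 3) ℤ)).toIdeal := by
      apply HomogeneousIdeal.mem_irrelevant_of_mem _ (i := 1) Nat.one_pos
      exact (MvPolynomial.mem_homogeneousSubmodule 1 _).2 (MvPolynomial.isHomogeneous_X ℤ i)
    simpa using Ideal.mem_map_of_mem (MvPolynomial.eval₂Hom (Int.castRingHom R) c) hX
  rw [coordHom, ← Ideal.map_map, h1, Ideal.map_top]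

/-- The `R`-valued point `[c₀, c₁, c₂]` of the plane, for `c` generating the unit ideal. -/
def pointOfCoords {R : Type} [CommRing R] (c : Fin 3 → R)
    (hc : Ideal.span (Set.range c) = ⊤) : Spec (CommRingCat.of R) ⟶ Plane :=
  Proj.fromOfGlobalSections _ (coordHom c) (map_coordHom_irrelevant c hc)

theorem span_range_eq_top_of_eq_one {R : Type} [CommRing R] {c : Fin 3 → R} (a : Fin 3)
    (h : c a = 1) : Ideal.span (Set.range c) = ⊤ :=
  (Ideal.eq_top_iff_one _).2 (h ▸ Ideal.subset_span ⟨a, rfl⟩)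

/-- The equations in `ℤ[x₀, x₁, x₂, y₀, y₁, y₂]` of the standard chart `x_a = 1`, `y_b = 1`
of the incidence correspondence `∑ xᵢ yᵢ = 0`. -/
def chartIdeal (a b : Fin 3) : Ideal (MvPolynomial (Fin 3 ⊕ Fin 3) ℤ) :=
  Ideal.span {MvPolynomial.X (Sum.inl a) - 1, MvPolynomial.X (Sum.inr b) - 1,
    ∑ i : Fin 3, MvPolynomial.X (Sum.inl i) * MvPolynomial.X (Sum.inr i)}

/-- The coordinate ring of the standard chart `x_a = 1`, `y_b = 1` of the incidence
correspondence `∑ xᵢ yᵢ = 0`. -/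
abbrev ChartRing (a b : Fin 3) : Type :=
  MvPolynomial (Fin 3 ⊕ Fin 3) ℤ ⧸ chartIdeal a b

/-- The coordinates `x₀, x₁, x₂` of the universal point on a chart. -/
def chartX (a b : Fin 3) (i : Fin 3) : ChartRing a b :=
  Ideal.Quotient.mk (chartIdeal a b) (MvPolynomial.X (Sum.inl i))

/-- The coordinates `y₀, y₁, y₂` of the universal line on a chart. -/
def chartY (a b : Fin 3) (i : Fin 3) : ChartRing a b :=
  Ideal.Quotient.mk (chartIdeal a b) (MvPolynomial.X (Sum.inr i))

theorem chartX_eq_one (a b : Fin 3) : chartX a b a = 1 := by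
  rw [chartX, ← map_one (Ideal.Quotient.mk (chartIdeal a b)), Ideal.Quotient.eq]
  exact Ideal.subset_span (by simp)

theorem chartY_eq_one (a b : Fin 3) : chartY a b b = 1 := by
  rw [chartY, ← map_one (Ideal.Quotient.mk (chartIdeal a b)), Ideal.Quotient.eq]
  exact Ideal.subset_span (by simp)

/-- The inclusion of a standard chart of the incidence correspondence. -/
def chartMap (a b : Fin 3) :
    Spec (CommRingCat.of (ChartRing a b)) ⟶ Plane ⨯ DualPlane :=
  prod.lift
    (pointOfCoords (chartX a b) (span_range_eq_top_of_eq_one a (chartX_eq_one a b)))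
    (pointOfCoords (chartY a b) (span_range_eq_top_of_eq_one b (chartY_eq_one a b)))

/-- The ideal sheaf of the incidence correspondence `∑ xᵢ yᵢ = 0`, that is of
`{(p, l) | p ∈ l}`, in the product of the plane and its dual: the functions that vanish on each
of its nine standard charts. -/
def incidenceIdeal : (Plane ⨯ DualPlane).IdealSheafData :=
  ⨅ (a : Fin 3) (b : Fin 3), (chartMap a b).ker

/-- The ideal sheaf of the diagonal of a scheme; it is used for the plane and its dual. -/
def diagonalIdeal (X : Scheme.{0}) : (X ⨯ X).IdealSheafData :=
  (Limits.diag X).ker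

/-- Homogeneous coordinates of the four anchor points. -/
def anchorCoords : Fin 4 → Fin 3 → ℤ :=
  ![![0, 0, 1], ![0, 1, 0], ![1, 0, 0], ![1, 1, 1]]

theorem span_anchorCoords (k : Fin 4) : Ideal.span (Set.range (anchorCoords k)) = ⊤ := by
  fin_cases k
  · exact span_range_eq_top_of_eq_one 2 rfl
  · exact span_range_eq_top_of_eq_one 1 rfl
  · exact span_range_eq_top_of_eq_one 0 rfl
  · exact span_range_eq_top_of_eq_one 0 rfl

/-- The ideal sheaf of the `k`-th anchor point, a section of the plane over `Spec ℤ`. -/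
def anchorIdeal (k : Fin 4) : Plane.IdealSheafData :=
  (pointOfCoords (anchorCoords k) (span_anchorCoords k)).ker

/-! ## Incidence schemes -/

/-- The combinatorial data of an incidence scheme with `M` labeled points and `N` labeled
lines. The first four points are the anchor points. -/
structure IncidenceData where
  /-- the number of points -/
  M : ℕ
  /-- the number of lines -/
  N : ℕ
  /-- the four anchor points are among the points -/
  four_le : 4 ≤ M
  /-- `inc i j` if the `i`-th point is required to lie on the `j`-th line; otherwise it is
  required not to lie on that line -/
  inc : Fin M → Fin N → Prop
  /-- any two lines have a marked point required to be on both of them -/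
  exists_common : ∀ j j' : Fin N, j ≠ j' → ∃ i : Fin M, inc i j ∧ inc i j'
  /-- each line contains at least three marked points -/
  three_le : ∀ j : Fin N, 3 ≤ {i : Fin M | inc i j}.ncard

namespace IncidenceData

variable (D : IncidenceData)

/-- The product of `M` copies of the plane and `N` copies of its dual, over `ℤ`
(the terminal scheme is `Spec ℤ`). -/
abbrev ambient : Scheme.{0} :=
  (∏ᶜ fun _ : Fin D.M => Plane) ⨯ (∏ᶜ fun _ : Fin D.N => DualPlane)

/-- The `i`-th marked point. -/
def pt (i : Fin D.M) : D.ambient ⟶ Plane :=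
  prod.fst ≫ Pi.π (fun _ : Fin D.M => Plane) i

/-- The `j`-th marked line. -/
def ln (j : Fin D.N) : D.ambient ⟶ DualPlane :=
  prod.snd ≫ Pi.π (fun _ : Fin D.N => DualPlane) j

/-- The ideal sheaf of the closed locus where the `i`-th point lies on the `j`-th line. -/
def onLine (i : Fin D.M) (j : Fin D.N) : D.ambient.IdealSheafData :=
  incidenceIdeal.comap (prod.lift (D.pt i) (D.ln j))

/-- The ideal sheaf of the closed conditions: the first four points are the anchor points, and
the required incidences hold. -/
def closedIdeal : D.ambient.IdealSheafData :=
  (⨆ k : Fin 4, (anchorIdeal k).comap (D.pt (Fin.castLE D.four_le k))) ⊔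
    ⨆ (i : Fin D.M) (j : Fin D.N) (_ : D.inc i j), D.onLine i j

/-- The open locus where the required non-incidences hold, the points are distinct, and the
lines are distinct. -/
def openLocus : D.ambient.Opens :=
  (⨅ (i : Fin D.M) (j : Fin D.N) (_ : ¬ D.inc i j), (D.onLine i j).support.compl) ⊓
  (⨅ (i : Fin D.M) (i' : Fin D.M) (_ : i ≠ i'),
    ((diagonalIdeal Plane).comap (prod.lift (D.pt i) (D.pt i'))).support.compl) ⊓
  (⨅ (j : Fin D.N) (j' : Fin D.N) (_ : j ≠ j'),
    ((diagonalIdeal DualPlane).comap (prod.lift (D.ln j) (D.ln j'))).support.compl)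

/-- The incidence scheme of `D`: the open part, given by the open conditions, of the closed
subscheme of the ambient product given by the closed conditions. -/
def incidenceScheme : Scheme.{0} :=
  ((D.closedIdeal.subschemeι ⁻¹ᵁ D.openLocus : D.closedIdeal.subscheme.Opens) : Scheme.{0})

end IncidenceData

end MnevSturmfels

end

noncomputable section

namespace MnevSturmfels

attribute [local instance] MvPolynomial.gradedAlgebra

/-! ## Coordinates of morphisms to the projective plane -/

/-! Coordinates are encoded as slopes of lines. A relation `a + b = c + d` or `a * b = c * d`
between four slopes is the condition for six lines of prescribed directions to close up to a
complete quadrangle: give the edges `13`, `24` the slopes `a`, `b`, the edges `14`, `23` the slopes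
`c`, `d`, make `34` vertical, and make `12` vertical for a sum and horizontal for a product
(`closes_iff`, `exists_eq_vertex`).

Algebra. Locally `Y` is the spectrum of a ring `A` of finite type over `ℤ`, and the point comes from
a homomorphism `φ` to an infinite field `K`. A slope system is a finite set of elements of `K` with
relations of the two kinds; its solutions over `R` are the deformations of these slopes that keep
the relations. Each generator of `A` is written as a difference `u - t - t'` of free slopes, and the
defining polynomials of `A` are computed by successive sums and products. Every intermediate value
carries generic summands, so that all slopes stay distinct although the values themselves may
coincide or vanish. Each new slope is free or determined by the previous ones, so solutions lift
along surjections. The equation `g = 0` is imposed at the end in the form `u + 0 = t + t'`. This is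
`exists_encoding`.

Geometry. For each relation a quadrangle is drawn over `K`, with base points in general position
(`exists_generic`). The marked points are the directions at infinity, the affine anchors and all
intersections of nonparallel lines; the required incidences are those that hold. A configuration
over a ring, with distinct slopes and nondegenerate quadrangles in the sense that `disc` is
invertible, solves the slope system. Conversely, once the slopes are lifted along a thickening, one
lifts the base point and the size of each quadrangle freely; any other point is an anchor or lies on
two lines only and is lifted as their intersection (`exists_lift_isAff`). Hence the localized
configuration ring is smooth over `A` (`hasSmoothConfig`).

Schemes. Normalized coordinates identify the spectrum of the configuration ring with an open part of
the closed locus (`isOpenImmersion_configChart`), and over a field the open conditions can be read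
off from coordinates (`toClosed_mem_openLocus`). Thus a point of an incidence scheme and the given
point of `Y` are joined by smooth morphisms. -/

/-- The grading of `ℤ[x₀, x₁, x₂]` by degree. -/
abbrev deg : ℕ → Submodule ℤ (MvPolynomial (Fin 3) ℤ) := MvPolynomial.homogeneousSubmodule (Fin 3) ℤ

/-- Evaluation of integral polynomials at a triple. -/
abbrev evalHom {R : Type*} [CommRing R] (c : Fin 3 → R) : MvPolynomial (Fin 3) ℤ →+* R :=
  MvPolynomial.eval₂Hom (Int.castRingHom R) c

theorem X_mem_deg (a : Fin 3) : (MvPolynomial.X a : MvPolynomial (Fin 3) ℤ) ∈ deg 1 :=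
  (MvPolynomial.mem_homogeneousSubmodule 1 _).2 (MvPolynomial.isHomogeneous_X ℤ a)

theorem map_evalHom_irrelevant {R : Type*} [CommRing R] (c : Fin 3 → R)
    (hc : Ideal.span (Set.range c) = ⊤) :
    (HomogeneousIdeal.irrelevant deg).toIdeal.map (evalHom c) = ⊤ := by
  rw [eq_top_iff, ← hc, Ideal.span_le]
  rintro _ ⟨i, rfl⟩
  have hX : (MvPolynomial.X i : MvPolynomial (Fin 3) ℤ) ∈
      (HomogeneousIdeal.irrelevant deg).toIdeal :=
    HomogeneousIdeal.mem_irrelevant_of_mem _ Nat.one_pos (X_mem_deg i)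
  simpa using Ideal.mem_map_of_mem (evalHom c) hX

/-- The morphism to the plane with homogeneous coordinates `c`. -/
def ptOf {T : Scheme.{0}} (c : Fin 3 → Γ(T, ⊤)) (hc : Ideal.span (Set.range c) = ⊤) : T ⟶ Plane :=
  Proj.fromOfGlobalSections _ (evalHom c) (map_evalHom_irrelevant c hc)

theorem ptOf_congr {T : Scheme.{0}} {c c' : Fin 3 → Γ(T, ⊤)} (h : c = c') (hc hc') :
    ptOf c hc = ptOf c' hc' := by subst h; rfl

/-- The anchors and the charts of the incidence correspondence have coordinates in a ring; replacing
them by global sections allows them to be pulled back along morphisms of schemes. -/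
theorem pointOfCoords_eq_ptOf {R : Type} [CommRing R] (c : Fin 3 → R) (hc) (hc') :
    pointOfCoords c hc =
      ptOf (fun i => (Scheme.ΓSpecIso (CommRingCat.of R)).inv.hom (c i)) hc' := by
  have h : coordHom c = evalHom fun i => (Scheme.ΓSpecIso (CommRingCat.of R)).inv.hom (c i) := by
    refine MvPolynomial.ringHom_ext (fun r => by simp) fun i => ?_
    simp [coordHom]
  unfold pointOfCoords ptOf
  congr 1

/-- Evaluation of degree zero fractions with denominators powers of `x_a`. -/
def awayHom {R : Type*} [CommRing R] (c : Fin 3 → R) (a : Fin 3) (h : IsUnit (c a)) :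
    HomogeneousLocalization.Away deg (MvPolynomial.X a) →+* R :=
  (IsLocalization.Away.lift (MvPolynomial.X a : MvPolynomial (Fin 3) ℤ) (g := evalHom c)
    (S := Localization.Away (MvPolynomial.X a : MvPolynomial (Fin 3) ℤ)) (by simpa using h)).comp
    (algebraMap _ _)

theorem awayHom_mk {R : Type*} [CommRing R] (c : Fin 3 → R) (a : Fin 3) (h : IsUnit (c a))
    (n : ℕ) (x : MvPolynomial (Fin 3) ℤ) (hx : x ∈ deg (n • 1)) :
    awayHom c a h (HomogeneousLocalization.Away.mk deg (X_mem_deg a) n x hx) * c a ^ n =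
      evalHom c x := by
  have h1 := HomogeneousLocalization.Away.val_mk (𝒜 := deg) n (X_mem_deg a) x hx
  simp only [awayHom, RingHom.coe_comp, Function.comp_apply,
    HomogeneousLocalization.algebraMap_apply, h1, Localization.mk_eq_mk']
  have h2 : c a ^ n = (IsLocalization.Away.lift (MvPolynomial.X a : MvPolynomial (Fin 3) ℤ)
      (g := evalHom c) (S := Localization.Away (MvPolynomial.X a : MvPolynomial (Fin 3) ℤ))
      (by simpa using h)) (algebraMap (MvPolynomial (Fin 3) ℤ) _ (MvPolynomial.X a ^ n)) := by
    rw [IsLocalization.Away.lift_eq]; simp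
  rw [h2, ← map_mul]
  erw [IsLocalization.mk'_spec_mk, IsLocalization.Away.lift_eq]

/-- The fraction `x_i / x_a`. -/
def frac (a i : Fin 3) : HomogeneousLocalization.Away deg (MvPolynomial.X a) :=
  HomogeneousLocalization.Away.mk deg (X_mem_deg a) 1 (MvPolynomial.X i) (X_mem_deg i)

/-- The chart `x_a ≠ 0` of the plane. -/
abbrev planeChart (a : Fin 3) :
    Spec (CommRingCat.of (HomogeneousLocalization.Away deg (MvPolynomial.X a))) ⟶ Plane :=
  Proj.awayι deg (MvPolynomial.X a) (X_mem_deg a) Nat.one_pos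

/-- An invertible coordinate makes the morphism land in an affine chart, where it is a ring
homomorphism. Pullback, uniqueness and rescaling of coordinates are all reduced to the affine case
in this way. -/
theorem ptOf_eq_chart {T : Scheme.{0}} (c : Fin 3 → Γ(T, ⊤)) (hc) (a : Fin 3)
    (h : IsUnit (c a)) :
    ptOf c hc = T.toSpecΓ ≫ Spec.map (CommRingCat.ofHom (awayHom c a h)) ≫ planeChart a := by
  have hr := Proj.fromOfGlobalSections_resLE deg (evalHom c) (map_evalHom_irrelevant c hc)
    Nat.one_pos (X_mem_deg a)
  have hr2 := congrArg (· ≫ Scheme.Opens.ι _) hr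
  simp only [Scheme.Hom.resLE_comp_ι] at hr2
  -- Since `c a` is a unit, the open set on which the morphism is described by fractions is all of
  -- `T`, so its inclusion is an isomorphism and can be cancelled.
  have htop : T.basicOpen (evalHom c (MvPolynomial.X a)) = ⊤ := by
    rw [Scheme.basicOpen_of_isUnit]; simpa using h
  have : IsIso (T.basicOpen (evalHom c (MvPolynomial.X a))).ι := by
    rw [htop]; exact (Scheme.topIso T).isIso_hom
  rw [← cancel_epi (T.basicOpen (evalHom c (MvPolynomial.X a))).ι]
  refine hr2.trans ?_
  simp only [Proj.toBasicOpenOfGlobalSections, Category.assoc, Proj.basicOpenIsoSpec_inv_ι,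
    Scheme.isoOfEq_inv]
  have e1 := T.toSpecΓ_preimage_basicOpen (evalHom c (MvPolynomial.X a))
  have h4 : (T.basicOpen (evalHom c (MvPolynomial.X a))).ι ≫ T.toSpecΓ =
      T.homOfLE e1.ge ≫ (T.toSpecΓ ∣_ _) ≫ (basicOpenIsoSpecAway _).hom ≫
        Spec.map (CommRingCat.ofHom (algebraMap _ _)) := by
    let W : (Spec Γ(T, ⊤)).Opens := PrimeSpectrum.basicOpen (evalHom c (MvPolynomial.X a))
    refine Eq.trans ?_ (congrArg (fun z => T.homOfLE e1.ge ≫ (T.toSpecΓ ∣_ _) ≫ z)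
      (basicOpenIsoSpecAway_hom_SpecMap _).symm)
    refine Eq.trans ?_ (congrArg (fun z => T.homOfLE e1.ge ≫ z)
      (morphismRestrict_ι T.toSpecΓ W).symm)
    exact (Scheme.homOfLE_ι_assoc _ _ _).symm
  rw [reassoc_of% h4]
  congr 3
  rw [← Category.assoc, ← Spec.map_comp, ← CommRingCat.ofHom_comp]
  congr 3
  change RingHom.comp _ _ = RingHom.comp _ (RingHom.comp _ _)
  rw [← RingHom.comp_assoc]
  refine congrArg (fun z : Localization.Away (MvPolynomial.X a : MvPolynomial (Fin 3) ℤ) →+* _ =>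
    z.comp (algebraMap (HomogeneousLocalization.Away deg (MvPolynomial.X a)) _)) ?_
  refine IsLocalization.ringHom_ext
    (M := .powers (MvPolynomial.X a : MvPolynomial (Fin 3) ℤ)) ?_
  erw [IsLocalization.map_comp]
  rw [RingHom.comp_assoc]
  refine congrArg (RingHom.comp _) ?_
  refine RingHom.ext fun x => ?_
  rw [RingHom.comp_apply, IsLocalization.Away.lift_eq]

theorem evalHom_mul_left {R : Type*} [CommRing R] (c : Fin 3 → R) (r : R) {n : ℕ}
    {p : MvPolynomial (Fin 3) ℤ} (hp : p.IsHomogeneous n) :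
    evalHom (fun i => r * c i) p = r ^ n * evalHom c p := by
  simp only [evalHom, MvPolynomial.coe_eval₂Hom, MvPolynomial.eval₂_eq', Finset.mul_sum]
  refine Finset.sum_congr rfl fun d hd => ?_
  have h1 : ∑ i, d i = n := by
    have : _ = n := hp (MvPolynomial.mem_support_iff.1 hd)
    simpa [Finsupp.weight_apply, Finsupp.sum_fintype] using this
  simp only [mul_pow, Finset.prod_mul_distrib, Finset.prod_pow_eq_pow_sum, h1]
  ring

/-- Dehomogenization: dividing `p` by `x_a ^ n` amounts to substituting the fractions `x_i / x_a`.
Therefore these three fractions generate the chart ring, as `away_hom_ext` needs. -/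
theorem mk_eq_evalHom_frac (a : Fin 3) (n : ℕ) (p : MvPolynomial (Fin 3) ℤ)
    (hp : p ∈ deg (n • 1)) :
    HomogeneousLocalization.Away.mk deg (X_mem_deg a) n p hp = evalHom (frac a) p := by
  apply HomogeneousLocalization.val_injective
  have h0 : (p.IsHomogeneous n) := by
    simpa using (MvPolynomial.mem_homogeneousSubmodule _ _).1 hp
  set S := Localization.Away (MvPolynomial.X a : MvPolynomial (Fin 3) ℤ)
  have h1 : (evalHom (frac a) p).val = evalHom (fun i => (frac a i).val) p := by
    change algebraMap (HomogeneousLocalization.Away deg (MvPolynomial.X a)) S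
      (evalHom (frac a) p) = _
    rw [MvPolynomial.coe_eval₂Hom, MvPolynomial.hom_eval₂]
    congr 1
    exact Subsingleton.elim _ _
  have hu : IsUnit (algebraMap (MvPolynomial (Fin 3) ℤ) S (MvPolynomial.X a)) :=
    IsLocalization.Away.algebraMap_isUnit _
  have h2 : ∀ i, algebraMap (MvPolynomial (Fin 3) ℤ) S (MvPolynomial.X a) * (frac a i).val =
      algebraMap (MvPolynomial (Fin 3) ℤ) S (MvPolynomial.X i) := by
    intro i
    rw [frac, HomogeneousLocalization.Away.val_mk, Localization.mk_eq_mk']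
    have := IsLocalization.mk'_spec' S (MvPolynomial.X i) (⟨MvPolynomial.X a ^ 1, 1, rfl⟩ :
      Submonoid.powers (MvPolynomial.X a : MvPolynomial (Fin 3) ℤ))
    simp only [pow_one] at this ⊢
    exact this
  rw [h1]
  apply (hu.pow n).mul_left_cancel
  rw [← evalHom_mul_left _ _ h0, funext h2, ← map_pow, HomogeneousLocalization.Away.val_mk,
    Localization.mk_eq_mk']
  refine (IsLocalization.mk'_spec' S p (⟨MvPolynomial.X a ^ n, n, rfl⟩ :
      Submonoid.powers (MvPolynomial.X a : MvPolynomial (Fin 3) ℤ))).trans ?_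
  have h3 : evalHom (fun i => algebraMap (MvPolynomial (Fin 3) ℤ) S (MvPolynomial.X i)) =
      algebraMap _ S := by
    exact MvPolynomial.ringHom_ext (fun r => by simp) fun i => by simp
  rw [h3]

theorem away_hom_ext {R : Type*} [CommRing R] {a : Fin 3}
    {f g : HomogeneousLocalization.Away deg (MvPolynomial.X a) →+* R}
    (h : ∀ i, f (frac a i) = g (frac a i)) : f = g := by
  refine RingHom.ext fun x => ?_
  obtain ⟨n, p, hp, rfl⟩ := HomogeneousLocalization.Away.mk_surjective deg (X_mem_deg a) x
  rw [mk_eq_evalHom_frac, MvPolynomial.coe_eval₂Hom, MvPolynomial.hom_eval₂,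
    MvPolynomial.hom_eval₂]
  congr 1
  · exact Subsingleton.elim _ _
  · exact funext h

theorem awayHom_frac_mul {R : Type*} [CommRing R] (c : Fin 3 → R) (a : Fin 3)
    (h : IsUnit (c a)) (i : Fin 3) : awayHom c a h (frac a i) * c a = c i := by
  have := awayHom_mk c a h 1 (MvPolynomial.X i) (X_mem_deg i)
  rwa [pow_one, MvPolynomial.coe_eval₂Hom, MvPolynomial.eval₂_X] at this

theorem frac_self (a : Fin 3) : frac a a = 1 := by
  rw [frac, mk_eq_evalHom_frac]
  apply HomogeneousLocalization.val_injective
  have : frac a a = evalHom (frac a) (MvPolynomial.X a) := by simp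
  rw [← this, frac, HomogeneousLocalization.Away.val_mk, HomogeneousLocalization.val_one,
    ← Localization.mk_one]
  refine Localization.mk_eq_mk_iff.2 (Localization.r_iff_exists.2 ⟨1, by simp⟩)

theorem comp_awayHom {R S : Type*} [CommRing R] [CommRing S] (g : R →+* S) (c : Fin 3 → R)
    (a : Fin 3) (h : IsUnit (c a)) :
    g.comp (awayHom c a h) = awayHom (fun i => g (c i)) a (h.map g) := by
  refine away_hom_ext fun i => ?_
  apply (h.map g).mul_right_cancel
  rw [RingHom.comp_apply, ← map_mul, awayHom_frac_mul, awayHom_frac_mul (fun i => g (c i))]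

theorem eq_awayHom {R : Type*} [CommRing R] {a : Fin 3}
    (f : HomogeneousLocalization.Away deg (MvPolynomial.X a) →+* R)
    (h : IsUnit (f (frac a a))) : f = awayHom (fun i => f (frac a i)) a h := by
  refine away_hom_ext fun i => ?_
  apply h.mul_right_cancel
  rw [awayHom_frac_mul (fun i => f (frac a i)), frac_self, map_one, mul_one]

theorem comp_ptOf_of_isUnit {S T : Scheme.{0}} (g : S ⟶ T) (c : Fin 3 → Γ(T, ⊤)) (hc) (hc')
    (a : Fin 3) (h : IsUnit (c a)) :
    g ≫ ptOf c hc = ptOf (fun i => g.appTop.hom (c i)) hc' := by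
  rw [ptOf_eq_chart c hc a h, ptOf_eq_chart _ hc' a (h.map g.appTop.hom),
    Scheme.toSpecΓ_naturality_assoc, ← Spec.map_comp_assoc]
  congr 3
  ext1
  exact comp_awayHom _ _ _ h

theorem toSpecΓ_comp_injective {T : Scheme.{0}} {R : CommRingCat.{0}} {f g : R ⟶ Γ(T, ⊤)}
    (h : T.toSpecΓ ≫ Spec.map f = T.toSpecΓ ≫ Spec.map g) : f = g := by
  have := congrArg (fun z => (Scheme.ΓSpecIso R).inv ≫ Scheme.Hom.appTop z) h
  simpa using this

/-- The normalization removes the scaling ambiguity: the chart is a monomorphism, and the values of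
the ring homomorphism on the fractions are the coordinates themselves. -/
theorem ptOf_injective {T : Scheme.{0}} {c c' : Fin 3 → Γ(T, ⊤)} {hc hc'} {a : Fin 3}
    (h : c a = 1) (h' : c' a = 1) (e : ptOf c hc = ptOf c' hc') : c = c' := by
  have hu : IsUnit (c a) := h ▸ isUnit_one
  have hu' : IsUnit (c' a) := h' ▸ isUnit_one
  rw [ptOf_eq_chart c hc a hu, ptOf_eq_chart c' hc' a hu', ← Category.assoc, ← Category.assoc,
    cancel_mono] at e
  have e1 := congrArg CommRingCat.Hom.hom (toSpecΓ_comp_injective e)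
  funext i
  have := DFunLike.congr_fun e1 (frac a i)
  have k1 := awayHom_frac_mul c a hu i
  have k2 := awayHom_frac_mul c' a hu' i
  rw [h, mul_one] at k1
  rw [h', mul_one] at k2
  exact k1.symm.trans (Eq.trans this k2)

theorem ptOf_mul {T : Scheme.{0}} {c c' : Fin 3 → Γ(T, ⊤)} (hc hc') {a : Fin 3}
    {r : Γ(T, ⊤)} (hr : IsUnit r) (h : IsUnit (c a)) (e : ∀ i, c' i = r * c i) :
    ptOf c hc = ptOf c' hc' := by
  have h' : IsUnit (c' a) := e a ▸ hr.mul h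
  rw [ptOf_eq_chart c hc a h, ptOf_eq_chart c' hc' a h']
  congr 4
  refine away_hom_ext fun i => ?_
  apply h'.mul_right_cancel
  rw [awayHom_frac_mul c', e, e, mul_left_comm, awayHom_frac_mul]

/-- The lift of `f` to the affine chart `x_a ≠ 0` is given by a ring homomorphism, whose values on
the fractions `x_i / x_a` serve as coordinates. -/
theorem exists_eq_ptOf {T : Scheme.{0}} (f : T ⟶ Plane) (a : Fin 3)
    (h : f ⁻¹ᵁ Proj.basicOpen deg (MvPolynomial.X a) = ⊤) :
    ∃ (c : Fin 3 → Γ(T, ⊤)) (hc : c a = 1), f = ptOf c (span_range_eq_top_of_eq_one a hc) := by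
  have hr : Set.range f ⊆ Set.range (planeChart a) := by
    have := Proj.opensRange_awayι deg (MvPolynomial.X a) (X_mem_deg a) Nat.one_pos
    rintro _ ⟨x, rfl⟩
    have hx : x ∈ f ⁻¹ᵁ Proj.basicOpen deg (MvPolynomial.X a) := h ▸ trivial
    rw [← this] at hx
    exact hx
  let f' := IsOpenImmersion.lift (planeChart a) f hr
  have hf : f' ≫ planeChart a = f := IsOpenImmersion.lift_fac _ _ _
  let φ := (Scheme.ΓSpecIso _).inv ≫ f'.appTop
  have hφ : f' = T.toSpecΓ ≫ Spec.map φ := by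
    rw [Spec.map_comp, ← Scheme.toSpecΓ_naturality_assoc]
    simp
  have h1 : φ.hom (frac a a) = 1 := by rw [frac_self, map_one]
  refine ⟨fun i => φ.hom (frac a i), h1, ?_⟩
  rw [ptOf_eq_chart _ _ a (by rw [h1]; exact isUnit_one), ← hf, hφ, Category.assoc]
  congr 3
  ext1
  exact eq_awayHom _ (h1 ▸ isUnit_one)

theorem ptOf_preimage_basicOpen {T : Scheme.{0}} (c : Fin 3 → Γ(T, ⊤)) (hc) (a : Fin 3) :
    ptOf c hc ⁻¹ᵁ Proj.basicOpen deg (MvPolynomial.X a) = T.basicOpen (c a) := by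
  rw [ptOf, Proj.fromOfGlobalSections_preimage_basicOpen _ _ _ Nat.one_pos (X_mem_deg a)]
  simp

/-! ## Ideal sheaves and morphisms -/

theorem isUnit_of_basicOpen_eq_top {X : Scheme.{0}} {f : Γ(X, ⊤)} (h : X.basicOpen f = ⊤) :
    IsUnit f :=
  X.toRingedSpace.isUnit_of_isUnit_germ ⊤ f fun x hx =>
    (Scheme.mem_basicOpen X f x hx).1 (by rw [h]; exact hx)

/-- Containment of an ideal sheaf in `h.ker` expresses that `h` factors through the closed
subscheme; such conditions are transported here to the scheme where the ideal is defined. -/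
theorem comap_le_ker_iff {S X Y : Scheme.{0}} (I : Y.IdealSheafData) (g : X ⟶ Y) (h : S ⟶ X) :
    I.comap g ≤ h.ker ↔ I ≤ (h ≫ g).ker := by
  rw [← Scheme.IdealSheafData.map_ker, Scheme.IdealSheafData.le_map_iff_comap_le]

/-- A field is reduced, so a section whose basic open set has empty preimage pulls back to zero.
This turns the set-theoretic complements in `openLocus` into statements about coordinates. -/
theorem le_ker_of_mem_support {K : Type} [Field K] {X : Scheme.{0}} {I : X.IdealSheafData}
    (x : Spec (CommRingCat.of K) ⟶ X) (h : ∀ t, x t ∈ I.support) : I ≤ x.ker := by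
  refine Scheme.IdealSheafData.le_ofIdeals_iff.2 fun U s hs => ?_
  rw [RingHom.mem_ker, ← basicOpen_eq_bot_iff, ← Scheme.preimage_basicOpen]
  rw [eq_bot_iff]
  intro t ht
  have h1 : x t ∈ X.basicOpen s := ht
  have h2 := (Scheme.IdealSheafData.mem_support_iff_of_mem (X.basicOpen_le _ h1)).1 (h t)
  rw [Scheme.mem_zeroLocus_iff] at h2
  exact (h2 s hs h1).elim

theorem eq_of_diagonalIdeal_le {S X : Scheme.{0}} [X.IsSeparated] (f g : S ⟶ X)
    (h : diagonalIdeal X ≤ (prod.lift f g).ker) : f = g := by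
  have : IsClosedImmersion (Limits.diag X) :=
    inferInstanceAs (IsClosedImmersion (prod.lift (𝟙 X) (𝟙 X)))
  have e := IsClosedImmersion.lift_fac (Limits.diag X) (prod.lift f g) h
  generalize IsClosedImmersion.lift (Limits.diag X) (prod.lift f g) h = t at e
  have e1 := (congrArg (· ≫ prod.fst) e).trans (prod.lift_fst f g)
  have e2 := (congrArg (· ≫ prod.snd) e).trans (prod.lift_snd f g)
  rw [Category.assoc, prod.lift_fst, Category.comp_id] at e1
  rw [Category.assoc, prod.lift_snd, Category.comp_id] at e2
  exact e1.symm.trans e2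

/-- `Spec ℤ` is terminal, so composing with the structure morphism gives an isomorphism, and a
section of a separated morphism is a closed immersion. -/
theorem isClosedImmersion_section {X : Scheme.{0}} [X.IsSeparated]
    (σ : Spec (CommRingCat.of ℤ) ⟶ X) : IsClosedImmersion σ := by
  have : IsIso (σ ≫ terminal.from X) :=
    isIso_of_isTerminal specZIsTerminal terminalIsTerminal _
  exact IsClosedImmersion.of_comp σ (terminal.from X)

/-- The anchor is a closed immersion, so the containment means that the point factors through it and
equals the constant point; both are normalized at `a`, so their coordinates agree. -/
theorem anchorIdeal_le_ker_iff {T : Scheme.{0}} (k : Fin 4) (a : Fin 3)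
    (ha : anchorCoords k a = 1) (c : Fin 3 → Γ(T, ⊤)) (hc : c a = 1) (hc') :
    anchorIdeal k ≤ (ptOf c hc').ker ↔ c = fun i => (anchorCoords k i : Γ(T, ⊤)) := by
  set σ := pointOfCoords (anchorCoords k) (span_anchorCoords k) with hσ
  have hσ' : IsClosedImmersion σ := isClosedImmersion_section σ
  have h1 : ∀ i, (Scheme.ΓSpecIso (CommRingCat.of ℤ)).inv.hom (anchorCoords k i) =
    ((anchorCoords k i : ℤ) : Γ(Spec (CommRingCat.of ℤ), ⊤)) := fun i => by
      exact eq_intCast _ _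
  have hu : ((anchorCoords k a : ℤ) : Γ(Spec (CommRingCat.of ℤ), ⊤)) = 1 := by simp [ha]
  have h2 : ∀ t : T ⟶ Spec (CommRingCat.of ℤ), t ≫ σ =
      ptOf (fun i => (anchorCoords k i : Γ(T, ⊤)))
        (span_range_eq_top_of_eq_one a (by simp [ha])) := by
    intro t
    rw [hσ, pointOfCoords_eq_ptOf _ _ (span_range_eq_top_of_eq_one a ((h1 a).trans hu)),
      comp_ptOf_of_isUnit t _ _ (span_range_eq_top_of_eq_one a (by rw [h1, hu, map_one])) a
        (by rw [h1, hu]; exact isUnit_one)]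
    exact ptOf_congr (funext fun i => by rw [h1, map_intCast]) _ _
  constructor
  · intro h
    have e := IsClosedImmersion.lift_fac σ (ptOf c hc') h
    rw [h2] at e
    exact (ptOf_injective (by simp [ha]) hc e).symm
  · intro h
    subst h
    have := h2 (specZIsTerminal.from T)
    rw [← this]
    exact Scheme.Hom.le_ker_comp _ _

/-! ## The incidence correspondence in coordinates -/

theorem app_eq_zero_iff {S X : Scheme.{0}} (s : S ⟶ X) (U : X.Opens) (e : Γ(U, ⊤)) :
    (s.app (U.ι ''ᵁ ⊤)).hom e = 0 ↔ (s ∣_ U).appTop.hom e = 0 := by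
  rw [morphismRestrict_appTop]
  exact (map_eq_zero_iff (S.presheaf.map (eqToHom _).op).hom
    (ConcreteCategory.bijective_of_isIso _).1).symm

theorem map_sum_mul {A B C : Type*} [CommRing A] [CommRing B] [CommRing C] (f : A →+* C)
    (g : B →+* C) {p l : Fin 3 → A} {c d : Fin 3 → B} {r r' : C}
    (h : ∀ i, f (p i) = r * g (c i)) (h' : ∀ i, f (l i) = r' * g (d i)) :
    f (∑ i, p i * l i) = r * r' * g (∑ i, c i * d i) := by
  rw [map_sum, map_sum, Finset.mul_sum]
  refine Finset.sum_congr rfl fun i _ => ?_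
  rw [map_mul, map_mul, h, h']
  ring

/-- The restriction of `∑ xᵢ yᵢ` and the pulled back equation of the incidence correspondence
on a product of standard charts vanish simultaneously. -/
theorem app_sum_eq_zero_iff {S : Scheme.{0}} {a b a' b' : Fin 3} {U : (Plane ⨯ DualPlane).Opens}
    {c d : Fin 3 → Γ(U, ⊤)} (hc : c a = 1) (hd : d b = 1)
    (ec : U.ι ≫ prod.fst = ptOf c (span_range_eq_top_of_eq_one a hc))
    (ed : U.ι ≫ prod.snd = ptOf d (span_range_eq_top_of_eq_one b hd))
    {p l : Fin 3 → Γ(S, ⊤)} (hp : p a' = 1) (hl : l b' = 1) (s : S ⟶ Plane ⨯ DualPlane)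
    (hs1 : s ≫ prod.fst = ptOf p (span_range_eq_top_of_eq_one a' hp))
    (hs2 : s ≫ prod.snd = ptOf l (span_range_eq_top_of_eq_one b' hl)) :
    (s.app (U.ι ''ᵁ ⊤)).hom (∑ i, c i * d i) = 0 ↔
      (s ⁻¹ᵁ U).ι.appTop.hom (∑ i, p i * l i) = 0 := by
  have key : ∀ (a a' : Fin 3) (π : Plane ⨯ DualPlane ⟶ Plane) (c : Fin 3 → Γ(U, ⊤))
      (p : Fin 3 → Γ(S, ⊤)) (hc : c a = 1) (hp : p a' = 1)
      (_ : U.ι ≫ π = ptOf c (span_range_eq_top_of_eq_one a hc))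
      (_ : s ≫ π = ptOf p (span_range_eq_top_of_eq_one a' hp)),
      ∃ r : Γ(s ⁻¹ᵁ U, ⊤), IsUnit r ∧
        ∀ i, (s ⁻¹ᵁ U).ι.appTop.hom (p i) = r * (s ∣_ U).appTop.hom (c i) := by
    intro a a' π c p hc hp ec hs
    have e1 : ptOf (fun i => (s ∣_ U).appTop.hom (c i))
          (span_range_eq_top_of_eq_one a (by rw [hc, map_one])) =
        ptOf (fun i => (s ⁻¹ᵁ U).ι.appTop.hom (p i))
          (span_range_eq_top_of_eq_one a' (by rw [hp, map_one])) := by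
      rw [← comp_ptOf_of_isUnit (s ∣_ U) c (span_range_eq_top_of_eq_one a hc) _ a
          (hc ▸ isUnit_one), ← ec, morphismRestrict_ι_assoc, hs,
        comp_ptOf_of_isUnit (s ⁻¹ᵁ U).ι p _
          (span_range_eq_top_of_eq_one a' (by rw [hp, map_one])) a' (hp ▸ isUnit_one)]
    -- The coordinate `p a` is invertible because the same point has coordinates `c` with `c a = 1`;
    -- it is the scalar between the two normalizations.
    have hu : IsUnit ((s ⁻¹ᵁ U).ι.appTop.hom (p a)) := by
      have e2 := congrArg (fun f => f ⁻¹ᵁ Proj.basicOpen deg (MvPolynomial.X a)) e1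
      simp only [ptOf_preimage_basicOpen, hc, map_one, Scheme.basicOpen_one] at e2
      exact isUnit_of_basicOpen_eq_top e2.symm
    refine ⟨_, hu, fun i => ?_⟩
    obtain ⟨w, hw⟩ := hu.exists_left_inv
    have hw' : IsUnit w := IsUnit.of_mul_eq_one _ hw
    have e3 := ptOf_mul (c := fun i => (s ⁻¹ᵁ U).ι.appTop.hom (p i))
      (c' := fun i => w * (s ⁻¹ᵁ U).ι.appTop.hom (p i))
      (span_range_eq_top_of_eq_one a' (by rw [hp, map_one]))
      (span_range_eq_top_of_eq_one a hw) hw' (a := a) hu (fun i => rfl)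
    have e4 := congrFun (ptOf_injective (a := a) (by rw [hc, map_one]) hw (e1.trans e3)) i
    beta_reduce at e4
    rw [e4, ← mul_assoc, mul_comm _ w, hw, one_mul]
  obtain ⟨r, hr, er⟩ := key a a' prod.fst c p hc hp ec hs1
  obtain ⟨r', hr', er'⟩ := key b b' prod.snd d l hd hl ed hs2
  rw [map_sum_mul _ _ er er', (hr.mul hr').mul_right_eq_zero]
  exact app_eq_zero_iff s U _

/-- If the equation holds, `s` factors through the single chart `(a, b)`. For the converse, local
normalized coordinates give a section `∑ cᵢ dᵢ` of the product; it vanishes on all nine charts by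
`app_sum_eq_zero_iff`, hence lies in the ideal, and its pullback along `s` vanishes exactly when `∑
pᵢ lᵢ` does. -/
theorem incidenceIdeal_le_ker_iff {T : Scheme.{0}} {a b : Fin 3} {p l : Fin 3 → Γ(T, ⊤)}
    (hp : p a = 1) (hl : l b = 1) (s : T ⟶ Plane ⨯ DualPlane)
    (hs1 : s ≫ prod.fst = ptOf p (span_range_eq_top_of_eq_one a hp))
    (hs2 : s ≫ prod.snd = ptOf l (span_range_eq_top_of_eq_one b hl)) :
    incidenceIdeal ≤ s.ker ↔ ∑ i, p i * l i = 0 := by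
  have chart_fst : ∀ a' b', chartMap a' b' ≫ prod.fst =
      ptOf (fun i => (Scheme.ΓSpecIso (CommRingCat.of (ChartRing a' b'))).inv.hom
        (chartX a' b' i)) (span_range_eq_top_of_eq_one a' (by rw [chartX_eq_one, map_one])) :=
    fun a' b' => (prod.lift_fst _ _).trans (pointOfCoords_eq_ptOf _ _ _)
  have chart_snd : ∀ a' b', chartMap a' b' ≫ prod.snd =
      ptOf (fun i => (Scheme.ΓSpecIso (CommRingCat.of (ChartRing a' b'))).inv.hom
        (chartY a' b' i)) (span_range_eq_top_of_eq_one b' (by rw [chartY_eq_one, map_one])) :=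
    fun a' b' => (prod.lift_snd _ _).trans (pointOfCoords_eq_ptOf _ _ _)
  constructor
  · intro h
    let W : (Plane ⨯ DualPlane).Opens :=
      (prod.fst : Plane ⨯ DualPlane ⟶ Plane) ⁻¹ᵁ Proj.basicOpen deg (MvPolynomial.X a) ⊓
      (prod.snd : Plane ⨯ DualPlane ⟶ DualPlane) ⁻¹ᵁ Proj.basicOpen deg (MvPolynomial.X b)
    have hW : ∀ t, s t ∈ W := by
      intro t
      constructor
      · change t ∈ (s ≫ prod.fst) ⁻¹ᵁ _
        rw [hs1, ptOf_preimage_basicOpen, hp, Scheme.basicOpen_one]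
        trivial
      · change t ∈ (s ≫ prod.snd) ⁻¹ᵁ _
        rw [hs2, ptOf_preimage_basicOpen, hl, Scheme.basicOpen_one]
        trivial
    -- Sections of an ideal sheaf are taken on affine opens, so the image is covered by affine opens
    -- on which both coordinates `x_a` and `y_b` are invertible.
    choose U hU hUt hUW using fun t => exists_isAffineOpen_mem_and_subset (hW t)
    have hcov : TopologicalSpace.IsOpenCover fun t => s ⁻¹ᵁ U t := by
      rw [TopologicalSpace.IsOpenCover, eq_top_iff]
      intro t _
      exact TopologicalSpace.Opens.mem_iSup.2 ⟨t, hUt t⟩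
    refine Scheme.zero_of_zero_cover _ (T.openCoverOfIsOpenCover _ hcov) fun t => ?_
    change (s ⁻¹ᵁ U t).ι.appTop.hom _ = 0
    obtain ⟨c, hc, ec⟩ := exists_eq_ptOf ((U t).ι ≫ prod.fst) a (by
      rw [eq_top_iff]; intro x _; exact (hUW t x.2).1)
    obtain ⟨d, hd, ed⟩ := exists_eq_ptOf ((U t).ι ≫ prod.snd) b (by
      rw [eq_top_iff]; intro x _; exact (hUW t x.2).2)
    rw [← app_sum_eq_zero_iff hc hd ec ed hp hl s hs1 hs2]
    have haff : IsAffineOpen ((U t).ι ''ᵁ ⊤) := by simpa using hU t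
    refine RingHom.mem_ker.1 (Scheme.Hom.ideal_ker_le s ⟨_, haff⟩ (h ⟨_, haff⟩ ?_))
    rw [incidenceIdeal]
    simp only [Scheme.IdealSheafData.ideal_iInf, iInf_apply, Ideal.mem_iInf]
    intro a' b'
    rw [Scheme.Hom.ker_apply, RingHom.mem_ker]
    refine (app_sum_eq_zero_iff (a' := a') (b' := b') hc hd ec ed ?_ ?_ (chartMap a' b') (chart_fst a' b')
      (chart_snd a' b')).2 ?_
    · rw [chartX_eq_one, map_one]
    · rw [chartY_eq_one, map_one]
    · simp only [← map_mul, ← map_sum]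
      have : ∑ i, chartX a' b' i * chartY a' b' i = 0 := by
        simp only [chartX, chartY, ← map_mul, ← map_sum]
        exact Ideal.Quotient.eq_zero_iff_mem.2 (Ideal.subset_span (by simp))
      rw [this, map_zero, map_zero]
  · intro h
    let φ : ChartRing a b →+* Γ(T, ⊤) := Ideal.Quotient.lift (chartIdeal a b)
      (MvPolynomial.eval₂Hom (Int.castRingHom _) (Sum.elim p l)) (by
        intro x hx
        rw [← RingHom.mem_ker]
        refine (Ideal.span_le.2 ?_ : chartIdeal a b ≤ _) hx
        rintro x (rfl | rfl | rfl)
        · simp [hp]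
        · simp [hl]
        · simpa using h)
    have hφ : s = T.toSpecΓ ≫ Spec.map (CommRingCat.ofHom φ) ≫ chartMap a b := by
      have e : ∀ r : ChartRing a b, (T.toSpecΓ ≫ Spec.map (CommRingCat.ofHom φ)).appTop.hom
          ((Scheme.ΓSpecIso (CommRingCat.of (ChartRing a b))).inv.hom r) = φ r := by
        intro r
        have : (Scheme.ΓSpecIso (CommRingCat.of (ChartRing a b))).inv ≫
          (T.toSpecΓ ≫ Spec.map (CommRingCat.ofHom φ)).appTop = CommRingCat.ofHom φ := by simp
        exact DFunLike.congr_fun (congrArg CommRingCat.Hom.hom this) r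
      apply prod.hom_ext
      · rw [hs1, Category.assoc, Category.assoc, chart_fst, ← Category.assoc,
          comp_ptOf_of_isUnit _ _ _ (span_range_eq_top_of_eq_one a
            (by rw [chartX_eq_one, map_one, map_one])) a
            (by rw [chartX_eq_one, map_one]; exact isUnit_one)]
        refine ptOf_congr (funext fun i => ?_) _ _
        rw [e]
        simp [φ, chartX]
      · rw [hs2, Category.assoc, Category.assoc, chart_snd, ← Category.assoc,
          comp_ptOf_of_isUnit _ _ _ (span_range_eq_top_of_eq_one b
            (by rw [chartY_eq_one, map_one, map_one])) b
            (by rw [chartY_eq_one, map_one]; exact isUnit_one)]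
        refine ptOf_congr (funext fun i => ?_) _ _
        rw [e]
        simp [φ, chartY]
    rw [hφ, ← Category.assoc]
    refine le_trans ?_ (Scheme.Hom.le_ker_comp _ _)
    exact (iInf_le _ a).trans (iInf_le _ b)

/-! ## Normalized coordinates of configurations -/

/-- `p` and `l` are coordinates over `R` of points and lines satisfying the closed conditions of
`D`, normalized by `p i (a i) = 1` and `l j (b j) = 1`. -/
structure IsConfig (D : IncidenceData) (a : Fin D.M → Fin 3) (b : Fin D.N → Fin 3)
    {R : Type*} [CommRing R] (p : Fin D.M → Fin 3 → R) (l : Fin D.N → Fin 3 → R) : Prop where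
  pt_one : ∀ i, p i (a i) = 1
  ln_one : ∀ j, l j (b j) = 1
  anchor : ∀ k t, p (Fin.castLE D.four_le k) t = anchorCoords k t
  incident : ∀ i j, D.inc i j → ∑ t, p i t * l j t = 0

variable {D : IncidenceData} {a : Fin D.M → Fin 3} {b : Fin D.N → Fin 3}

theorem IsConfig.map {R S : Type*} [CommRing R] [CommRing S] {p : Fin D.M → Fin 3 → R}
    {l : Fin D.N → Fin 3 → R} (h : IsConfig D a b p l) (f : R →+* S) :
    IsConfig D a b (fun i t => f (p i t)) (fun j t => f (l j t)) where
  pt_one i := by rw [h.pt_one, map_one]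
  ln_one j := by rw [h.ln_one, map_one]
  anchor k t := by rw [h.anchor, map_intCast]
  incident i j hij := by
    rw [← map_zero f, ← h.incident i j hij, map_sum]
    exact Finset.sum_congr rfl fun t _ => (map_mul _ _ _).symm

variable (D a b) in
/-- The equations of the universal configuration. -/
def configIdeal : Ideal (MvPolynomial ((Fin D.M ⊕ Fin D.N) × Fin 3) ℤ) :=
  Ideal.span {f | (∃ i, f = MvPolynomial.X (Sum.inl i, a i) - 1) ∨
    (∃ j, f = MvPolynomial.X (Sum.inr j, b j) - 1) ∨
    (∃ k t, f = MvPolynomial.X (Sum.inl (Fin.castLE D.four_le k), t) -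
      MvPolynomial.C (anchorCoords k t)) ∨
    (∃ i j, D.inc i j ∧
      f = ∑ t, MvPolynomial.X (Sum.inl i, t) * MvPolynomial.X (Sum.inr j, t))}

variable (D a b) in
/-- The ring of the universal configuration. -/
abbrev ConfigRing : Type :=
  MvPolynomial ((Fin D.M ⊕ Fin D.N) × Fin 3) ℤ ⧸ configIdeal D a b

variable (D a b) in
/-- The points of the universal configuration. -/
def univPt (i : Fin D.M) (t : Fin 3) : ConfigRing D a b :=
  Ideal.Quotient.mk _ (MvPolynomial.X (Sum.inl i, t))

variable (D a b) in
/-- The lines of the universal configuration. -/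
def univLn (j : Fin D.N) (t : Fin 3) : ConfigRing D a b :=
  Ideal.Quotient.mk _ (MvPolynomial.X (Sum.inr j, t))

variable (D a b) in
theorem isConfig_univ : IsConfig D a b (univPt D a b) (univLn D a b) where
  pt_one i := by
    rw [univPt, ← map_one (Ideal.Quotient.mk _), Ideal.Quotient.eq]
    exact Ideal.subset_span (Or.inl ⟨i, rfl⟩)
  ln_one j := by
    rw [univLn, ← map_one (Ideal.Quotient.mk _), Ideal.Quotient.eq]
    exact Ideal.subset_span (Or.inr (Or.inl ⟨j, rfl⟩))
  anchor k t := by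
    rw [univPt, ← map_intCast (Ideal.Quotient.mk (configIdeal D a b)), Ideal.Quotient.eq]
    exact Ideal.subset_span (Or.inr (Or.inr (Or.inl ⟨k, t, by simp⟩)))
  incident i j hij := by
    have : Ideal.Quotient.mk (configIdeal D a b)
        (∑ t, MvPolynomial.X (Sum.inl i, t) * MvPolynomial.X (Sum.inr j, t)) = 0 :=
      Ideal.Quotient.eq_zero_iff_mem.2
        (Ideal.subset_span (Or.inr (Or.inr (Or.inr ⟨i, j, hij, rfl⟩))))
    rw [map_sum] at this
    rw [← this]
    exact Finset.sum_congr rfl fun t _ => (map_mul _ _ _).symm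

/-- The homomorphism from the universal configuration ring given by a configuration. -/
def IsConfig.hom {R : Type*} [CommRing R] {p : Fin D.M → Fin 3 → R}
    {l : Fin D.N → Fin 3 → R} (h : IsConfig D a b p l) : ConfigRing D a b →+* R :=
  Ideal.Quotient.lift _ (MvPolynomial.eval₂Hom (Int.castRingHom R)
      fun x => Sum.elim p l x.1 x.2) <| by
    intro f hf
    have : configIdeal D a b ≤ RingHom.ker (MvPolynomial.eval₂Hom (Int.castRingHom R)
        fun x : (Fin D.M ⊕ Fin D.N) × Fin 3 => Sum.elim p l x.1 x.2) := by
      refine Ideal.span_le.2 ?_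
      rintro f (⟨i, rfl⟩ | ⟨j, rfl⟩ | ⟨k, t, rfl⟩ | ⟨i, j, hij, rfl⟩) <;>
        rw [SetLike.mem_coe, RingHom.mem_ker]
      · simp [h.pt_one]
      · simp [h.ln_one]
      · rw [map_sub, MvPolynomial.eval₂Hom_C, MvPolynomial.eval₂Hom_X']
        simp [h.anchor]
      · simp [← h.incident i j hij]
    exact this hf

@[simp]
theorem IsConfig.hom_univPt {R : Type*} [CommRing R] {p : Fin D.M → Fin 3 → R}
    {l : Fin D.N → Fin 3 → R} (h : IsConfig D a b p l) (i : Fin D.M) (t : Fin 3) :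
    h.hom (univPt D a b i t) = p i t :=
  (Ideal.Quotient.lift_mk _ _ _).trans (MvPolynomial.eval₂Hom_X' _ _ _)

@[simp]
theorem IsConfig.hom_univLn {R : Type*} [CommRing R] {p : Fin D.M → Fin 3 → R}
    {l : Fin D.N → Fin 3 → R} (h : IsConfig D a b p l) (j : Fin D.N) (t : Fin 3) :
    h.hom (univLn D a b j t) = l j t :=
  (Ideal.Quotient.lift_mk _ _ _).trans (MvPolynomial.eval₂Hom_X' _ _ _)

theorem configRing_hom_ext {R : Type*} [CommRing R] {f g : ConfigRing D a b →+* R}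
    (hp : ∀ i t, f (univPt D a b i t) = g (univPt D a b i t))
    (hl : ∀ j t, f (univLn D a b j t) = g (univLn D a b j t)) : f = g := by
  refine Ideal.Quotient.ringHom_ext (MvPolynomial.ringHom_ext (fun n => by simp) ?_)
  rintro ⟨i | j, t⟩
  · exact hp i t
  · exact hl j t

/-! ## Configurations as morphisms -/

section
variable {T : Scheme.{0}} {p : Fin D.M → Fin 3 → Γ(T, ⊤)} {l : Fin D.N → Fin 3 → Γ(T, ⊤)}

/-- The morphism to the ambient product given by normalized coordinates. -/
def ambientMap (hp : ∀ i, p i (a i) = 1) (hl : ∀ j, l j (b j) = 1) : T ⟶ D.ambient :=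
  prod.lift (Pi.lift fun i => ptOf (p i) (span_range_eq_top_of_eq_one (a i) (hp i)))
    (Pi.lift fun j => ptOf (l j) (span_range_eq_top_of_eq_one (b j) (hl j)))

theorem ambientMap_pt (hp : ∀ i, p i (a i) = 1) (hl : ∀ j, l j (b j) = 1) (i : Fin D.M) :
    ambientMap hp hl ≫ D.pt i = ptOf (p i) (span_range_eq_top_of_eq_one (a i) (hp i)) := by
  rw [ambientMap, IncidenceData.pt, prod.lift_fst_assoc, Pi.lift_π]

theorem ambientMap_ln (hp : ∀ i, p i (a i) = 1) (hl : ∀ j, l j (b j) = 1) (j : Fin D.N) :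
    ambientMap hp hl ≫ D.ln j = ptOf (l j) (span_range_eq_top_of_eq_one (b j) (hl j)) := by
  rw [ambientMap, IncidenceData.ln, prod.lift_snd_assoc, Pi.lift_π]

theorem ambient_hom_ext {f g : T ⟶ D.ambient} (hp : ∀ i, f ≫ D.pt i = g ≫ D.pt i)
    (hl : ∀ j, f ≫ D.ln j = g ≫ D.ln j) : f = g := by
  refine Limits.prod.hom_ext (Limits.Pi.hom_ext _ _ fun i => ?_) (Limits.Pi.hom_ext _ _ fun j => ?_)
  · simpa [IncidenceData.pt] using hp i
  · simpa [IncidenceData.ln] using hl j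

theorem onLine_le_ker_iff (s : T ⟶ D.ambient) (hp : ∀ i, p i (a i) = 1) (hl : ∀ j, l j (b j) = 1)
    (hs : ∀ i, s ≫ D.pt i = ptOf (p i) (span_range_eq_top_of_eq_one (a i) (hp i)))
    (hs' : ∀ j, s ≫ D.ln j = ptOf (l j) (span_range_eq_top_of_eq_one (b j) (hl j)))
    (i : Fin D.M) (j : Fin D.N) :
    D.onLine i j ≤ s.ker ↔ ∑ t, p i t * l j t = 0 := by
  rw [IncidenceData.onLine, comap_le_ker_iff]
  refine incidenceIdeal_le_ker_iff (hp i) (hl j) _ ?_ ?_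
  · rw [Category.assoc, prod.lift_fst, hs]
  · rw [Category.assoc, prod.lift_snd, hs']

/-- The hypothesis `ha` lets the first four points be normalized at an index where the anchor has
coordinate one, so that equality of points becomes equality of coordinates. -/
theorem closedIdeal_le_ker_iff (ha : ∀ k, anchorCoords k (a (Fin.castLE D.four_le k)) = 1)
    (s : T ⟶ D.ambient) (hp : ∀ i, p i (a i) = 1) (hl : ∀ j, l j (b j) = 1)
    (hs : ∀ i, s ≫ D.pt i = ptOf (p i) (span_range_eq_top_of_eq_one (a i) (hp i)))
    (hs' : ∀ j, s ≫ D.ln j = ptOf (l j) (span_range_eq_top_of_eq_one (b j) (hl j))) :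
    D.closedIdeal ≤ s.ker ↔ IsConfig D a b p l := by
  rw [IncidenceData.closedIdeal, sup_le_iff]
  simp only [iSup_le_iff, onLine_le_ker_iff s hp hl hs hs', comap_le_ker_iff, hs,
    anchorIdeal_le_ker_iff _ _ (ha _) _ (hp _)]
  exact ⟨fun h => ⟨hp, hl, fun k t => congrFun (h.1 k) t, h.2⟩,
    fun h => ⟨fun k => funext fun t => h.anchor k t, h.incident⟩⟩

/-- The morphism to the closed locus given by a configuration. -/
def IsConfig.toClosed (ha : ∀ k, anchorCoords k (a (Fin.castLE D.four_le k)) = 1)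
    (h : IsConfig D a b p l) : T ⟶ D.closedIdeal.subscheme :=
  IsClosedImmersion.lift D.closedIdeal.subschemeι (ambientMap h.pt_one h.ln_one) <| by
    rw [Scheme.IdealSheafData.ker_subschemeι]
    exact (closedIdeal_le_ker_iff ha _ h.pt_one h.ln_one (ambientMap_pt _ _)
      (ambientMap_ln _ _)).2 h

theorem IsConfig.toClosed_ι (ha : ∀ k, anchorCoords k (a (Fin.castLE D.four_le k)) = 1)
    (h : IsConfig D a b p l) :
    h.toClosed ha ≫ D.closedIdeal.subschemeι = ambientMap h.pt_one h.ln_one :=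
  IsClosedImmersion.lift_fac _ _ _

theorem comp_ptOf_of_eq_one {S T : Scheme.{0}} (g : S ⟶ T) (c : Fin 3 → Γ(T, ⊤)) (a : Fin 3)
    (hc : c a = 1) :
    g ≫ ptOf c (span_range_eq_top_of_eq_one a hc) = ptOf (fun i => g.appTop.hom (c i))
      (span_range_eq_top_of_eq_one a (by rw [hc, map_one])) :=
  comp_ptOf_of_isUnit g c _ _ a (hc ▸ isUnit_one)

theorem IsConfig.comp_toClosed {S : Scheme.{0}}
    (ha : ∀ k, anchorCoords k (a (Fin.castLE D.four_le k)) = 1)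
    (h : IsConfig D a b p l) (g : S ⟶ T) :
    g ≫ h.toClosed ha = (h.map g.appTop.hom).toClosed ha := by
  rw [← cancel_mono D.closedIdeal.subschemeι, Category.assoc, toClosed_ι, toClosed_ι]
  refine ambient_hom_ext (fun i => ?_) fun j => ?_
  · rw [Category.assoc, ambientMap_pt, ambientMap_pt, comp_ptOf_of_eq_one _ _ (a i) (h.pt_one i)]
  · rw [Category.assoc, ambientMap_ln, ambientMap_ln, comp_ptOf_of_eq_one _ _ (b j) (h.ln_one j)]

theorem IsConfig.eq_of_toClosed_eq {p' : Fin D.M → Fin 3 → Γ(T, ⊤)}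
    {l' : Fin D.N → Fin 3 → Γ(T, ⊤)}
    (ha : ∀ k, anchorCoords k (a (Fin.castLE D.four_le k)) = 1)
    (h : IsConfig D a b p l) (h' : IsConfig D a b p' l') (e : h.toClosed ha = h'.toClosed ha) :
    p = p' ∧ l = l' := by
  have e' := congrArg (· ≫ D.closedIdeal.subschemeι) e
  simp only [toClosed_ι] at e'
  constructor
  · funext i
    have := congrArg (· ≫ D.pt i) e'
    simp only [ambientMap_pt] at this
    exact ptOf_injective (h.pt_one i) (h'.pt_one i) this
  · funext j
    have := congrArg (· ≫ D.ln j) e'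
    simp only [ambientMap_ln] at this
    exact ptOf_injective (h.ln_one j) (h'.ln_one j) this

end

/-! ### The affine chart of the closed locus -/

section
variable (ha : ∀ k, anchorCoords k (a (Fin.castLE D.four_le k)) = 1)

/-- The universal configuration over `Spec` of the universal configuration ring. -/
theorem isConfig_spec : IsConfig D a b
    (fun i t => (Scheme.ΓSpecIso (CommRingCat.of (ConfigRing D a b))).inv.hom (univPt D a b i t))
    (fun j t => (Scheme.ΓSpecIso (CommRingCat.of (ConfigRing D a b))).inv.hom
      (univLn D a b j t)) :=
  (isConfig_univ D a b).map _

/-- The chart of the closed locus of normalized configurations. -/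
def configChart : Spec (CommRingCat.of (ConfigRing D a b)) ⟶ D.closedIdeal.subscheme :=
  (isConfig_spec (a := a) (b := b)).toClosed ha

/-- The morphism to the universal configuration given by a configuration. -/
def IsConfig.toSpec {T : Scheme.{0}} {p : Fin D.M → Fin 3 → Γ(T, ⊤)}
    {l : Fin D.N → Fin 3 → Γ(T, ⊤)} (h : IsConfig D a b p l) :
    T ⟶ Spec (CommRingCat.of (ConfigRing D a b)) :=
  T.toSpecΓ ≫ Spec.map (CommRingCat.ofHom h.hom)

theorem IsConfig.toSpec_appTop {T : Scheme.{0}} {p : Fin D.M → Fin 3 → Γ(T, ⊤)}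
    {l : Fin D.N → Fin 3 → Γ(T, ⊤)} (h : IsConfig D a b p l) (x : ConfigRing D a b) :
    h.toSpec.appTop.hom
      ((Scheme.ΓSpecIso (CommRingCat.of (ConfigRing D a b))).inv.hom x) = h.hom x := by
  have : (Scheme.ΓSpecIso (CommRingCat.of (ConfigRing D a b))).inv ≫ h.toSpec.appTop =
      CommRingCat.ofHom h.hom := by
    simp [toSpec]
  exact congrArg (fun z : CommRingCat.of (ConfigRing D a b) ⟶ Γ(T, ⊤) => z.hom x) this

theorem IsConfig.toClosed_congr {T : Scheme.{0}} {p p' : Fin D.M → Fin 3 → Γ(T, ⊤)}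
    {l l' : Fin D.N → Fin 3 → Γ(T, ⊤)} (h : IsConfig D a b p l) (h' : IsConfig D a b p' l')
    (hp : p = p') (hl : l = l') : h.toClosed ha = h'.toClosed ha := by
  subst hp hl; rfl

theorem IsConfig.toSpec_configChart {T : Scheme.{0}} {p : Fin D.M → Fin 3 → Γ(T, ⊤)}
    {l : Fin D.N → Fin 3 → Γ(T, ⊤)} (h : IsConfig D a b p l) :
    h.toSpec ≫ configChart ha = h.toClosed ha := by
  rw [configChart, comp_toClosed]
  refine toClosed_congr ha _ _ ?_ ?_
  · funext i t
    rw [toSpec_appTop, hom_univPt]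
  · funext j t
    rw [toSpec_appTop, hom_univLn]

/-- Normalized coordinates are determined by the points and lines, and they generate the
configuration ring. -/
theorem mono_configChart : Mono (configChart (b := b) ha) := by
  constructor
  intro T f g e
  rw [configChart, IsConfig.comp_toClosed, IsConfig.comp_toClosed] at e
  obtain ⟨e1, e2⟩ := IsConfig.eq_of_toClosed_eq ha _ _ e
  apply ext_of_isAffine
  rw [← cancel_epi (Scheme.ΓSpecIso (CommRingCat.of (ConfigRing D a b))).inv]
  ext1
  refine configRing_hom_ext (fun i t => ?_) fun j t => ?_
  · exact congrFun (congrFun e1 i) t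
  · exact congrFun (congrFun e2 j) t

variable (a b) in
/-- The open part of the closed locus where the normalizations are possible. -/
def normalizedLocus : D.closedIdeal.subscheme.Opens :=
  (⨅ i, (D.closedIdeal.subschemeι ≫ D.pt i) ⁻¹ᵁ Proj.basicOpen deg (MvPolynomial.X (a i))) ⊓
    ⨅ j, (D.closedIdeal.subschemeι ≫ D.ln j) ⁻¹ᵁ Proj.basicOpen deg (MvPolynomial.X (b j))

theorem mem_normalizedLocus (x : D.closedIdeal.subscheme) : x ∈ normalizedLocus a b ↔
    (∀ i, x ∈ (D.closedIdeal.subschemeι ≫ D.pt i) ⁻¹ᵁ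
      Proj.basicOpen deg (MvPolynomial.X (a i))) ∧
    ∀ j, x ∈ (D.closedIdeal.subschemeι ≫ D.ln j) ⁻¹ᵁ
      Proj.basicOpen deg (MvPolynomial.X (b j)) := by
  rw [normalizedLocus, ← SetLike.mem_coe, TopologicalSpace.Opens.coe_inf,
    TopologicalSpace.Opens.coe_iInf, TopologicalSpace.Opens.coe_iInf, Set.mem_inter_iff,
    Set.mem_iInter, Set.mem_iInter]
  rfl

theorem range_toClosed_subset {T : Scheme.{0}} {p : Fin D.M → Fin 3 → Γ(T, ⊤)}
    {l : Fin D.N → Fin 3 → Γ(T, ⊤)} (h : IsConfig D a b p l) :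
    Set.range (h.toClosed ha) ⊆ normalizedLocus a b := by
  rintro _ ⟨x, rfl⟩
  refine (mem_normalizedLocus _).2 ⟨fun i => ?_, fun j => ?_⟩
  · change x ∈ (h.toClosed ha ≫ D.closedIdeal.subschemeι ≫ D.pt i) ⁻¹ᵁ _
    rw [← Category.assoc, h.toClosed_ι, ambientMap_pt, ptOf_preimage_basicOpen, h.pt_one,
      Scheme.basicOpen_of_isUnit _ isUnit_one]
    trivial
  · change x ∈ (h.toClosed ha ≫ D.closedIdeal.subschemeι ≫ D.ln j) ⁻¹ᵁ _
    rw [← Category.assoc, h.toClosed_ι, ambientMap_ln, ptOf_preimage_basicOpen, h.ln_one,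
      Scheme.basicOpen_of_isUnit _ isUnit_one]
    trivial

/-- On the open set where the chosen coordinates are invertible, the tautological points and lines
can be normalized. They form a configuration, whose `toSpec` is inverse to the chart. -/
theorem isOpenImmersion_configChart : IsOpenImmersion (configChart (b := b) ha) := by
  have hmono := mono_configChart (b := b) ha
  set U := normalizedLocus a b
  have h1 : ∀ i, (U.ι ≫ D.closedIdeal.subschemeι ≫ D.pt i) ⁻¹ᵁ
      Proj.basicOpen deg (MvPolynomial.X (a i)) = ⊤ := fun i =>
    top_unique fun x _ => ((mem_normalizedLocus x.1).1 x.2).1 i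
  have h2 : ∀ j, (U.ι ≫ D.closedIdeal.subschemeι ≫ D.ln j) ⁻¹ᵁ
      Proj.basicOpen deg (MvPolynomial.X (b j)) = ⊤ := fun j =>
    top_unique fun x _ => ((mem_normalizedLocus x.1).1 x.2).2 j
  choose p hp ep using fun i => exists_eq_ptOf _ (a i) (h1 i)
  choose l hl el using fun j => exists_eq_ptOf _ (b j) (h2 j)
  have hs : ∀ i, (U.ι ≫ D.closedIdeal.subschemeι) ≫ D.pt i =
    ptOf (p i) (span_range_eq_top_of_eq_one (a i) (hp i)) := fun i => by
      rw [Category.assoc, ep]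
  have hs' : ∀ j, (U.ι ≫ D.closedIdeal.subschemeι) ≫ D.ln j =
    ptOf (l j) (span_range_eq_top_of_eq_one (b j) (hl j)) := fun j => by
      rw [Category.assoc, el]
  have hcfg : IsConfig D a b p l := by
    refine (closedIdeal_le_ker_iff ha (U.ι ≫ D.closedIdeal.subschemeι) hp hl hs hs').1 ?_
    refine le_trans (le_of_eq ?_) (Scheme.Hom.le_ker_comp _ _)
    rw [Scheme.IdealSheafData.ker_subschemeι]
  have hU : hcfg.toClosed ha = U.ι := by
    rw [← cancel_mono D.closedIdeal.subschemeι, hcfg.toClosed_ι]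
    refine ambient_hom_ext (fun i => ?_) fun j => ?_
    · rw [ambientMap_pt, hs]
    · rw [ambientMap_ln, hs']
  have hr : Set.range (configChart (b := b) ha) ⊆ Set.range U.ι := by
    rw [Scheme.Opens.range_ι]
    exact range_toClosed_subset ha isConfig_spec
  let ψ := IsOpenImmersion.lift U.ι (configChart (b := b) ha) hr
  have hψ : ψ ≫ U.ι = configChart (b := b) ha := IsOpenImmersion.lift_fac _ _ _
  have hq : hcfg.toSpec ≫ configChart ha = U.ι := (hcfg.toSpec_configChart ha).trans hU
  have : IsIso ψ := by
    refine ⟨hcfg.toSpec, ?_, ?_⟩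
    · rw [← cancel_mono (configChart (b := b) ha), Category.assoc, hq, hψ, Category.id_comp]
    · rw [← cancel_mono U.ι, Category.assoc, hψ, hq, Category.id_comp]
  rw [← hψ]
  infer_instance

end

/-! ## Open conditions in coordinates -/

/-- Coordinates of equal points are proportional, so all two-by-two minors vanish; a nonzero minor
in `IsOpenConfig` therefore separates points or lines. -/
theorem mul_eq_mul_of_ptOf_eq {T : Scheme.{0}} {c c' : Fin 3 → Γ(T, ⊤)} {a b : Fin 3}
    (hc : c a = 1) (hc' : c' b = 1)
    (e : ptOf c (span_range_eq_top_of_eq_one a hc) =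
      ptOf c' (span_range_eq_top_of_eq_one b hc')) (s t : Fin 3) :
    c s * c' t = c t * c' s := by
  have hu : IsUnit (c b) := by
    apply isUnit_of_basicOpen_eq_top
    rw [← ptOf_preimage_basicOpen c (span_range_eq_top_of_eq_one a hc), e,
      ptOf_preimage_basicOpen, hc', Scheme.basicOpen_of_isUnit _ isUnit_one]
  obtain ⟨w, hw⟩ := hu.exists_left_inv
  have e3 := ptOf_mul (c := c) (c' := fun i => w * c i) (span_range_eq_top_of_eq_one a hc)
    (span_range_eq_top_of_eq_one b hw) (a := b) (IsUnit.of_mul_eq_one _ hw) hu (fun i => rfl)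
  have e4 := ptOf_injective (a := b) hc' hw (e.symm.trans e3)
  rw [e4]
  ring

/-- The coordinates `p` and `l` satisfy the open conditions of `D`. -/
structure IsOpenConfig (D : IncidenceData) {K : Type*} [CommRing K]
    (p : Fin D.M → Fin 3 → K) (l : Fin D.N → Fin 3 → K) : Prop where
  not_incident : ∀ i j, ¬ D.inc i j → ∑ t, p i t * l j t ≠ 0
  pt_ne : ∀ i i', i ≠ i' → ∃ s t, p i s * p i' t ≠ p i t * p i' s
  ln_ne : ∀ j j', j ≠ j' → ∃ s t, l j s * l j' t ≠ l j t * l j' s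

variable {D : IncidenceData} {a : Fin D.M → Fin 3} {b : Fin D.N → Fin 3}

theorem IsOpenConfig.map {R S : Type*} [CommRing R] [CommRing S] {p : Fin D.M → Fin 3 → R}
    {l : Fin D.N → Fin 3 → R} (h : IsOpenConfig D p l) (f : R →+* S)
    (hf : Function.Injective f) :
    IsOpenConfig D (fun i t => f (p i t)) (fun j t => f (l j t)) where
  not_incident i j hij e := h.not_incident i j hij <| hf <| by
    rw [map_zero, ← e, map_sum]
    exact Finset.sum_congr rfl fun t _ => map_mul _ _ _
  pt_ne i i' hi := by
    obtain ⟨s, t, hst⟩ := h.pt_ne i i' hi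
    exact ⟨s, t, fun e => hst (hf (by rw [map_mul, map_mul, e]))⟩
  ln_ne i i' hi := by
    obtain ⟨s, t, hst⟩ := h.ln_ne i i' hi
    exact ⟨s, t, fun e => hst (hf (by rw [map_mul, map_mul, e]))⟩

theorem mem_iInf_prop {X : Type*} [TopologicalSpace X] {P : Prop}
    (U : P → TopologicalSpace.Opens X) (x : X) :
    x ∈ ((⨅ h, U h : TopologicalSpace.Opens X) : Set X) ↔ ∀ h, x ∈ U h := by
  by_cases h : P
  · rw [iInf_pos h]
    exact ⟨fun hx _ => hx, fun hx => hx h⟩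
  · rw [iInf_neg h]
    exact ⟨fun _ h' => (h h').elim, fun _ => trivial⟩

theorem mem_openLocus (x : D.ambient) : x ∈ D.openLocus ↔
    (∀ i j, ¬ D.inc i j → x ∉ (D.onLine i j).support) ∧
    (∀ i i', i ≠ i' →
      x ∉ ((diagonalIdeal Plane).comap (prod.lift (D.pt i) (D.pt i'))).support) ∧
    ∀ j j', j ≠ j' →
      x ∉ ((diagonalIdeal DualPlane).comap (prod.lift (D.ln j) (D.ln j'))).support := by
  rw [IncidenceData.openLocus]
  simp only [← SetLike.mem_coe (A := D.ambient.Opens), TopologicalSpace.Opens.coe_inf,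
    TopologicalSpace.Opens.coe_iInf, Set.mem_inter_iff, Set.mem_iInter, mem_iInf_prop, and_assoc]
  rfl

/-- If the point were in a forbidden closed set, `le_ker_of_mem_support` would give an ideal
containment, that is, an incidence or a coincidence in coordinates. -/
theorem toClosed_mem_openLocus {K : Type} [Field K]
    {p : Fin D.M → Fin 3 → Γ(Spec (CommRingCat.of K), ⊤)}
    {l : Fin D.N → Fin 3 → Γ(Spec (CommRingCat.of K), ⊤)}
    (ha : ∀ k, anchorCoords k (a (Fin.castLE D.four_le k)) = 1)
    (h : IsConfig D a b p l) (ho : IsOpenConfig D p l) (x : Spec (CommRingCat.of K)) :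
    h.toClosed ha x ∈ D.closedIdeal.subschemeι ⁻¹ᵁ D.openLocus := by
  have hx : D.closedIdeal.subschemeι (h.toClosed ha x) = ambientMap h.pt_one h.ln_one x := by
    rw [← h.toClosed_ι ha]
    rfl
  change D.closedIdeal.subschemeι (h.toClosed ha x) ∈ D.openLocus
  rw [hx, mem_openLocus]
  have key : ∀ {I : D.ambient.IdealSheafData}, ambientMap h.pt_one h.ln_one x ∈ I.support →
      I ≤ (ambientMap h.pt_one h.ln_one).ker := fun hI =>
    le_ker_of_mem_support _ fun t => by rwa [Subsingleton.elim t x]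
  refine ⟨fun i j hij hI => ?_, fun i i' hi hI => ?_, fun i i' hi hI => ?_⟩
  · exact ho.not_incident i j hij ((onLine_le_ker_iff _ h.pt_one h.ln_one (ambientMap_pt _ _)
      (ambientMap_ln _ _) i j).1 (key hI))
  · obtain ⟨s, t, hst⟩ := ho.pt_ne i i' hi
    have h1 := (comap_le_ker_iff _ _ _).1 (key hI)
    rw [prod.comp_lift, ambientMap_pt, ambientMap_pt] at h1
    exact hst (mul_eq_mul_of_ptOf_eq (h.pt_one i) (h.pt_one i') (eq_of_diagonalIdeal_le _ _ h1) s t)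
  · obtain ⟨s, t, hst⟩ := ho.ln_ne i i' hi
    have h1 := (comap_le_ker_iff _ _ _).1 (key hI)
    rw [prod.comp_lift, ambientMap_ln, ambientMap_ln] at h1
    exact hst (mul_eq_mul_of_ptOf_eq (h.ln_one i) (h.ln_one i') (eq_of_diagonalIdeal_le _ _ h1) s t)

/-! ## From configurations over fields to singularity types -/

theorem smoothCovers_of_isOpenImmersion {X Y : Scheme.{0}} (f : X ⟶ Y) [IsOpenImmersion f]
    (x : X) : SmoothCovers ⟨X, x⟩ ⟨Y, f x⟩ :=
  ⟨f, inferInstance, rfl⟩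

theorem SameSingularityType.symm' {A B : PointedScheme} (h : SameSingularityType A B) :
    SameSingularityType B A := Relation.EqvGen.symm _ _ h

theorem SameSingularityType.trans' {A B C : PointedScheme} (h : SameSingularityType A B)
    (h' : SameSingularityType B C) : SameSingularityType A C := Relation.EqvGen.trans _ _ _ h h'

theorem SmoothCovers.same {A B : PointedScheme} (h : SmoothCovers A B) :
    SameSingularityType A B := Relation.EqvGen.rel _ _ h

/-- The coproduct, the incidence scheme, the closed locus and the chart are linked by open
immersions, which are smooth; the point defined over `K` lies in all of them. -/
theorem exists_sameSingularityType_configChart {K : Type} [Field K] {p : Fin D.M → Fin 3 → K}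
    {l : Fin D.N → Fin 3 → K} (ha : ∀ k, anchorCoords k (a (Fin.castLE D.four_le k)) = 1)
    (h : IsConfig D a b p l) (ho : IsOpenConfig D p l) (x : Spec (CommRingCat.of K)) :
    ∃ P : (∐ fun D : IncidenceData => D.incidenceScheme : Scheme.{0}),
      SameSingularityType ⟨_, P⟩ ⟨Spec (CommRingCat.of (ConfigRing D a b)),
        Spec.map (CommRingCat.ofHom h.hom) x⟩ := by
  have := isOpenImmersion_configChart (b := b) ha
  set e := (Scheme.ΓSpecIso (CommRingCat.of K)).inv.hom
  have he : Function.Injective e := e.injective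
  have hc : (Spec.map (CommRingCat.ofHom h.hom) ≫ configChart ha) = (h.map e).toClosed ha := by
    rw [← (h.map e).toSpec_configChart ha]
    congr 1
    apply ext_of_isAffine
    rw [← cancel_epi (Scheme.ΓSpecIso (CommRingCat.of (ConfigRing D a b))).inv]
    ext1
    refine RingHom.ext fun z => ?_
    refine Eq.trans ?_ ((h.map e).toSpec_appTop z).symm
    rw [← Scheme.ΓSpecIso_inv_naturality]
    refine congrArg (fun f : ConfigRing D a b →+* Γ(Spec (CommRingCat.of K), ⊤) => f z)
      (configRing_hom_ext (f := e.comp h.hom) (g := (h.map e).hom) (fun i t => ?_) fun j t => ?_)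
    · rw [RingHom.comp_apply, h.hom_univPt, (h.map e).hom_univPt]
    · rw [RingHom.comp_apply, h.hom_univLn, (h.map e).hom_univLn]
  have hm := toClosed_mem_openLocus ha (h.map e) (ho.map e he) x
  let Z' : D.closedIdeal.subscheme.Opens := D.closedIdeal.subschemeι ⁻¹ᵁ D.openLocus
  let P : D.incidenceScheme := ⟨(h.map e).toClosed ha x, hm⟩
  refine ⟨Sigma.ι (fun D : IncidenceData => D.incidenceScheme) D P, ?_⟩
  refine (smoothCovers_of_isOpenImmersion
    (Sigma.ι (fun D : IncidenceData => D.incidenceScheme) D) P).same.symm'.trans' ?_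
  refine (smoothCovers_of_isOpenImmersion Z'.ι P).same.trans' ?_
  have hP : Z'.ι P = configChart ha (Spec.map (CommRingCat.ofHom h.hom) x) := by
    change (h.map e).toClosed ha x = _
    rw [← hc]
    rfl
  rw [hP]
  exact (smoothCovers_of_isOpenImmersion (configChart (b := b) ha) _).same.symm'

/-- A configuration over `K` of some incidence data `D` satisfying the open conditions, and a
smooth homomorphism from `A` to a localization of the configuration ring inducing `φ`. -/
def HasSmoothConfig {A : Type} [CommRing A] {K : Type} [Field K] (φ : A →+* K) : Prop :=
  ∃ (D : IncidenceData) (a : Fin D.M → Fin 3) (b : Fin D.N → Fin 3)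
    (p : Fin D.M → Fin 3 → K) (l : Fin D.N → Fin 3 → K)
    (_ : ∀ k, anchorCoords k (a (Fin.castLE D.four_le k)) = 1)
    (hc : IsConfig D a b p l) (_ : IsOpenConfig D p l) (h : ConfigRing D a b)
    (j : A →+* Localization.Away h) (_ : j.Smooth) (θ : Localization.Away h →+* K),
    θ.comp (algebraMap _ _) = hc.hom ∧ θ.comp j = φ

theorem HasSmoothConfig.exists_sameSingularityType {A : Type} [CommRing A] {K : Type} [Field K]
    {φ : A →+* K} (H : HasSmoothConfig φ) (x : Spec (CommRingCat.of K)) :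
    ∃ P : (∐ fun D : IncidenceData => D.incidenceScheme : Scheme.{0}),
      SameSingularityType ⟨_, P⟩ ⟨Spec (CommRingCat.of A),
        Spec.map (CommRingCat.ofHom φ) x⟩ := by
  obtain ⟨D, a, b, p, l, ha, hc, ho, h, j, hj, θ, h1, h2⟩ := H
  obtain ⟨P, hP⟩ := exists_sameSingularityType_configChart ha hc ho x
  refine ⟨P, hP.trans' ?_⟩
  let y := Spec.map (CommRingCat.ofHom θ) x
  have h3 : Spec.map (CommRingCat.ofHom hc.hom) x =
      Spec.map (CommRingCat.ofHom (algebraMap (ConfigRing D a b) (Localization.Away h))) y := by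
    rw [← h1, CommRingCat.ofHom_comp, Spec.map_comp]
    rfl
  have h4 : Spec.map (CommRingCat.ofHom φ) x = Spec.map (CommRingCat.ofHom j) y := by
    rw [← h2, CommRingCat.ofHom_comp, Spec.map_comp]
    rfl
  rw [h3, h4]
  have h5 : Smooth (Spec.map (CommRingCat.ofHom j)) :=
    (HasRingHomProperty.Spec_iff (P := @Smooth)).2 hj
  have h6 : IsOpenImmersion (Spec.map (CommRingCat.ofHom
    (algebraMap (ConfigRing D a b) (Localization.Away h)))) := inferInstance
  exact (smoothCovers_of_isOpenImmersion (Spec.map (CommRingCat.ofHom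
    (algebraMap (ConfigRing D a b) (Localization.Away h)))) y).same.symm'.trans'
    (SmoothCovers.same ⟨_, h5, rfl⟩)

/-- The residue field may be finite; its algebraic closure has the same kernel on `A` and enough
elements for the generic choices below. -/
theorem exists_infinite_field_point (A : Type) [CommRing A] (q : PrimeSpectrum A) :
    ∃ (K : Type) (_ : Field K) (_ : Infinite K) (φ : A →+* K) (x : Spec (CommRingCat.of K)),
      Spec.map (CommRingCat.ofHom φ) x = q := by
  let k := q.asIdeal.ResidueField
  let K := AlgebraicClosure k
  let φ : A →+* K := (algebraMap k K).comp (algebraMap A k)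
  refine ⟨K, inferInstance, inferInstance, φ, (⊥ : PrimeSpectrum K),
    PrimeSpectrum.ext ?_⟩
  ext z
  change φ z ∈ (⊥ : Ideal K) ↔ z ∈ q.asIdeal
  rw [Ideal.mem_bot, RingHom.comp_apply, map_eq_zero_iff _ (algebraMap k K).injective,
    Ideal.algebraMap_residueField_eq_zero]

/-- An affine neighbourhood has the same singularity type at the point, and its ring of sections is
of finite type over `ℤ`. -/
theorem murphysLaw_of_hasSmoothConfig
    (H : ∀ (A : Type) [CommRing A] [Algebra.FiniteType ℤ A] (K : Type) [Field K] [Infinite K]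
      (φ : A →+* K), HasSmoothConfig φ) :
    MurphysLaw (∐ fun D : IncidenceData => D.incidenceScheme) := by
  intro Y s hs _ Q
  obtain ⟨U, hU, hQ, -⟩ := exists_isAffineOpen_mem_and_subset (x := Q) (U := ⊤) trivial
  let A : Type := Γ(Y, U)
  have hA : Algebra.FiniteType ℤ A := by
    have h1 := LocallyOfFiniteType.finiteType_appLE s (isAffineOpen_top _) hU le_top
    have h2 : ((s.appLE ⊤ U le_top).hom.comp
        (Scheme.ΓSpecIso (CommRingCat.of ℤ)).inv.hom).FiniteType :=
      h1.comp (RingHom.FiniteType.of_surjective _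
        (Scheme.ΓSpecIso (CommRingCat.of ℤ)).symm.commRingCatIsoToRingEquiv.surjective)
    have h3 : (algebraMap ℤ A).FiniteType := by
      rw [Subsingleton.elim (algebraMap ℤ A) ((s.appLE ⊤ U le_top).hom.comp
        (Scheme.ΓSpecIso (CommRingCat.of ℤ)).inv.hom)]
      exact h2
    exact RingHom.finiteType_algebraMap.1 h3
  have hQ' : Q ∈ Set.range hU.fromSpec := by
    rw [hU.range_fromSpec]; exact hQ
  obtain ⟨q, rfl⟩ := hQ'
  obtain ⟨K, _, _, φ, y, hφ⟩ := exists_infinite_field_point A q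
  obtain ⟨P, hP⟩ := (H A K φ).exists_sameSingularityType y
  refine ⟨P, hP.trans' ?_⟩
  rw [hφ]
  exact (smoothCovers_of_isOpenImmersion hU.fromSpec q).same

/-! ## Systems of sums and products of slopes -/

/-- A relation `a + b = c + d` or `a * b = c * d` between four slopes. -/
structure SlopeRel (K : Type) where
  /-- whether the relation is multiplicative -/
  mul : Bool
  /-- the first slope on the left -/
  a : K
  /-- the second slope on the left -/
  b : K
  /-- the first slope on the right -/
  c : K
  /-- the second slope on the right -/
  d : K

namespace SlopeRel
variable {K : Type}

/-- The relation holds for the slopes `y`. -/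
def Holds (q : SlopeRel K) {R : Type*} [CommRing R] (y : K → R) : Prop :=
  if q.mul then y q.a * y q.b = y q.c * y q.d else y q.a + y q.b = y q.c + y q.d

/-- A relation that holds in `K` between elements of `E`, without common terms on both sides. -/
structure Valid [Field K] (q : SlopeRel K) (E : Finset K) : Prop where
  ha : q.a ∈ E
  hb : q.b ∈ E
  hc : q.c ∈ E
  hd : q.d ∈ E
  hac : q.a ≠ q.c
  had : q.a ≠ q.d
  hbc : q.b ≠ q.c
  hbd : q.b ≠ q.d
  ne_zero : q.mul = true → q.a ≠ 0 ∧ q.b ≠ 0 ∧ q.c ≠ 0 ∧ q.d ≠ 0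
  holds : q.Holds (id : K → K)

theorem Valid.mono [Field K] {q : SlopeRel K} {E E' : Finset K} (h : q.Valid E) (hE : E ⊆ E') :
    q.Valid E' :=
  { h with ha := hE h.ha, hb := hE h.hb, hc := hE h.hc, hd := hE h.hd }

theorem Holds.congr {q : SlopeRel K} {R : Type*} [CommRing R] {y y' : K → R} [Field K]
    {E : Finset K} (hq : q.Valid E) (h : ∀ e ∈ E, y' e = y e) (hy : q.Holds y) : q.Holds y' := by
  rw [Holds] at hy ⊢
  rwa [h _ hq.ha, h _ hq.hb, h _ hq.hc, h _ hq.hd]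

end SlopeRel

/-- A finite set of slopes in `K` with valid relations between them. -/
structure SlopeSystem (K : Type) [Field K] where
  /-- the slopes -/
  E : Finset K
  /-- the relations -/
  L : Finset (SlopeRel K)
  zero_mem : 0 ∈ E
  one_mem : 1 ∈ E
  valid : ∀ q ∈ L, q.Valid E

/-! ### Solutions and unobstructed extensions -/

namespace SlopeSystem
variable {K : Type} [Field K]

/-- A deformation over `R` of the slopes that keeps the relations. -/
structure IsSol (s : SlopeSystem K) {R : Type*} [CommRing R] (y : K → R) : Prop where
  zero : y 0 = 0
  one : y 1 = 1
  rel : ∀ q ∈ s.L, q.Holds y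

theorem isSol_id (s : SlopeSystem K) : s.IsSol (id : K → K) :=
  ⟨rfl, rfl, fun q hq => (s.valid q hq).holds⟩

/-- `s'` has more slopes and relations than `s`, and the additional ones are unobstructed. -/
structure Ext (s s' : SlopeSystem K) : Prop where
  hE : s.E ⊆ s'.E
  hL : s.L ⊆ s'.L
  lift : ∀ {R S : Type} [CommRing R] [CommRing S] (f : R →+* S) (_ : Function.Surjective f)
    (z : K → S) (_ : s'.IsSol z) (y : K → R) (_ : s.IsSol y) (_ : ∀ e ∈ s.E, f (y e) = z e),
    ∃ y' : K → R, s'.IsSol y' ∧ (∀ e ∈ s.E, y' e = y e) ∧ ∀ e ∈ s'.E, f (y' e) = z e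

theorem Ext.refl (s : SlopeSystem K) : s.Ext s :=
  ⟨Finset.Subset.refl _, Finset.Subset.refl _,
    fun _ _ _ _ y hy h => ⟨y, hy, fun _ _ => rfl, h⟩⟩

theorem IsSol.mono {s s' : SlopeSystem K} {R : Type*} [CommRing R] {y : K → R} (h : s'.IsSol y)
    (e : s.L ⊆ s'.L) : s.IsSol y := ⟨h.zero, h.one, fun q hq => h.rel q (e hq)⟩

theorem Ext.trans {s s' s'' : SlopeSystem K} (h : s.Ext s') (h' : s'.Ext s'') : s.Ext s'' := by
  refine ⟨h.hE.trans h'.hE, h.hL.trans h'.hL, fun f hf z hz y hy hzy => ?_⟩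
  obtain ⟨y1, h1, h2, h3⟩ := h.lift f hf z (hz.mono h'.hL) y hy hzy
  obtain ⟨y2, k1, k2, k3⟩ := h'.lift f hf z hz y1 h1 h3
  exact ⟨y2, k1, fun e he => (k2 e (h.hE he)).trans (h2 e he), k3⟩

theorem isSol_update [DecidableEq K] {s : SlopeSystem K} {R : Type*} [CommRing R] {y : K → R}
    (h : s.IsSol y) {c : K} (hc : c ∉ s.E) (v : R) : s.IsSol (Function.update y c v) := by
  have h1 : ∀ e ∈ s.E, Function.update y c v e = y e := fun e he =>
    Function.update_of_ne (ne_of_mem_of_not_mem he hc) _ _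
  exact ⟨by rw [h1 _ s.zero_mem, h.zero], by rw [h1 _ s.one_mem, h.one],
    fun q hq => (h.rel q hq).congr (s.valid q hq) h1⟩

-- No relation of `s` involves the new slope, so its value can be any lift along the surjection.
open Classical in
theorem exists_fresh (s : SlopeSystem K) {c : K} (hc : c ∉ s.E) :
    ∃ s' : SlopeSystem K, s.Ext s' ∧ s'.E = insert c s.E := by
  refine ⟨⟨insert c s.E, s.L, by simp [s.zero_mem], by simp [s.one_mem],
    fun q hq => (s.valid q hq).mono (Finset.subset_insert _ _)⟩,
    ⟨Finset.subset_insert _ _, Finset.Subset.refl _, fun f hf z hz y hy hzy => ?_⟩, rfl⟩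
  obtain ⟨v, hv⟩ := hf (z c)
  have h1 : ∀ e ∈ s.E, Function.update y c v e = y e := fun e he =>
    Function.update_of_ne (ne_of_mem_of_not_mem he hc) _ _
  have h2 := isSol_update hy hc v
  refine ⟨Function.update y c v, ⟨h2.zero, h2.one, h2.rel⟩, h1, fun e he => ?_⟩
  rcases Finset.mem_insert.1 he with rfl | he
  · rw [Function.update_self, hv]
  · rw [h1 e he, hzy e he]

-- The new slope is determined by its relation: `hv` gives its value over `R`, and the uniqueness
-- `hu` over `S` forces the image of that value to be the prescribed one.
open Classical in
theorem exists_defined (s : SlopeSystem K) (q : SlopeRel K) (hc : q.c ∉ s.E)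
    (hq : q.Valid (insert q.c s.E))
    (hv : ∀ {R : Type} [CommRing R] (y : K → R), s.IsSol y → ∃ v,
      q.Holds (Function.update y q.c v))
    (hu : ∀ {R : Type} [CommRing R] (y y' : K → R), s.IsSol y → s.IsSol y' → q.Holds y →
      q.Holds y' → (∀ e ∈ s.E, y e = y' e) → y q.c = y' q.c) :
    ∃ s' : SlopeSystem K, s.Ext s' ∧ s'.E = insert q.c s.E ∧ q ∈ s'.L := by
  refine ⟨⟨insert q.c s.E, insert q s.L, by simp [s.zero_mem], by simp [s.one_mem],
    fun q' hq' => ?_⟩, ⟨Finset.subset_insert _ _, Finset.subset_insert _ _,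
      fun f hf z hz y hy hzy => ?_⟩, rfl, by simp⟩
  · rcases Finset.mem_insert.1 hq' with rfl | hq'
    · exact hq
    · exact (s.valid q' hq').mono (Finset.subset_insert _ _)
  · obtain ⟨v, hv⟩ := hv y hy
    have h1 : ∀ e ∈ s.E, Function.update y q.c v e = y e := fun e he =>
      Function.update_of_ne (ne_of_mem_of_not_mem he hc) _ _
    have h2 := isSol_update hy hc v
    refine ⟨Function.update y q.c v, ⟨h2.zero, h2.one, fun q' hq' => ?_⟩, h1, fun e he => ?_⟩
    · rcases Finset.mem_insert.1 hq' with rfl | hq'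
      · exact hv
      · exact h2.rel q' hq'
    · rcases Finset.mem_insert.1 he with rfl | he
      · refine hu (fun e => f (Function.update y q.c v e)) z ?_ ⟨hz.zero, hz.one,
          fun q' hq' => hz.rel q' (Finset.mem_insert_of_mem hq')⟩ ?_
          (hz.rel q (Finset.mem_insert_self _ _)) fun e he => by rw [h1 e he, hzy e he]
        · refine ⟨by rw [h2.zero, map_zero], by rw [h2.one, map_one], fun q' hq' => ?_⟩
          have := h2.rel q' hq'
          rw [SlopeRel.Holds] at this ⊢
          split_ifs at this ⊢
          · rw [← map_mul, this, map_mul]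
          · rw [← map_add, this, map_add]
        · rw [SlopeRel.Holds] at hv ⊢
          split_ifs at hv ⊢
          · rw [← map_mul, hv, map_mul]
          · rw [← map_add, hv, map_add]
      · rw [h1 e he, hzy e he]

open Classical in
/-- A new slope `c` with `a + b = c + d`. -/
theorem exists_add_sub (s : SlopeSystem K) {a b c d : K} (ha : a ∈ s.E) (hb : b ∈ s.E)
    (hd : d ∈ s.E) (had : a ≠ d) (hbd : b ≠ d) (hc : c ∉ s.E) (h : a + b = c + d) :
    ∃ s' : SlopeSystem K, s.Ext s' ∧ s'.E = insert c s.E ∧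
      ∀ {R : Type} [CommRing R] (y : K → R), s'.IsSol y → y a + y b = y c + y d := by
  have hac : a ≠ c := fun h => hc (h ▸ ha)
  have hbc : b ≠ c := fun h => hc (h ▸ hb)
  have hdc : d ≠ c := fun h => hc (h ▸ hd)
  obtain ⟨s', h1, h2, h3⟩ := s.exists_defined ⟨false, a, b, c, d⟩ hc
    ⟨by simp [ha], by simp [hb], by simp, by simp [hd], hac, had, hbc, hbd, by simp,
      by simpa [SlopeRel.Holds] using h⟩
    (fun y _ => ⟨y a + y b - y d, by simp [SlopeRel.Holds, hac, hbc, hdc]⟩)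
    (fun y y' _ _ h h' e => by
      simp only [SlopeRel.Holds, Bool.false_eq_true, if_false] at h h'
      rw [e a ha, e b hb, e d hd, h'] at h
      exact (add_right_cancel h).symm)
  exact ⟨s', h1, h2, fun y hy => by simpa [SlopeRel.Holds] using hy.rel _ h3⟩

open Classical in
/-- A new slope `a + b`. -/
theorem exists_add (s : SlopeSystem K) {a b : K} (ha : a ∈ s.E) (hb : b ∈ s.E) (ha0 : a ≠ 0)
    (hb0 : b ≠ 0) (hc : a + b ∉ s.E) :
    ∃ s' : SlopeSystem K, s.Ext s' ∧ s'.E = insert (a + b) s.E ∧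
      ∀ {R : Type} [CommRing R] (y : K → R), s'.IsSol y → y (a + b) = y a + y b := by
  obtain ⟨s', h1, h2, h3⟩ := s.exists_add_sub ha hb s.zero_mem ha0 hb0 hc (by ring)
  exact ⟨s', h1, h2, fun y hy => by rw [h3 y hy, hy.zero, add_zero]⟩

open Classical in
/-- A new slope `a * b`. -/
theorem exists_mul (s : SlopeSystem K) {a b : K} (ha : a ∈ s.E) (hb : b ∈ s.E) (ha0 : a ≠ 0)
    (hb0 : b ≠ 0) (ha1 : a ≠ 1) (hb1 : b ≠ 1) (hc : a * b ∉ s.E) :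
    ∃ s' : SlopeSystem K, s.Ext s' ∧ s'.E = insert (a * b) s.E ∧
      ∀ {R : Type} [CommRing R] (y : K → R), s'.IsSol y → y (a * b) = y a * y b := by
  have hac : a ≠ a * b := fun h => hc (h ▸ ha)
  have hbc : b ≠ a * b := fun h => hc (h ▸ hb)
  have hdc : 1 ≠ a * b := fun h => hc (h ▸ s.one_mem)
  obtain ⟨s', h1, h2, h3⟩ := s.exists_defined ⟨true, a, b, a * b, 1⟩ hc
    ⟨by simp [ha], by simp [hb], by simp, by simp [s.one_mem], hac, ha1, hbc, hb1,
      fun _ => ⟨ha0, hb0, mul_ne_zero ha0 hb0, one_ne_zero⟩, by simp [SlopeRel.Holds]⟩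
    (fun y hy => ⟨y a * y b, by
      simp only [SlopeRel.Holds, if_true]
      rw [Function.update_self, Function.update_of_ne hac, Function.update_of_ne hbc,
        Function.update_of_ne hdc, hy.one, mul_one]⟩)
    (fun y y' hy hy' h h' e => by
      simp only [SlopeRel.Holds, if_true] at h h'
      rw [e a ha, e b hb, h', hy.one, hy'.one, mul_one, mul_one] at h
      exact h.symm)
  refine ⟨s', h1, h2, fun y hy => ?_⟩
  have := hy.rel _ h3
  simp only [SlopeRel.Holds, if_true] at this
  rw [this, hy.one, mul_one]

/-! ### Avoiding finitely many values -/

/-- Such an `f` is injective, so only finitely many arguments are bad. Over an infinite field,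
finitely many conditions of this kind can be met at once; this is how all generic shifts are chosen.
-/
theorem eventually_notMem (f : K → K) {α : K} (hα : α ≠ 0)
    (h : ∀ a b, f a - f b = α * (a - b)) (s : Finset K) :
    ∀ᶠ ρ in Filter.cofinite, f ρ ∉ s := by
  have hf : Function.Injective f := fun a b hab => by
    have := h a b
    rw [hab, sub_self, eq_comm, mul_eq_zero, or_iff_right hα, sub_eq_zero] at this
    exact this
  exact hf.tendsto_cofinite.eventually s.finite_toSet.eventually_cofinite_notMem

theorem eventually_ne (f g : K → K) {α : K} (hα : α ≠ 0)
    (h : ∀ a b, (f a - g a) - (f b - g b) = α * (a - b)) :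
    ∀ᶠ ρ in Filter.cofinite, f ρ ≠ g ρ := by
  filter_upwards [eventually_notMem (fun x => f x - g x) hα h {0}] with ρ hρ e
  simp [e] at hρ

theorem eventually_add_notMem (t : K) (s : Finset K) :
    ∀ᶠ ρ in Filter.cofinite, t + ρ ∉ s :=
  eventually_notMem (fun ρ => t + ρ) one_ne_zero (fun a b => by ring) s

open Classical in
/-- New slopes `ρ`, `t + ρ` and `u + ρ`. -/
theorem exists_shift [Infinite K] (s : SlopeSystem K) {u t : K} (hu : u ∈ s.E) (ht : t ∈ s.E)
    (hut : u ≠ t) (hu0 : u ≠ 0) (ht0 : t ≠ 0) {Q : K → Prop} (hQ : ∀ᶠ ρ in Filter.cofinite, Q ρ) :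
    ∃ (ρ : K) (s' : SlopeSystem K), Q ρ ∧ ρ ∉ s.E ∧ t + ρ ∉ s.E ∧ u + ρ ∉ s.E ∧ s.Ext s' ∧
      s'.E = insert (u + ρ) (insert (t + ρ) (insert ρ s.E)) ∧
      ∀ {R : Type} [CommRing R] (y : K → R), s'.IsSol y →
        y (u + ρ) = y u + y ρ ∧ y (t + ρ) = y t + y ρ := by
  have h0 : ∀ᶠ ρ in Filter.cofinite, ρ ∉ s.E := s.E.finite_toSet.eventually_cofinite_notMem
  obtain ⟨ρ, hρ, h1, h2, h3⟩ := (((hQ.and (h0.and ((eventually_add_notMem t s.E).and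
    (eventually_add_notMem u s.E)))))).exists
  have hρ0 : ρ ≠ 0 := fun h => h1 (h ▸ s.zero_mem)
  obtain ⟨s1, e1, E1⟩ := s.exists_fresh h1
  obtain ⟨s2, e2, E2, y2⟩ := s1.exists_add (a := t) (b := ρ) (by simp [E1, ht]) (by simp [E1])
    ht0 hρ0 (by simp [E1, h2, ht0])
  obtain ⟨s3, e3, E3, y3⟩ := s2.exists_add (a := u) (b := ρ) (by simp [E2, E1, hu])
    (by simp [E2, E1]) hu0 hρ0 (by simp [E2, E1, h3, hu0, hut])
  exact ⟨ρ, s3, hρ, h1, h2, h3, (e1.trans e2).trans e3, by rw [E3, E2, E1],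
    fun y hy => ⟨y3 y hy, y2 y (hy.mono e3.hL)⟩⟩

end SlopeSystem

namespace SlopeSystem
variable {K : Type} [Field K]

/-! ### Polynomials in the slopes -/

/-- In all solutions of `s`, the polynomial `g` in the slopes is `u - t - t'`. -/
structure IsTriple (s : SlopeSystem K) (g : MvPolynomial K ℤ) (u t t' : K) : Prop where
  hu : u ∈ s.E
  ht : t ∈ s.E
  ht' : t' ∈ s.E
  u_ne : u ≠ 0
  t_ne : t ≠ 0
  t_ne' : t' ≠ 0
  ut : u ≠ t
  ut' : u ≠ t'
  eq : ∀ {R : Type} [CommRing R] (y : K → R), s.IsSol y → y u = MvPolynomial.aeval y g + y t + y t'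

theorem IsTriple.mono {s s' : SlopeSystem K} {g : MvPolynomial K ℤ} {u t t' : K}
    (h : s.IsTriple g u t t') (e : s.Ext s') : s'.IsTriple g u t t' :=
  { h with
    hu := e.hE h.hu, ht := e.hE h.ht, ht' := e.hE h.ht'
    eq := fun y hy => h.eq y (hy.mono e.hL) }

/-- Every system containing `E₀` can be extended so that `g` is represented. -/
def Representable (E₀ : Finset K) (g : MvPolynomial K ℤ) : Prop :=
  ∀ s : SlopeSystem K, E₀ ⊆ s.E → ∃ (s' : SlopeSystem K) (u t t' : K),
    s.Ext s' ∧ s'.IsTriple g u t t'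

theorem ne_zero_of_notMem {s : SlopeSystem K} {a : K} (h : a ∉ s.E) : a ≠ 0 :=
  fun e => h (e ▸ s.zero_mem)

theorem ne_one_of_notMem {s : SlopeSystem K} {a : K} (h : a ∉ s.E) : a ≠ 1 :=
  fun e => h (e ▸ s.one_mem)

variable [Infinite K]

-- Multiplying `u = g + t + t'` by `e` represents `g * e`, but the products may coincide with slopes
-- already present. Adding `ρ` to `u` and `t`, then `ρ'` to `u` and `t'`, keeps the identity and
-- makes the products new. The condition `e ≠ 1` is needed for `e * b = (e * b) * 1` to be valid,
-- and for `e * (t + ρ)` to differ from `ρ` and its translates for almost all `ρ`.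
open Classical in
theorem Representable.mul_X {E₀ : Finset K} {g : MvPolynomial K ℤ} (hg : Representable E₀ g)
    {e : K} (he : e ∈ E₀) (he0 : e ≠ 0) (he1 : e ≠ 1) :
    Representable E₀ (g * MvPolynomial.X e) := by
  intro s0 hs0
  obtain ⟨s, u, t, t', es, h⟩ := hg s0 hs0
  have hes : e ∈ s.E := es.hE (hs0 he)
  have he1' : e - 1 ≠ 0 := sub_ne_zero.2 he1
  obtain ⟨ρ, s1, ⟨q1, q2, q3, q4⟩, m1, m2, m3, e1, E1, y1⟩ := s.exists_shift h.hu h.ht h.ut h.u_ne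
    h.t_ne
    ((eventually_notMem (fun ρ => e * (t + ρ)) he0 (fun a b => by ring) s.E).and
    ((eventually_ne (fun ρ => e * (t + ρ)) (fun ρ => ρ) he1' (fun a b => by ring)).and
    ((eventually_ne (fun ρ => e * (t + ρ)) (fun ρ => u + ρ) he1' (fun a b => by ring)).and
    (eventually_ne (fun ρ => e * (t + ρ)) (fun ρ => t + ρ) he1' (fun a b => by ring)))))
  obtain ⟨s2, e2, E2, y2⟩ := s1.exists_mul (a := e) (b := t + ρ) (by simp [E1, hes])
    (by simp [E1]) he0 (ne_zero_of_notMem m2) he1 (ne_one_of_notMem m2)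
    (by simp only [E1, Finset.mem_insert, not_or]; exact ⟨q3, q4, q2, q1⟩)
  obtain ⟨ρ', s3, ⟨r1, r2, r3, r4, r5, r6, r7, r8⟩, n1, n2, n3, e3, E3, y3⟩ :=
    s2.exists_shift (u := u + ρ) (t := t') (by simp [E2, E1]) (by simp [E2, E1, h.ht'])
    (fun e => m3 (e ▸ h.ht')) (ne_zero_of_notMem m3) h.t_ne'
    ((eventually_notMem (fun ρ => e * (t' + ρ)) he0 (fun a b => by ring) s2.E).and
    ((eventually_ne (fun ρ => e * (t' + ρ)) (fun ρ => ρ) he1' (fun a b => by ring)).and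
    ((eventually_ne (fun x => e * (t' + x)) (fun x => u + ρ + x) he1' (fun a b => by ring)).and
    ((eventually_ne (fun x => e * (t' + x)) (fun x => t' + x) he1' (fun a b => by ring)).and
    ((eventually_notMem (fun x => e * (u + ρ + x)) he0 (fun a b => by ring) s2.E).and
    ((eventually_ne (fun x => e * (u + ρ + x)) (fun ρ => ρ) he1' (fun a b => by ring)).and
    ((eventually_ne (fun x => e * (u + ρ + x)) (fun x => u + ρ + x) he1'
      (fun a b => by ring)).and
    (eventually_ne (fun x => e * (u + ρ + x)) (fun x => t' + x) he1'
      (fun a b => by ring)))))))))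
  obtain ⟨s4, e4, E4, y4⟩ := s3.exists_mul (a := e) (b := t' + ρ') (by simp [E3, E2, E1, hes])
    (by simp [E3]) he0 (ne_zero_of_notMem n2) he1 (ne_one_of_notMem n2)
    (by simp only [E3, Finset.mem_insert, not_or]; exact ⟨r3, r4, r2, r1⟩)
  have hne : e * (u + ρ + ρ') ≠ e * (t' + ρ') := fun e => m3 <| by
    rw [add_right_cancel (mul_left_cancel₀ he0 e)]; exact h.ht'
  obtain ⟨s5, e5, E5, y5⟩ := s4.exists_mul (a := e) (b := u + ρ + ρ')
    (by simp [E4, E3, E2, E1, hes]) (by simp [E4, E3]) he0 (ne_zero_of_notMem n3) he1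
    (ne_one_of_notMem n3)
    (by simp only [E4, E3, Finset.mem_insert, not_or]; exact ⟨hne, r7, r8, r6, r5⟩)
  refine ⟨s5, e * (u + ρ + ρ'), e * (t + ρ), e * (t' + ρ'),
    ((((es.trans e1).trans e2).trans e3).trans e4).trans e5, ?_⟩
  refine ⟨by simp [E5], by simp [E5, E4, E3, E2], by simp [E5, E4],
    mul_ne_zero he0 (ne_zero_of_notMem n3), mul_ne_zero he0 (ne_zero_of_notMem m2),
    mul_ne_zero he0 (ne_zero_of_notMem n2), ?_, hne, ?_⟩
  · intro h
    exact r5 (by rw [h]; simp [E2])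
  · intro R _ y hy
    have k4 := hy.mono e5.hL
    have k3 := k4.mono e4.hL
    have k2 := k3.mono e3.hL
    have k1 := k2.mono e2.hL
    rw [y5 y hy, y4 y k4, y2 y k2, (y3 y k3).1, (y3 y k3).2, (y1 y k1).1, (y1 y k1).2,
      h.eq y (k1.mono e1.hL), map_mul, MvPolynomial.aeval_X]
    ring

-- The sum of `u = g + t + t'` and `w = h + σ-slopes s + s'` has the masks `t + s` and `t' + s'`.
-- Since the two triples may overlap, four balanced shifts come first: `ρ₁` on `w, s`, `ρ₂` on `u,
-- t`, `ρ₃` on `w, s'` and `ρ₄` on `u, t'`. They cancel in the identity and make the three sums new.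
open Classical in
theorem Representable.add {E₀ : Finset K} {g h : MvPolynomial K ℤ} (hg : Representable E₀ g)
    (hh : Representable E₀ h) : Representable E₀ (g + h) := by
  intro s00 hs00
  obtain ⟨s0, u, t, t', es0, h0⟩ := hg s00 hs00
  obtain ⟨σ, w, s, s', es, k⟩ := hh s0 (hs00.trans es0.hE)
  have h := h0.mono es
  obtain ⟨ρ₁, s1, ⟨q1, q2⟩, a1, a2, a3, e1, E1, y1⟩ := σ.exists_shift k.hu k.ht k.ut k.u_ne k.t_ne
    ((eventually_ne (fun x => t + (s + x)) (fun _ => 0) one_ne_zero (fun a b => by ring)).and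
    (eventually_ne (fun x => t + (s + x)) (fun _ => u) one_ne_zero (fun a b => by ring)))
  obtain ⟨ρ₂, s2, ⟨q3, q4⟩, b1, b2, b3, e2, E2, y2⟩ := s1.exists_shift (u := u) (t := t)
    (e1.hE h.hu) (e1.hE h.ht) h.ut h.u_ne h.t_ne
    ((eventually_notMem (fun x => t + x + (s + ρ₁)) one_ne_zero (fun a b => by ring) s1.E).and
    (eventually_ne (fun x => u + x + (w + ρ₁)) (fun _ => t' + s') one_ne_zero
      (fun a b => by ring)))
  have hu1 : u + ρ₂ ∉ σ.E := fun h => b3 (e1.hE h)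
  have hs1 : s + ρ₁ ≠ 0 := ne_zero_of_notMem a2
  obtain ⟨s3, e3, E3, y3⟩ := s2.exists_add (a := t + ρ₂) (b := s + ρ₁) (by simp [E2])
    (by simp [E2, E1]) (ne_zero_of_notMem b2) hs1
    (by
      simp only [E2, Finset.mem_insert, not_or]
      refine ⟨fun e => q2 ?_, by simpa using hs1, fun e => q1 ?_, q3⟩
      · linear_combination e
      · linear_combination e)
  obtain ⟨ρ₃, s4, ⟨q5, q6, q7, q8⟩, c1, c2, c3, e4, E4, y4⟩ :=
    s3.exists_shift (u := w + ρ₁) (t := s') (by simp [E3, E2, E1]) (by simp [E3, E2, E1, k.ht'])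
    (fun e => a3 (e ▸ k.ht')) (ne_zero_of_notMem a3) k.t_ne'
    ((eventually_ne (fun x => t' + (s' + x)) (fun _ => 0) one_ne_zero (fun a b => by ring)).and
    ((eventually_ne (fun x => t' + (s' + x)) (fun _ => u + ρ₂) one_ne_zero
      (fun a b => by ring)).and
    ((eventually_ne (fun x => u + ρ₂ + (w + ρ₁ + x)) (fun _ => 0) one_ne_zero
      (fun a b => by ring)).and
    (eventually_ne (fun x => u + ρ₂ + (w + ρ₁ + x)) (fun _ => t') one_ne_zero
      (fun a b => by ring)))))
  have e14 := ((e1.trans e2).trans e3).trans e4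
  obtain ⟨ρ₄, s5, ⟨q9, q10⟩, d1, d2, d3, e5, E5, y5⟩ :=
    s4.exists_shift (u := u + ρ₂) (t := t') (by simp [E4, E3, E2]) (e14.hE h.ht')
    (fun e => hu1 (e ▸ h.ht')) (ne_zero_of_notMem hu1) h.t_ne'
    ((eventually_notMem (fun x => t' + x + (s' + ρ₃)) one_ne_zero (fun a b => by ring) s4.E).and
    (eventually_notMem (fun x => u + ρ₂ + x + (w + ρ₁ + ρ₃)) one_ne_zero
      (fun a b => by ring) s4.E))
  have hs1' : s' + ρ₃ ≠ 0 := ne_zero_of_notMem c2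
  have hw2 : w + ρ₁ + ρ₃ ≠ 0 := ne_zero_of_notMem c3
  obtain ⟨s6, e6, E6, y6⟩ := s5.exists_add (a := t' + ρ₄) (b := s' + ρ₃) (by simp [E5])
    (by simp [E5, E4]) (ne_zero_of_notMem d2) hs1'
    (by
      simp only [E5, Finset.mem_insert, not_or]
      refine ⟨fun e => q6 ?_, by simpa using hs1', fun e => q5 ?_, q9⟩
      · linear_combination e
      · linear_combination e)
  have hUT : u + ρ₂ + ρ₄ + (w + ρ₁ + ρ₃) ≠ t' + ρ₄ + (s' + ρ₃) := fun e => q4 <|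
    add_right_cancel (b := ρ₃ + ρ₄) (by linear_combination e)
  have hU : u + ρ₂ + ρ₄ + (w + ρ₁ + ρ₃) ∉ s5.E := by
    simp only [E5, Finset.mem_insert, not_or]
    refine ⟨by simpa using hw2, fun e => q8 ?_, fun e => q7 ?_, q10⟩
    · linear_combination e
    · linear_combination e
  obtain ⟨s7, e7, E7, y7⟩ := s6.exists_add (a := u + ρ₂ + ρ₄) (b := w + ρ₁ + ρ₃)
    (by simp [E6, E5]) (by simp [E6, E5, E4]) (ne_zero_of_notMem d3) hw2
    (by simp only [E6, Finset.mem_insert, not_or]; exact ⟨hUT, hU⟩)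
  have hT1 : t + ρ₂ + (s + ρ₁) ∈ s5.E := by simp [E5, E4, E3]
  have hT2 : t' + ρ₄ + (s' + ρ₃) ∉ s4.E := q9
  refine ⟨s7, u + ρ₂ + ρ₄ + (w + ρ₁ + ρ₃), t + ρ₂ + (s + ρ₁), t' + ρ₄ + (s' + ρ₃),
    (((((((es0.trans es).trans e1).trans e2).trans e3).trans e4).trans e5).trans e6).trans e7,
    ⟨by simp [E7], by simp [E7, E6, E5, E4, E3], by simp [E7, E6], ne_zero_of_notMem hU,
      ne_zero_of_notMem q3, ne_zero_of_notMem hT2, fun e => hU (e ▸ hT1), hUT, ?_⟩⟩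
  intro R _ y hy
  have k6 := hy.mono e7.hL
  have k5 := k6.mono e6.hL
  have k4 := k5.mono e5.hL
  have k3 := k4.mono e4.hL
  have k2 := k3.mono e3.hL
  have k1 := k2.mono e2.hL
  have k0 := k1.mono e1.hL
  rw [y7 y hy, y6 y k6, y3 y k3, (y5 y k5).1, (y5 y k5).2, (y4 y k4).1, (y4 y k4).2,
    (y2 y k2).1, (y2 y k2).2, (y1 y k1).1, (y1 y k1).2, h.eq y k0, k.eq y k0, map_add]
  ring

-- Two free masks together with their sum represent the polynomial zero; `F` collects values to be
-- avoided so that the constants one and minus one can be added to the sum afterwards.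
open Classical in
theorem exists_masks (s : SlopeSystem K) (F : Finset K) :
    ∃ (t t' : K) (s' : SlopeSystem K), t ∉ F ∧ t' ∉ F ∧ t + t' ∉ F ∧ t ∉ s.E ∧ t' ∉ s.E ∧
      t ≠ t' ∧ t + t' ∉ s.E ∧
      s.Ext s' ∧ s'.E = insert (t + t') (insert t' (insert t s.E)) ∧
      ∀ {R : Type} [CommRing R] (y : K → R), s'.IsSol y → y (t + t') = y t + y t' := by
  obtain ⟨t, ht⟩ := ((s.E ∪ F).finite_toSet.eventually_cofinite_notMem).exists
  obtain ⟨t', h1, h2⟩ := ((eventually_add_notMem t (s.E ∪ F)).and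
    ((s.E ∪ F ∪ {t}).finite_toSet.eventually_cofinite_notMem)).exists
  rw [Finset.mem_coe] at ht h2
  simp only [Finset.mem_union, Finset.mem_singleton, not_or] at ht h1 h2
  have t0 := ne_zero_of_notMem ht.1
  have t0' := ne_zero_of_notMem h2.1.1
  obtain ⟨s1, e1, E1⟩ := s.exists_fresh ht.1
  obtain ⟨s2, e2, E2⟩ := s1.exists_fresh (c := t') (by simp [E1, h2.1.1, h2.2])
  obtain ⟨s3, e3, E3, y3⟩ := s2.exists_add (a := t) (b := t') (by simp [E2, E1]) (by simp [E2])
    t0 t0' (by simp [E2, E1, h1.1, t0, t0'])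
  exact ⟨t, t', s3, ht.2, h2.1.2, h1.2, ht.1, h2.1.1, Ne.symm h2.2, h1.1, (e1.trans e2).trans e3,
    by rw [E3, E2, E1], y3⟩

theorem representable_zero (E₀ : Finset K) : Representable E₀ (0 : MvPolynomial K ℤ) := by
  classical
  intro s _
  obtain ⟨t, t', s', -, -, -, ht, ht', htt, hu, e, E, hy⟩ := s.exists_masks ∅
  have t0 := ne_zero_of_notMem ht
  have t0' := ne_zero_of_notMem ht'
  exact ⟨s', t + t', t, t', e, ⟨by simp [E], by simp [E], by simp [E], ne_zero_of_notMem hu,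
    t0, t0', by simp [t0'], by simp [t0], fun y h => by rw [hy y h, map_zero, zero_add]⟩⟩

theorem representable_one (E₀ : Finset K) : Representable E₀ (1 : MvPolynomial K ℤ) := by
  classical
  intro s _
  -- The avoided values make `t + t' + 1` usable: `t + t'` is not in `s.E - 1`, so the new slope is
  -- not in `s.E`, and no mask is `-1`, so it differs from both masks.
  obtain ⟨t, t', s', f1, f2, f3, ht, ht', htt, hv, e, E, hy⟩ :=
    s.exists_masks (insert (-1) (s.E.image (· - 1)))
  simp only [Finset.mem_insert, Finset.mem_image, not_or, not_exists, not_and] at f1 f2 f3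
  have hu : t + t' + 1 ∉ s.E := fun h => f3.2 _ h (by ring)
  have h1 : t + t' + 1 ≠ t := fun h => f2.1 (by linear_combination h)
  have h2 : t + t' + 1 ≠ t' := fun h => f1.1 (by linear_combination h)
  obtain ⟨s1, e1, E1, y1⟩ := s'.exists_add (a := t + t') (b := 1) (by simp [E]) s'.one_mem
    (ne_zero_of_notMem hv) one_ne_zero (by simp [E, hu, h1, h2])
  refine ⟨s1, t + t' + 1, t, t', e.trans e1, ⟨by simp [E1], by simp [E1, E], by simp [E1, E],
    ne_zero_of_notMem hu, ne_zero_of_notMem ht, ne_zero_of_notMem ht', h1, h2, fun y h => ?_⟩⟩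
  rw [y1 y h, hy y (h.mono e1.hL), h.one, map_one]
  ring

theorem representable_neg_one (E₀ : Finset K) :
    Representable E₀ (-1 : MvPolynomial K ℤ) := by
  classical
  intro s _
  obtain ⟨t, t', s', f1, f2, f3, ht, ht', htt, hv, e, E, hy⟩ :=
    s.exists_masks (s.E.image (· + 1))
  simp only [Finset.mem_image, not_exists, not_and] at f3
  have hu : t + t' - 1 ∉ s.E := fun h => f3 _ h (by ring)
  have h1 : t + t' - 1 ≠ t := fun h => ne_one_of_notMem ht' (by linear_combination h)
  have h2 : t + t' - 1 ≠ t' := fun h => ne_one_of_notMem ht (by linear_combination h)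
  -- One is subtracted through the relation `(t + t') + 0 = (t + t' - 1) + 1`.
  obtain ⟨s1, e1, E1, y1⟩ := s'.exists_add_sub (a := t + t') (b := 0) (c := t + t' - 1) (d := 1)
    (by simp [E]) s'.zero_mem s'.one_mem (ne_one_of_notMem hv) zero_ne_one
    (by simp [E, hu, h1, h2]) (by ring)
  refine ⟨s1, t + t' - 1, t, t', e.trans e1, ⟨by simp [E1], by simp [E1, E], by simp [E1, E],
    ne_zero_of_notMem hu, ne_zero_of_notMem ht, ne_zero_of_notMem ht', h1, h2, fun y h => ?_⟩⟩
  have := y1 y h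
  rw [hy y (h.mono e1.hL), h.one, h.zero] at this
  rw [map_neg, map_one]
  linear_combination -this

theorem representable_C (E₀ : Finset K) (n : ℤ) :
    Representable E₀ (MvPolynomial.C n : MvPolynomial K ℤ) := by
  induction n using Int.induction_on with
  | zero => simpa using representable_zero E₀
  | succ i hi => simpa using hi.add (representable_one E₀)
  | pred i hi => simpa [sub_eq_add_neg] using hi.add (representable_neg_one E₀)

/-- Polynomials are built from constants by sums and by products with one variable at a time. The
exclusion of `0` and `1` from `E₀` is what `Representable.mul_X` requires of the variables. -/
theorem representable (E₀ : Finset K) (h0 : 0 ∉ E₀) (h1 : 1 ∉ E₀) {ι : Type*} (v : ι → K)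
    (hv : ∀ i, v i ∈ E₀) (g : MvPolynomial ι ℤ) :
    Representable E₀ (MvPolynomial.rename v g) := by
  induction g using MvPolynomial.induction_on with
  | C n => simpa using representable_C E₀ n
  | add p q hp hq => simpa using hp.add hq
  | mul_X p i hp =>
    rw [map_mul, MvPolynomial.rename_X]
    exact hp.mul_X (hv i) (fun h => h0 (h ▸ hv i)) (fun h => h1 (h ▸ hv i))

/-! ### Slope systems for rings of finite type -/

theorem exists_triples {K : Type} [Field K] (E₀ : Finset K) (s : SlopeSystem K) (hs : E₀ ⊆ s.E)
    (G : List (MvPolynomial K ℤ)) (hG : ∀ g ∈ G, Representable E₀ g) :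
    ∃ s' : SlopeSystem K, s.Ext s' ∧ ∀ g ∈ G, ∃ u t t', s'.IsTriple g u t t' := by
  induction G with
  | nil => exact ⟨s, Ext.refl s, by simp⟩
  | cons g G ih =>
    obtain ⟨s1, e1, h1⟩ := ih fun g hg => hG g (List.mem_cons_of_mem _ hg)
    obtain ⟨s2, u, t, t', e2, h2⟩ := hG g List.mem_cons_self s1 (hs.trans e1.hE)
    refine ⟨s2, e1.trans e2, fun g' hg' => ?_⟩
    rcases List.mem_cons.1 hg' with rfl | hg'
    · exact ⟨u, t, t', h2⟩
    · obtain ⟨u, t, t', h⟩ := h1 g' hg'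
      exact ⟨u, t, t', h.mono e2⟩

open Classical in
/-- A represented polynomial that vanishes at the given slopes can be imposed to be zero. -/
theorem exists_impose_zero {K : Type} [Field K] (s : SlopeSystem K) (G : List (MvPolynomial K ℤ))
    (hG : ∀ g ∈ G, (∃ u t t', s.IsTriple g u t t') ∧ MvPolynomial.aeval (id : K → K) g = 0) :
    ∃ s' : SlopeSystem K, s'.E = s.E ∧ ∀ {R : Type} [CommRing R] (y : K → R),
      s'.IsSol y ↔ s.IsSol y ∧ ∀ g ∈ G, MvPolynomial.aeval y g = 0 := by
  induction G with
  | nil => exact ⟨s, rfl, by simp⟩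
  | cons g G ih =>
    obtain ⟨s1, E1, h1⟩ := ih fun g hg => hG g (List.mem_cons_of_mem _ hg)
    obtain ⟨⟨u, t, t', h⟩, h0⟩ := hG g List.mem_cons_self
    have hu := h.eq id s.isSol_id
    rw [h0, zero_add] at hu
    -- Two masks are needed here: with `g = 0`, a single mask would give `u = t`, whereas in `u + 0
    -- = t + t'` the slopes `u` and `0` both differ from `t` and `t'`.
    let q : SlopeRel K := ⟨false, u, 0, t, t'⟩
    refine ⟨⟨s1.E, insert q s1.L, s1.zero_mem, s1.one_mem, fun q' hq' => ?_⟩, E1,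
      fun y => ⟨fun hy => ?_, fun hy => ?_⟩⟩
    · rcases Finset.mem_insert.1 hq' with rfl | hq'
      · exact ⟨E1 ▸ h.hu, s1.zero_mem, E1 ▸ h.ht, E1 ▸ h.ht', h.ut, h.ut', h.t_ne.symm,
          h.t_ne'.symm, by simp [q], by simpa [SlopeRel.Holds, q] using hu⟩
      · exact s1.valid q' hq'
    · have k1 := (h1 y).1 ⟨hy.zero, hy.one, fun q' hq' =>
        hy.rel q' (Finset.mem_insert_of_mem hq')⟩
      refine ⟨k1.1, List.forall_mem_cons.2 ⟨?_, k1.2⟩⟩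
      have k2 := hy.rel q (Finset.mem_insert_self _ _)
      simp only [SlopeRel.Holds, q, Bool.false_eq_true, if_false] at k2
      rw [hy.zero, h.eq y k1.1] at k2
      linear_combination k2
    · obtain ⟨k1, k2⟩ := hy
      have k3 := List.forall_mem_cons.1 k2
      have k4 := (h1 y).2 ⟨k1, k3.2⟩
      refine ⟨k4.zero, k4.one, fun q' hq' => ?_⟩
      rcases Finset.mem_insert.1 hq' with rfl | hq'
      · simp only [SlopeRel.Holds, q, Bool.false_eq_true, if_false]
        rw [k4.zero, h.eq y k1, k3.1]
        ring
      · exact k4.rel q' hq'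

open Classical in
/-- Independent slopes with prescribed values of `u i - t i - t' i`. -/
theorem exists_base {n : ℕ} (x : Fin n → K) : ∃ (s : SlopeSystem K) (u t t' : Fin n → K),
    (∀ {R : Type} [CommRing R] (y : K → R), s.IsSol y ↔ y 0 = 0 ∧ y 1 = 1) ∧
    (∀ i, x i = u i - t i - t' i) ∧
    (∀ i, u i ∈ s.E ∧ t i ∈ s.E ∧ t' i ∈ s.E) ∧
    (∀ i, u i ≠ 0 ∧ t i ≠ 0 ∧ t' i ≠ 0 ∧ u i ≠ 1 ∧ t i ≠ 1 ∧ t' i ≠ 1) ∧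
    ∀ {R S : Type} [CommRing R] [CommRing S] (f : R →+* S) (_ : Function.Surjective f)
      (z : K → S) (_ : s.IsSol z) (α : Fin n → R) (_ : ∀ i, f (α i) = z (u i) - z (t i) - z (t' i)),
      ∃ y : K → R, s.IsSol y ∧ (∀ i, α i = y (u i) - y (t i) - y (t' i)) ∧
        ∀ e ∈ s.E, f (y e) = z e := by
  induction n with
  | zero =>
    refine ⟨⟨{0, 1}, ∅, by simp, by simp, by simp⟩, fun _ => 0, fun _ => 0, fun _ => 0,
      fun y => ⟨fun h => ⟨h.zero, h.one⟩, fun h => ⟨h.1, h.2, by simp⟩⟩, fun i => i.elim0,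
      fun i => i.elim0, fun i => i.elim0, fun {R S _ _} f hf z hz α _ => ?_⟩
    refine ⟨Function.update (fun _ => 0) 1 1, ⟨?_, by simp, by simp⟩, fun i => i.elim0, ?_⟩
    · simp
    · intro e he
      rcases Finset.mem_insert.1 he with rfl | he
      · simp [hz.zero]
      · rw [Finset.mem_singleton.1 he]; simp [hz.one]
  | succ n ih =>
    obtain ⟨s, u, t, t', h1, h2, h3, h4, h5⟩ := ih (fun i => x i.succ)
    -- Avoiding `-x 0` ensures that `c = x 0 + a + b` differs from `b`.
    obtain ⟨a, ha⟩ := ((insert (-x 0) s.E).finite_toSet.eventually_cofinite_notMem).exists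
    obtain ⟨b, k1, hb⟩ := ((eventually_notMem (fun r => x 0 + a + r) one_ne_zero
        (fun a b => by ring) (insert a s.E)).and
      ((insert a s.E).finite_toSet.eventually_cofinite_notMem)).exists
    rw [Finset.mem_coe] at ha hb
    simp only [Finset.mem_insert, not_or] at ha hb k1
    obtain ⟨c, hc⟩ : ∃ c, c = x 0 + a + b := ⟨_, rfl⟩
    rw [← hc] at k1
    have hcb : c ≠ b := fun h => ha.1 (by linear_combination h - hc)
    have hE : s.E ⊆ insert c (insert b (insert a s.E)) :=
      ((Finset.subset_insert _ _).trans (Finset.subset_insert _ _)).trans (Finset.subset_insert _ _)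
    refine ⟨⟨insert c (insert b (insert a s.E)), s.L, hE s.zero_mem, hE s.one_mem,
      fun q hq => (s.valid q hq).mono hE⟩, Fin.cons c u, Fin.cons a t, Fin.cons b t',
      fun y => Iff.trans ⟨fun h => ⟨h.zero, h.one, h.rel⟩, fun h => ⟨h.zero, h.one, h.rel⟩⟩ (h1 y),
      ?_, ?_, ?_, ?_⟩
    · refine Fin.cases ?_ h2
      simp only [Fin.cons_zero]
      linear_combination -hc
    · refine Fin.cases (by simp) fun i => ?_
      exact ⟨hE (h3 i).1, hE (h3 i).2.1, hE (h3 i).2.2⟩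
    · refine Fin.cases ?_ h4
      exact ⟨ne_zero_of_notMem k1.2, ne_zero_of_notMem ha.2, ne_zero_of_notMem hb.2,
        ne_one_of_notMem k1.2, ne_one_of_notMem ha.2, ne_one_of_notMem hb.2⟩
    · intro R S _ _ f hf z hz α hα
      obtain ⟨y, y1, y2, y3⟩ := h5 f hf z ⟨hz.zero, hz.one, hz.rel⟩ (fun i => α i.succ)
        fun i => hα i.succ
      obtain ⟨va, hva⟩ := hf (z a)
      obtain ⟨vb, hvb⟩ := hf (z b)
      -- The two masks are lifted arbitrarily; the value at `c` is then forced by `α 0`.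
      let y' : K → R := fun e => if e = a then va else if e = b then vb else
        if e = c then α 0 + va + vb else y e
      have hya : y' a = va := by simp [y']
      have hyb : y' b = vb := by simp [y', hb.1]
      have hyc : y' c = α 0 + va + vb := by simp [y', k1.1, hcb]
      have hye : ∀ e ∈ s.E, y' e = y e := fun e he => by
        have e1 : e ≠ a := ne_of_mem_of_not_mem he ha.2
        have e2 : e ≠ b := ne_of_mem_of_not_mem he hb.2
        have e3 : e ≠ c := ne_of_mem_of_not_mem he k1.2
        simp [y', e1, e2, e3]
      refine ⟨y', ⟨by rw [hye _ s.zero_mem, y1.zero], by rw [hye _ s.one_mem, y1.one],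
        fun q hq => (y1.rel q hq).congr (s.valid q hq) hye⟩, ?_, ?_⟩
      · refine Fin.cases ?_ fun i => ?_
        · simp only [Fin.cons_zero]
          rw [hya, hyb, hyc]
          ring
        · simp only [Fin.cons_succ]
          rw [hye _ (h3 i).1, hye _ (h3 i).2.1, hye _ (h3 i).2.2, y2]
      · intro e he
        simp only [Finset.mem_insert] at he
        rcases he with rfl | rfl | rfl | he
        · have := hα 0
          simp only [Fin.cons_zero] at this
          rw [hyc, map_add, map_add, this, hva, hvb]
          ring
        · rw [hyb, hvb]
        · rw [hya, hva]
        · rw [hye e he, y3 e he]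

/-- Points of a ring of finite type are encoded by the solutions of a slope system. -/
theorem exists_encoding {A : Type} [CommRing A] [Algebra.FiniteType ℤ A] (φ : A →+* K) :
    ∃ (s : SlopeSystem K) (n : ℕ) (π : MvPolynomial (Fin n) ℤ →+* A) (u t t' : Fin n → K),
      Function.Surjective π ∧
      (∀ i, u i ∈ s.E ∧ t i ∈ s.E ∧ t' i ∈ s.E) ∧
      (∀ i, φ (π (MvPolynomial.X i)) = u i - t i - t' i) ∧
      (∀ {R : Type} [CommRing R] (y : K → R), s.IsSol y → ∀ f, π f = 0 →
        MvPolynomial.aeval (fun i => y (u i) - y (t i) - y (t' i)) f = 0) ∧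
      ∀ {R S : Type} [CommRing R] [CommRing S] (f : R →+* S) (_ : Function.Surjective f)
        (z : K → S) (_ : s.IsSol z) (α : A →+* R)
        (_ : ∀ i, f (α (π (MvPolynomial.X i))) = z (u i) - z (t i) - z (t' i)),
        ∃ y : K → R, s.IsSol y ∧
          (∀ i, α (π (MvPolynomial.X i)) = y (u i) - y (t i) - y (t' i)) ∧
          ∀ e ∈ s.E, f (y e) = z e := by
  classical
  obtain ⟨n, π', hπ⟩ := Algebra.FiniteType.iff_quotient_mvPolynomial''.1
    (inferInstance : Algebra.FiniteType ℤ A)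
  let π : MvPolynomial (Fin n) ℤ →+* A := π'.toRingHom
  obtain ⟨s0, u, t, t', h1, h2, h3, h4, h5⟩ := exists_base fun i => φ (π (MvPolynomial.X i))
  -- Integral polynomial rings are Noetherian, so finitely many equations have to be imposed.
  obtain ⟨F, hF⟩ : (RingHom.ker π).FG := IsNoetherian.noetherian _
  let ξ : Fin n → MvPolynomial K ℤ := fun i =>
    MvPolynomial.X (u i) - MvPolynomial.X (t i) - MvPolynomial.X (t' i)
  let E₀ : Finset K := Finset.univ.image u ∪ Finset.univ.image t ∪ Finset.univ.image t'
  let v : Fin n × Fin 3 → K := fun i => ![u i.1, t i.1, t' i.1] i.2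
  have hv : ∀ i, v i ∈ E₀ := by
    rintro ⟨i, k⟩
    fin_cases k <;> simp [v, E₀]
  have hE0 : E₀ ⊆ s0.E := by
    intro e he
    simp only [E₀, Finset.mem_union, Finset.mem_image, Finset.mem_univ, true_and] at he
    rcases he with (⟨i, rfl⟩ | ⟨i, rfl⟩) | ⟨i, rfl⟩
    exacts [(h3 i).1, (h3 i).2.1, (h3 i).2.2]
  have hE00 : (0 : K) ∉ E₀ := by
    simp only [E₀, Finset.mem_union, Finset.mem_image, Finset.mem_univ, true_and]
    rintro ((⟨i, h⟩ | ⟨i, h⟩) | ⟨i, h⟩)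
    exacts [(h4 i).1 h, (h4 i).2.1 h, (h4 i).2.2.1 h]
  have hE01 : (1 : K) ∉ E₀ := by
    simp only [E₀, Finset.mem_union, Finset.mem_image, Finset.mem_univ, true_and]
    rintro ((⟨i, h⟩ | ⟨i, h⟩) | ⟨i, h⟩)
    exacts [(h4 i).2.2.2.1 h, (h4 i).2.2.2.2.1 h, (h4 i).2.2.2.2.2 h]
  let G : List (MvPolynomial K ℤ) := F.toList.map (MvPolynomial.aeval ξ)
  have hev : ∀ {R : Type} [CommRing R] (y : K → R) (f : MvPolynomial (Fin n) ℤ),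
      MvPolynomial.aeval y (MvPolynomial.aeval ξ f) =
        MvPolynomial.aeval (fun i => y (u i) - y (t i) - y (t' i)) f := by
    intro R _ y f
    rw [MvPolynomial.comp_aeval_apply]
    congr 2
    funext i
    simp [ξ]
  have hπe : ∀ f : MvPolynomial (Fin n) ℤ, ∀ {R : Type} [CommRing R] (α : A →+* R),
      α (π f) = MvPolynomial.aeval (fun i => α (π (MvPolynomial.X i))) f := by
    intro f R _ α
    have : (α.comp π) = (MvPolynomial.aeval (R := ℤ) fun i => α (π (MvPolynomial.X i))).toRingHom :=
      MvPolynomial.ringHom_ext (fun r => by simp) fun i => by simp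
    exact DFunLike.congr_fun this f
  have hG : ∀ g ∈ G, Representable E₀ g := by
    intro g hg
    obtain ⟨f, -, rfl⟩ := List.mem_map.1 hg
    have := representable E₀ hE00 hE01 v hv (MvPolynomial.aeval (fun i =>
      (MvPolynomial.X (i, 0) - MvPolynomial.X (i, 1) - MvPolynomial.X (i, 2) :
        MvPolynomial (Fin n × Fin 3) ℤ)) f)
    rw [MvPolynomial.comp_aeval_apply] at this
    convert this using 3
    funext i
    simp [ξ, v]
  have hG0 : ∀ g ∈ G, MvPolynomial.aeval (id : K → K) g = 0 := by
    intro g hg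
    obtain ⟨f, hf, rfl⟩ := List.mem_map.1 hg
    have hf' : f ∈ RingHom.ker π := hF ▸ Ideal.subset_span (Finset.mem_toList.1 hf)
    rw [hev]
    have := hπe f φ
    rw [RingHom.mem_ker.1 hf', map_zero] at this
    rw [this]
    congr 2
    funext i
    exact (h2 i).symm
  obtain ⟨s1, e1, k1⟩ := exists_triples E₀ s0 hE0 G hG
  -- This is the only step that can obstruct deformations. Lifting survives because the lifted
  -- coordinates come from a homomorphism `α` defined on `A`, which satisfies the equations.
  obtain ⟨s2, E2, k2⟩ := s1.exists_impose_zero G fun g hg => ⟨k1 g hg, hG0 g hg⟩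
  refine ⟨s2, n, π, u, t, t', hπ, fun i => ?_, h2, fun y hy f hf => ?_,
    fun {R S _ _} f hf z hz α hα => ?_⟩
  · rw [E2]
    exact ⟨e1.hE (h3 i).1, e1.hE (h3 i).2.1, e1.hE (h3 i).2.2⟩
  · have hle : RingHom.ker π ≤ RingHom.ker (MvPolynomial.aeval (R := ℤ) fun i =>
        y (u i) - y (t i) - y (t' i)).toRingHom := by
      rw [← hF, Ideal.span_le]
      intro f hf
      have := ((k2 y).1 hy).2 _ (List.mem_map_of_mem (Finset.mem_toList.2 hf))
      rw [hev] at this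
      exact this
    exact hle hf
  · obtain ⟨hz1, hz2⟩ := (k2 z).1 hz
    obtain ⟨y0, m1, m2, m3⟩ := h5 f hf z (hz1.mono e1.hL) _ hα
    obtain ⟨y, n1, n2, n3⟩ := e1.lift f hf z hz1 y0 m1 m3
    have hα' : ∀ i, α (π (MvPolynomial.X i)) = y (u i) - y (t i) - y (t' i) := fun i => by
      rw [n2 _ (h3 i).1, n2 _ (h3 i).2.1, n2 _ (h3 i).2.2, m2]
    refine ⟨y, (k2 y).2 ⟨n1, fun g hg => ?_⟩, hα', fun e he => n3 e (E2 ▸ he)⟩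
    obtain ⟨f, hf, rfl⟩ := List.mem_map.1 hg
    have hf' : f ∈ RingHom.ker π := hF ▸ Ideal.subset_span (Finset.mem_toList.1 hf)
    rw [hev, ← funext hα', ← hπe, RingHom.mem_ker.1 hf', map_zero]

end SlopeSystem

/-! ## Directions -/

section Directions
variable {K R : Type} [CommRing R]

/-- The first coordinate of the normal vector of lines of slope `y k`, or of vertical lines. -/
def nx (y : K → R) : Option K → R
  | none => 1
  | some k => -y k

/-- The second coordinate of the normal vector of lines of slope `y k`, or of vertical lines. -/
def ny (R : Type) [CommRing R] : Option K → R
  | none => 0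
  | some _ => 1

@[simp] theorem nx_none (y : K → R) : nx y none = 1 := rfl
@[simp] theorem nx_some (y : K → R) (k : K) : nx y (some k) = -y k := rfl
@[simp] theorem ny_none : ny R (none : Option K) = 0 := rfl
@[simp] theorem ny_some (k : K) : ny R (some k) = 1 := rfl

/-- The determinant of the normal vectors of two directions. -/
def br (y : K → R) (δ δ' : Option K) : R := nx y δ * ny R δ' - ny R δ * nx y δ'

theorem map_nx {S : Type} [CommRing S] (f : R →+* S) (y : K → R) (z : K → S) (δ : Option K)
    (h : ∀ k ∈ δ, f (y k) = z k) : f (nx y δ) = nx z δ := by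
  cases δ with
  | none => simp
  | some k => simp [h k rfl]

theorem map_ny {S : Type} [CommRing S] (f : R →+* S) (δ : Option K) : f (ny R δ) = ny S δ := by
  cases δ <;> simp

theorem map_br {S : Type} [CommRing S] (f : R →+* S) (y : K → R) (z : K → S) (δ δ' : Option K)
    (h : ∀ k ∈ δ, f (y k) = z k) (h' : ∀ k ∈ δ', f (y k) = z k) :
    f (br y δ δ') = br z δ δ' := by
  simp only [br, map_sub, map_mul, map_nx f y z δ h, map_nx f y z δ' h', map_ny]

/-- The determinant is a difference of two slopes, or `1` or `-1` if one direction is vertical. -/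
theorem isUnit_br {y : K → R} {E : Set K} (h : ∀ i ∈ E, ∀ j ∈ E, i ≠ j → IsUnit (y i - y j))
    {δ δ' : Option K} (hδ : ∀ k ∈ δ, k ∈ E) (hδ' : ∀ k ∈ δ', k ∈ E) (hne : δ ≠ δ') :
    IsUnit (br y δ δ') := by
  cases δ with
  | none => cases δ' with
    | none => exact (hne rfl).elim
    | some k => simp [br]
  | some k => cases δ' with
    | none => simp [br]
    | some k' =>
      have := h k' (hδ' k' rfl) k (hδ k rfl) (fun e => hne (e ▸ rfl))
      simpa [br, sub_eq_add_neg, add_comm] using this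

theorem br_id_ne_zero {K : Type} [Field K] {δ δ' : Option K} (hne : δ ≠ δ') :
    br (id : K → K) δ δ' ≠ 0 :=
  (isUnit_br (E := Set.univ) (fun _ _ _ _ hij => (sub_ne_zero.2 hij).isUnit)
    (fun _ _ => trivial) (fun _ _ => trivial) hne).ne_zero

/-- Two lines whose directions have invertible determinant meet in one point. -/
theorem eq_of_br_isUnit {y : K → R} {δ δ' : Option K} (h : IsUnit (br y δ δ')) {P Q : R × R}
    (h1 : nx y δ * P.1 + ny R δ * P.2 = nx y δ * Q.1 + ny R δ * Q.2)
    (h2 : nx y δ' * P.1 + ny R δ' * P.2 = nx y δ' * Q.1 + ny R δ' * Q.2) : P = Q := by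
  apply Prod.ext
  · apply h.mul_left_cancel
    rw [br]
    linear_combination ny R δ' * h1 - ny R δ * h2
  · apply h.mul_left_cancel
    rw [br]
    linear_combination nx y δ * h2 - nx y δ' * h1

/-- Cramer's rule. -/
theorem exists_of_br_isUnit {y : K → R} {δ δ' : Option K} (h : IsUnit (br y δ δ')) (c c' : R) :
    ∃ P : R × R, nx y δ * P.1 + ny R δ * P.2 = c ∧ nx y δ' * P.1 + ny R δ' * P.2 = c' := by
  obtain ⟨v, hv⟩ := h.exists_right_inv
  refine ⟨((c * ny R δ' - c' * ny R δ) * v, (nx y δ * c' - nx y δ' * c) * v), ?_, ?_⟩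
  · rw [br] at hv
    linear_combination c * hv
  · rw [br] at hv
    linear_combination c' * hv

end Directions

/-! ## Quadrangles -/

section Quadrangle

/-- The edges `12, 13, 14, 23, 24, 34` of a quadrangle by their end points. -/
def edgeEnds : Fin 6 → Fin 4 × Fin 4 := ![(0, 1), (0, 2), (0, 3), (1, 2), (1, 3), (2, 3)]

/-- The vertex `i` is an end point of the edge `e`. -/
def IsEnd (i : Fin 4) (e : Fin 6) : Prop := i = (edgeEnds e).1 ∨ i = (edgeEnds e).2

instance (i : Fin 4) (e : Fin 6) : Decidable (IsEnd i e) :=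
  inferInstanceAs (Decidable (_ ∨ _))

/-- Two distinct edges with a common end point. -/
def Adjacent (e e' : Fin 6) : Prop := e ≠ e' ∧ e.val + e'.val ≠ 5

instance (e e' : Fin 6) : Decidable (Adjacent e e') := inferInstanceAs (Decidable (_ ∧ _))

theorem exists_isEnd_of_adjacent : ∀ e e', Adjacent e e' → ∃ i, IsEnd i e ∧ IsEnd i e' := by
  decide

theorem exists_adjacent_of_isEnd : ∀ i, ∃ e e', Adjacent e e' ∧ IsEnd i e ∧ IsEnd i e' := by
  decide

theorem adjacent_or_adjacent : ∀ e e' e'', e ≠ e' → e ≠ e'' → e' ≠ e'' →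
    Adjacent e e' ∨ Adjacent e e'' := by
  decide

theorem exists_isEnd_not_isEnd : ∀ e e', e ≠ e' → ∃ i, IsEnd i e' ∧ ¬ IsEnd i e := by
  decide

theorem isEnd_fst (e : Fin 6) : IsEnd (edgeEnds e).1 e := Or.inl rfl
theorem isEnd_snd (e : Fin 6) : IsEnd (edgeEnds e).2 e := Or.inr rfl

variable {K R : Type} [CommRing R]

/-- The vertices of the quadrangle of size `σ` at the origin whose edges have directions `d`. -/
def vertex (y : K → R) (d : Fin 6 → Option K) (σ : R) : Fin 4 → R × R :=
  ![(0, 0),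
    (σ * br y (d 1) (d 3) * br y (d 2) (d 4) * ny R (d 0),
      -(σ * br y (d 1) (d 3) * br y (d 2) (d 4) * nx y (d 0))),
    (σ * br y (d 0) (d 3) * br y (d 2) (d 4) * ny R (d 1),
      -(σ * br y (d 0) (d 3) * br y (d 2) (d 4) * nx y (d 1))),
    (σ * br y (d 0) (d 4) * br y (d 1) (d 3) * ny R (d 2),
      -(σ * br y (d 0) (d 4) * br y (d 1) (d 3) * nx y (d 2)))]

/-- The relation between the directions of the six edges of a quadrangle. -/
def Closes (y : K → R) (d : Fin 6 → Option K) : Prop :=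
  br y (d 0) (d 4) * br y (d 1) (d 3) * br y (d 2) (d 5) =
    br y (d 2) (d 4) * br y (d 0) (d 3) * br y (d 1) (d 5)

/-- The formulas for the vertices satisfy five edge conditions identically; only the last edge uses
`Closes`, multiplied by the size. -/
theorem vertex_mem_edge {y : K → R} {d : Fin 6 → Option K} (h : Closes y d) (σ : R) {i : Fin 4}
    {e : Fin 6} (hi : IsEnd i e) :
    nx y (d e) * (vertex y d σ i).1 + ny R (d e) * (vertex y d σ i).2 =
      nx y (d e) * (vertex y d σ (edgeEnds e).1).1 +
        ny R (d e) * (vertex y d σ (edgeEnds e).1).2 := by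
  rcases hi with rfl | rfl
  · rfl
  · rw [Closes] at h
    fin_cases e <;> simp [vertex, edgeEnds] <;> simp only [br] at h ⊢ <;> try ring1
    linear_combination -σ * h

/-- The value at the `i`-th vertex of the equation of an edge not containing it. -/
def offEdge (y : K → R) (d : Fin 6 → Option K) (σ : R) (e : Fin 6) (i : Fin 4) : R :=
  nx y (d e) * (vertex y d σ i).1 + ny R (d e) * (vertex y d σ i).2 -
    (nx y (d e) * (vertex y d σ (edgeEnds e).1).1 + ny R (d e) * (vertex y d σ (edgeEnds e).1).2)

-- Up to sign, each of the twelve values is the size times three determinants of adjacent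
-- directions, and none of these factors vanishes.
set_option linter.unusedSimpArgs false in
set_option linter.unreachableTactic false in
set_option linter.unusedTactic false in
theorem offEdge_ne_zero {K L : Type} [Field L] {y : K → L} {d : Fin 6 → Option K} {σ : L}
    (hσ : σ ≠ 0) (hd : ∀ e e', Adjacent e e' → br y (d e) (d e') ≠ 0)
    {i : Fin 4} {e : Fin 6}
    (hi : ¬ IsEnd i e) : offEdge y d σ e i ≠ 0 := by
  have key : ∀ a a' b b' c c' : Fin 6, Adjacent a a' → Adjacent b b' → Adjacent c c' →
      (offEdge y d σ e i = σ * br y (d a) (d a') * br y (d b) (d b') * br y (d c) (d c') ∨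
        offEdge y d σ e i = -(σ * br y (d a) (d a') * br y (d b) (d b') * br y (d c) (d c'))) →
      offEdge y d σ e i ≠ 0 := by
    intro a a' b b' c c' ha hb hc h
    have := mul_ne_zero (mul_ne_zero (mul_ne_zero hσ (hd _ _ ha)) (hd _ _ hb)) (hd _ _ hc)
    rcases h with h | h <;> rw [h]
    · exact this
    · exact neg_ne_zero.2 this
  fin_cases e <;> fin_cases i <;> first | exact (hi (by decide)).elim | skip
  · refine key 0 3 2 4 0 1 (by decide) (by decide) (by decide) ?_
    simp only [offEdge, vertex, edgeEnds, br, Fin.isValue, Matrix.cons_val, Fin.reduceFinMk, Fin.mk_zero, Fin.mk_one, Fin.zero_eta]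
    first | (left; ring1) | (right; ring1)
  · refine key 0 4 1 3 0 2 (by decide) (by decide) (by decide) ?_
    simp only [offEdge, vertex, edgeEnds, br, Fin.isValue, Matrix.cons_val, Fin.reduceFinMk, Fin.mk_zero, Fin.mk_one, Fin.zero_eta]
    first | (left; ring1) | (right; ring1)
  · refine key 1 3 2 4 1 0 (by decide) (by decide) (by decide) ?_
    simp only [offEdge, vertex, edgeEnds, br, Fin.isValue, Matrix.cons_val, Fin.reduceFinMk, Fin.mk_zero, Fin.mk_one, Fin.zero_eta]
    first | (left; ring1) | (right; ring1)
  · refine key 0 4 1 3 1 2 (by decide) (by decide) (by decide) ?_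
    simp only [offEdge, vertex, edgeEnds, br, Fin.isValue, Matrix.cons_val, Fin.reduceFinMk, Fin.mk_zero, Fin.mk_one, Fin.zero_eta]
    first | (left; ring1) | (right; ring1)
  · refine key 1 3 2 4 2 0 (by decide) (by decide) (by decide) ?_
    simp only [offEdge, vertex, edgeEnds, br, Fin.isValue, Matrix.cons_val, Fin.reduceFinMk, Fin.mk_zero, Fin.mk_one, Fin.zero_eta]
    first | (left; ring1) | (right; ring1)
  · refine key 0 3 2 4 2 1 (by decide) (by decide) (by decide) ?_
    simp only [offEdge, vertex, edgeEnds, br, Fin.isValue, Matrix.cons_val, Fin.reduceFinMk, Fin.mk_zero, Fin.mk_one, Fin.zero_eta]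
    first | (left; ring1) | (right; ring1)
  · refine key 1 3 2 4 3 0 (by decide) (by decide) (by decide) ?_
    simp only [offEdge, vertex, edgeEnds, br, Fin.isValue, Matrix.cons_val, Fin.reduceFinMk, Fin.mk_zero, Fin.mk_one, Fin.zero_eta]
    first | (left; ring1) | (right; ring1)
  · refine key 1 3 0 2 3 4 (by decide) (by decide) (by decide) ?_
    simp only [offEdge, vertex, edgeEnds, br, Fin.isValue, Matrix.cons_val, Fin.reduceFinMk, Fin.mk_zero, Fin.mk_one, Fin.zero_eta]
    first | (left; ring1) | (right; ring1)
  · refine key 1 3 2 4 4 0 (by decide) (by decide) (by decide) ?_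
    simp only [offEdge, vertex, edgeEnds, br, Fin.isValue, Matrix.cons_val, Fin.reduceFinMk, Fin.mk_zero, Fin.mk_one, Fin.zero_eta]
    first | (left; ring1) | (right; ring1)
  · refine key 2 4 0 1 4 3 (by decide) (by decide) (by decide) ?_
    simp only [offEdge, vertex, edgeEnds, br, Fin.isValue, Matrix.cons_val, Fin.reduceFinMk, Fin.mk_zero, Fin.mk_one, Fin.zero_eta]
    first | (left; ring1) | (right; ring1)
  · refine key 0 3 2 4 5 1 (by decide) (by decide) (by decide) ?_
    simp only [offEdge, vertex, edgeEnds, br, Fin.isValue, Matrix.cons_val, Fin.reduceFinMk, Fin.mk_zero, Fin.mk_one, Fin.zero_eta]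
    first | (left; ring1) | (right; ring1)
  · refine key 2 4 0 1 5 3 (by decide) (by decide) (by decide) ?_
    simp only [offEdge, vertex, edgeEnds, br, Fin.isValue, Matrix.cons_val, Fin.reduceFinMk, Fin.mk_zero, Fin.mk_one, Fin.zero_eta]
    first | (left; ring1) | (right; ring1)

/-- The size of the quadrangle with vertices `V`, measured along its first edge. -/
def quadSize (y : K → R) (δ : Option K) (V W : R × R) : R :=
  ny R δ * (W.1 - V.1) - nx y δ * (W.2 - V.2)

/-- Four points joined by lines of the given directions form a standard quadrangle. -/
theorem exists_eq_vertex {y : K → R} {d : Fin 6 → Option K}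
    (hn : nx y (d 0) * nx y (d 0) + ny R (d 0) * ny R (d 0) = 1)
    (hd : ∀ e e', Adjacent e e' → IsUnit (br y (d e) (d e'))) (V : Fin 4 → R × R)
    (hV : ∀ e, nx y (d e) * (V (edgeEnds e).1).1 + ny R (d e) * (V (edgeEnds e).1).2 =
      nx y (d e) * (V (edgeEnds e).2).1 + ny R (d e) * (V (edgeEnds e).2).2)
    (hs : IsUnit (quadSize y (d 0) (V 0) (V 1))) :
    Closes y d ∧ ∃ σ, ∀ i, V i = V 0 + vertex y d σ i := by
  have h0 := hV 0
  have h1 := hV 1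
  have h2 := hV 2
  have h3 := hV 3
  have h4 := hV 4
  have h5 := hV 5
  simp only [edgeEnds, Fin.isValue, Matrix.cons_val] at h0 h1 h2 h3 h4 h5
  obtain ⟨v, hv⟩ := ((hd 1 3 (by decide)).mul (hd 2 4 (by decide))).exists_right_inv
  -- The size is forced by the first edge, on which `quadSize` of the standard quadrangle is `σ * br
  -- 1 3 * br 2 4`. By `hn` this determines `V 1`, then `V 2` and `V 3` are intersections of two
  -- edges each.
  obtain ⟨σ, hσ⟩ : ∃ σ, σ = quadSize y (d 0) (V 0) (V 1) * v := ⟨_, rfl⟩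
  have hσu : IsUnit σ := by
    rw [hσ]
    exact hs.mul (IsUnit.of_mul_eq_one_right _ hv)
  have hσ' : quadSize y (d 0) (V 0) (V 1) = σ * br y (d 1) (d 3) * br y (d 2) (d 4) := by
    rw [hσ]
    linear_combination -quadSize y (d 0) (V 0) (V 1) * hv
  have e1 : V 1 = V 0 + vertex y d σ 1 := by
    apply Prod.ext
    · simp only [vertex, Fin.isValue, Matrix.cons_val, Prod.fst_add]
      rw [← hσ', quadSize]
      linear_combination -((V 1).1 - (V 0).1) * hn - nx y (d 0) * h0
    · simp only [vertex, Fin.isValue, Matrix.cons_val, Prod.snd_add]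
      rw [← hσ', quadSize]
      linear_combination -((V 1).2 - (V 0).2) * hn - ny R (d 0) * h0
  have e2 : V 2 = V 0 + vertex y d σ 2 := by
    refine eq_of_br_isUnit (hd 1 3 (by decide)) ?_ ?_
    · rw [← h1]
      simp only [vertex, Fin.isValue, Matrix.cons_val, Prod.fst_add, Prod.snd_add]
      ring
    · rw [← h3, e1]
      simp only [vertex, Fin.isValue, Matrix.cons_val, Prod.fst_add, Prod.snd_add, br]
      ring
  have e3 : V 3 = V 0 + vertex y d σ 3 := by
    refine eq_of_br_isUnit (hd 2 4 (by decide)) ?_ ?_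
    · rw [← h2]
      simp only [vertex, Fin.isValue, Matrix.cons_val, Prod.fst_add, Prod.snd_add]
      ring
    · rw [← h4, e1]
      simp only [vertex, Fin.isValue, Matrix.cons_val, Prod.fst_add, Prod.snd_add, br]
      ring
  refine ⟨?_, σ, fun i => ?_⟩
  -- The one unused edge yields the closing relation multiplied by the unit `σ`.
  · apply hσu.mul_left_cancel
    rw [e2, e3] at h5
    simp only [vertex, Fin.isValue, Matrix.cons_val, Prod.fst_add, Prod.snd_add, br] at h5 ⊢
    linear_combination h5
  · fin_cases i
    · simp [vertex]
    · exact e1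
    · exact e2
    · exact e3

theorem map_vertex {S : Type} [CommRing S] (f : R →+* S) {y : K → R} {z : K → S}
    {d : Fin 6 → Option K} (h : ∀ e, ∀ k ∈ d e, f (y k) = z k) (σ : R) (i : Fin 4) :
    (f (vertex y d σ i).1, f (vertex y d σ i).2) = vertex z d (f σ) i := by
  have hb : ∀ e e', f (br y (d e) (d e')) = br z (d e) (d e') := fun e e' =>
    map_br f y z _ _ (h e) (h e')
  have hx : ∀ e, f (nx y (d e)) = nx z (d e) := fun e => map_nx f y z _ (h e)
  fin_cases i <;> simp [vertex, hb, hx, map_ny]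

end Quadrangle

/-! ## Quadrangles of relations -/

namespace SlopeRel
variable {K : Type} [Field K]

/-- The directions of the edges of the quadrangle attached to a relation. -/
def dir (q : SlopeRel K) : Fin 6 → Option K :=
  ![if q.mul then some 0 else none, some q.a, some q.c, some q.d, some q.b, none]

/-- Adjacent edges pair a left slope with a right one, or a slope with the vertical or horizontal
direction; these are the exclusions in `Valid`. Opposite edges are allowed to be parallel: `a = b`
and `c = d` may occur, and in the additive case both the first and the last edge are vertical. -/
theorem Valid.dir_ne {q : SlopeRel K} {E : Finset K} (h : q.Valid E) {e e' : Fin 6}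
    (he : Adjacent e e') : q.dir e ≠ q.dir e' := by
  have h1 := h.hac
  have h2 := h.had
  have h3 := h.hbc
  have h4 := h.hbd
  have h1' := h.hac.symm
  have h2' := h.had.symm
  have h3' := h.hbc.symm
  have h4' := h.hbd.symm
  by_cases hm : q.mul = true
  · obtain ⟨ha, hb, hc, hd⟩ := h.ne_zero hm
    have ha' := ha.symm
    have hb' := hb.symm
    have hc' := hc.symm
    have hd' := hd.symm
    fin_cases e <;> fin_cases e' <;> first | exact (absurd he (by decide)) | simp [dir, *]
  · fin_cases e <;> fin_cases e' <;> first | exact (absurd he (by decide)) | simp [dir, *]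

theorem Valid.dir_mem {q : SlopeRel K} {E : Finset K} (h : q.Valid E) (h0 : 0 ∈ E) (e : Fin 6) :
    ∀ k ∈ q.dir e, k ∈ E := by
  intro k hk
  fin_cases e <;> simp [dir] at hk
  · obtain ⟨-, rfl⟩ := hk; exact h0
  · exact hk ▸ h.ha
  · exact hk ▸ h.hc
  · exact hk ▸ h.hd
  · exact hk ▸ h.hb

/-- For a sum, all four slopes belong to edges joining two vertical lines, and both sides add up the
same height differences. For a product, vertices `3` and `4` lie on a vertical line and `1` and `2`
on a horizontal one; both sides are the product of two heights divided by the product of two widths.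
-/
theorem closes_iff (q : SlopeRel K) {R : Type} [CommRing R] {y : K → R} (h0 : y 0 = 0) :
    Closes y q.dir ↔ q.Holds y := by
  rw [Closes, Holds]
  by_cases hm : q.mul = true
  · simp only [dir, hm, if_true, br, Fin.isValue, Matrix.cons_val, nx_some, nx_none, ny_some,
      ny_none, h0]
    exact ⟨fun h => by linear_combination h, fun h => by linear_combination h⟩
  · simp only [dir, hm, br, Fin.isValue, Matrix.cons_val, nx_some, nx_none, ny_some,
      ny_none]
    simp only [Bool.false_eq_true, if_false, nx_none, ny_none]
    exact ⟨fun h => by linear_combination h, fun h => by linear_combination h⟩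

theorem dir_zero_normal (q : SlopeRel K) {R : Type} [CommRing R] {y : K → R} (h0 : y 0 = 0) :
    nx y (q.dir 0) * nx y (q.dir 0) + ny R (q.dir 0) * ny R (q.dir 0) = 1 := by
  by_cases hm : q.mul = true <;> simp [dir, hm, h0]

end SlopeRel

/-! ## Generic positions -/

/-- Join a good vector for the earlier functions to a good vector for the next one. Along this line
each function is affine and not identically zero, so only finitely many parameters are excluded. -/
theorem exists_forall_ne_zero {K V ι : Type} [Field K] [Infinite K] [AddCommGroup V] [Module K V]
    [Finite ι] (F : ι → V → K)
    (hF : ∀ i v w (r : K), F i (v + r • (w - v)) = F i v + r * (F i w - F i v))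
    (h : ∀ i, ∃ v, F i v ≠ 0) : ∃ v, ∀ i, F i v ≠ 0 := by
  classical
  have := Fintype.ofFinite ι
  suffices ∀ s : Finset ι, ∃ v, ∀ i ∈ s, F i v ≠ 0 by
    obtain ⟨v, hv⟩ := this Finset.univ
    exact ⟨v, fun i => hv i (Finset.mem_univ i)⟩
  intro s
  induction s using Finset.induction_on with
  | empty => exact ⟨0, by simp⟩
  | insert j s hj ih =>
    obtain ⟨v, hv⟩ := ih
    obtain ⟨w, hw⟩ := h j
    have key : ∀ i, (F i v ≠ 0 ∨ F i w ≠ 0) →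
        ∀ᶠ r : K in Filter.cofinite, F i (v + r • (w - v)) ≠ 0 := by
      intro i hi
      by_cases hne : F i w - F i v = 0
      · refine Filter.Eventually.of_forall fun r => ?_
        rw [hF, hne, mul_zero, add_zero]
        rcases hi with hi | hi
        · exact hi
        · rwa [← sub_eq_zero.1 hne]
      · refine SlopeSystem.eventually_ne (fun r => F i (v + r • (w - v))) (fun _ => 0) hne
          fun a b => ?_
        rw [hF, hF]
        ring
    have h1 : ∀ᶠ r : K in Filter.cofinite, ∀ i ∈ insert j s, F i (v + r • (w - v)) ≠ 0 := by
      rw [Filter.eventually_all_finset]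
      intro i hi
      rcases Finset.mem_insert.1 hi with rfl | hi
      · exact key _ (Or.inr hw)
      · exact key _ (Or.inl (hv i hi))
    obtain ⟨r, hr⟩ := h1.exists
    exact ⟨_, hr⟩

namespace SlopeSystem
variable {K : Type} [Field K] (s : SlopeSystem K)

/-! ## The arrangement of a slope system -/

/-- The affine lines of the arrangement: the diagonal, and six edges for each relation. -/
abbrev Line : Type := Option ({q // q ∈ s.L} × Fin 6)

variable {s}

/-- The direction of an affine line of the arrangement. -/
def lineDir : s.Line → Option K
  | none => some 1
  | some (g, e) => g.1.dir e

/-- The relation to which an affine line of the arrangement belongs, if any. -/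
def block : s.Line → Option {q // q ∈ s.L} := Option.map Prod.fst

/-- The constant term of the equation of a line, in terms of the vertices. -/
def lineConst {R : Type} [CommRing R] (y : K → R) (V : {q // q ∈ s.L} → Fin 4 → R × R) :
    s.Line → R
  | none => 0
  | some (g, e) => nx y (g.1.dir e) * (V g (edgeEnds e).1).1 +
      ny R (g.1.dir e) * (V g (edgeEnds e).1).2

/-- The point `P` is on the line `a`. -/
def OnLine {R : Type} [CommRing R] (y : K → R) (V : {q // q ∈ s.L} → Fin 4 → R × R)
    (a : s.Line) (P : R × R) : Prop :=
  nx y (lineDir a) * P.1 + ny R (lineDir a) * P.2 = lineConst y V a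

theorem lineDir_mem (a : s.Line) : ∀ k ∈ lineDir a, k ∈ s.E := by
  rcases a with _ | ⟨g, e⟩
  · rintro k hk
    obtain rfl : 1 = k := by simpa [lineDir] using hk
    exact s.one_mem
  · exact (s.valid _ g.2).dir_mem s.zero_mem e

/-- The vertices of unit quadrangles with base points `T`. -/
def vert (T : {q // q ∈ s.L} → K × K) (g : {q // q ∈ s.L}) (i : Fin 4) : K × K :=
  T g + vertex id g.1.dir 1 i

theorem closes_id (g : {q // q ∈ s.L}) : Closes (id : K → K) g.1.dir :=
  (g.1.closes_iff rfl).2 (s.valid _ g.2).holds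

/-- Ends are on the edge because the relation holds in `K`; the other vertices are off it by
`offEdge_ne_zero`. -/
theorem onLine_vert_iff (T : {q // q ∈ s.L} → K × K) (g : {q // q ∈ s.L}) (e : Fin 6)
    (i : Fin 4) : OnLine id (vert T) (some (g, e) : s.Line) (vert T g i) ↔ IsEnd i e := by
  by_cases h : IsEnd i e
  · refine iff_of_true ?_ h
    have := vertex_mem_edge (closes_id g) (1 : K) h
    simp only [OnLine, lineDir, lineConst, vert, Prod.fst_add, Prod.snd_add]
    linear_combination this
  · refine iff_of_false (fun hon => ?_) h
    refine offEdge_ne_zero (one_ne_zero : (1 : K) ≠ 0)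
      (fun a b hab => br_id_ne_zero ((s.valid _ g.2).dir_ne hab)) h ?_
    simp only [OnLine, lineDir, lineConst, vert, Prod.fst_add, Prod.snd_add] at hon
    rw [offEdge]
    linear_combination hon

theorem lineConst_affine (T T' : {q // q ∈ s.L} → K × K) (r : K) (a : s.Line) :
    lineConst id (vert (T + r • (T' - T))) a =
      lineConst id (vert T) a + r * (lineConst id (vert T') a - lineConst id (vert T) a) := by
  rcases a with _ | ⟨g, e⟩
  · simp [lineConst]
  · simp only [lineConst, vert, Prod.fst_add, Prod.snd_add, Pi.add_apply, Pi.smul_apply,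
      Pi.sub_apply, Prod.smul_fst, Prod.smul_snd, Prod.fst_sub, Prod.snd_sub, smul_eq_mul]
    ring

/-- A vector moving lines of the given direction by one. -/
def shiftVec (K : Type) [Field K] (δ : Option K) : K × K := (1 - ny K δ, ny K δ)

theorem shiftVec_spec (δ : Option K) :
    nx id δ * (shiftVec K δ).1 + ny K δ * (shiftVec K δ).2 = 1 := by
  cases δ <;> simp [shiftVec]

-- Translating one quadrangle changes the constants of its own edges only; this isolates each
-- genericity condition.
open Classical in
theorem lineConst_single (g : {q // q ∈ s.L}) (v : K × K) (a : s.Line) :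
    lineConst id (vert (Pi.single g v)) a = lineConst id (vert 0) a +
      if block a = some g then nx id (lineDir a) * v.1 + ny K (lineDir a) * v.2 else 0 := by
  rcases a with _ | ⟨g', e⟩
  · simp [lineConst, block]
  · by_cases hg : g' = g
    · subst hg
      simp only [lineConst, lineDir, block, vert, Option.map_some, if_true, Prod.fst_add,
        Prod.snd_add, Pi.single_eq_same, Pi.zero_apply, Prod.fst_zero, Prod.snd_zero]
      ring
    · simp [lineConst, block, vert, hg, Pi.single_eq_of_ne]

/-- The three lines have a common point only if this vanishes. -/
def concurrency (V : {q // q ∈ s.L} → Fin 4 → K × K) (a b c : s.Line) : K :=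
  br id (lineDir b) (lineDir c) * lineConst id V a +
    br id (lineDir c) (lineDir a) * lineConst id V b +
    br id (lineDir a) (lineDir b) * lineConst id V c

theorem concurrency_eq_zero {V : {q // q ∈ s.L} → Fin 4 → K × K} {a b c : s.Line} {P : K × K}
    (ha : OnLine id V a P) (hb : OnLine id V b P) (hc : OnLine id V c P) :
    concurrency V a b c = 0 := by
  rw [concurrency, ← ha, ← hb, ← hc]
  simp only [br]
  ring

/-- The base points `T` are in general position. -/
structure Generic (T : {q // q ∈ s.L} → K × K) : Prop where
  parallel : ∀ a b : s.Line, block a ≠ block b → lineDir a = lineDir b →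
    lineConst id (vert T) a ≠ lineConst id (vert T) b
  concurrent : ∀ a b c : s.Line, block a ≠ block b → block a ≠ block c →
    lineDir a ≠ lineDir b → lineDir b ≠ lineDir c → lineDir c ≠ lineDir a →
    concurrency (vert T) a b c ≠ 0
  zero : ∀ a : s.Line, a ≠ none → ¬ OnLine id (vert T) a (0, 0)
  one : ∀ a : s.Line, a ≠ none → ¬ OnLine id (vert T) a (1, 1)

/-- Each condition is the nonvanishing of a function affine in the base points. It suffices that the
function is not constant, which is seen by moving a single quadrangle. -/
theorem exists_generic [Infinite K] : ∃ T : {q // q ∈ s.L} → K × K, Generic T := by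
  classical
  let ι := {p : s.Line × s.Line // block p.1 ≠ block p.2 ∧ lineDir p.1 = lineDir p.2} ⊕
    {p : s.Line × s.Line × s.Line // block p.1 ≠ block p.2.1 ∧ block p.1 ≠ block p.2.2 ∧
      lineDir p.1 ≠ lineDir p.2.1 ∧ lineDir p.2.1 ≠ lineDir p.2.2 ∧ lineDir p.2.2 ≠ lineDir p.1} ⊕
    {p : s.Line × K // p.1 ≠ none ∧ (p.2 = 0 ∨ p.2 = 1)}
  have hfin : Finite {p : s.Line × K // p.1 ≠ none ∧ (p.2 = 0 ∨ p.2 = 1)} := by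
    refine Set.Finite.subset (s := Set.univ ×ˢ {0, 1}) (Set.finite_univ.prod (by simp)) ?_
    rintro ⟨a, k⟩ ⟨-, h⟩
    exact ⟨trivial, h⟩
  let F : ι → ({q // q ∈ s.L} → K × K) → K := Sum.elim
    (fun p T => lineConst id (vert T) p.1.1 - lineConst id (vert T) p.1.2)
    (Sum.elim (fun p T => concurrency (vert T) p.1.1 p.1.2.1 p.1.2.2)
      (fun p T => lineConst id (vert T) p.1.1 -
        (nx id (lineDir p.1.1) * p.1.2 + ny K (lineDir p.1.1) * p.1.2)))
  have hmove : ∀ i, (∃ g v, F i (Pi.single g v) - F i 0 ≠ 0) → ∃ v, F i v ≠ 0 := by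
    rintro i ⟨g, v, h⟩
    by_contra hcon
    push Not at hcon
    rw [hcon, hcon, sub_zero] at h
    exact h rfl
  obtain ⟨T, hT⟩ := exists_forall_ne_zero F (by
    rintro (p | p | p) v w r
    · simp only [F, Sum.elim_inl, lineConst_affine]
      ring
    · simp only [F, Sum.elim_inl, Sum.elim_inr, concurrency, lineConst_affine]
      ring
    · simp only [F, Sum.elim_inr, lineConst_affine]
      ring) (by
    rintro (⟨⟨a, b⟩, h1, h2⟩ | ⟨⟨a, b, c⟩, h1, h2, h3, h4, h5⟩ | ⟨⟨a, k⟩, h1, h2⟩)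
    · apply hmove
      simp only [F, Sum.elim_inl]
      rcases ha : block a with _ | g
      · rcases hb : block b with _ | g
        · exact (h1 (ha.trans hb.symm)).elim
        · refine ⟨g, shiftVec K (lineDir b), ?_⟩
          rw [lineConst_single, lineConst_single, if_pos hb, if_neg (by simp [ha]), shiftVec_spec]
          ring_nf
          simp
      · refine ⟨g, shiftVec K (lineDir a), ?_⟩
        rw [lineConst_single, lineConst_single, if_pos ha,
          if_neg (fun hb => h1 (ha.trans hb.symm)), shiftVec_spec]
        ring_nf
        simp
    · apply hmove
      simp only [F, Sum.elim_inl, Sum.elim_inr, concurrency]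
      simp only at h1 h2 h3 h4 h5
      rcases ha : block a with _ | g
      · rcases hb : block b with _ | g
        · exact (h1 (ha.trans hb.symm)).elim
        · by_cases hc : block c = some g
          -- Here `a` is the diagonal, while `b` and `c` belong to the same quadrangle. Moving both
          -- across `a` has the effect of moving `a` backwards, and the determinant changes by `-br
          -- b c`.
          · refine ⟨g, shiftVec K (lineDir a), ?_⟩
            rw [lineConst_single, lineConst_single, lineConst_single, if_pos hb, if_pos hc,
              if_neg (by simp [ha])]
            have hs := shiftVec_spec (lineDir a)
            refine ne_of_eq_of_ne (b := -br id (lineDir b) (lineDir c)) ?_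
              (neg_ne_zero.2 (br_id_ne_zero h4))
            simp only [br] at hs ⊢
            linear_combination
              -(nx id (lineDir b) * ny K (lineDir c) - ny K (lineDir b) * nx id (lineDir c)) * hs
          · refine ⟨g, shiftVec K (lineDir b), ?_⟩
            rw [lineConst_single, lineConst_single, lineConst_single, if_pos hb, if_neg hc,
              if_neg (by simp [ha]), shiftVec_spec]
            refine ne_of_eq_of_ne ?_ (br_id_ne_zero h5)
            ring
      · refine ⟨g, shiftVec K (lineDir a), ?_⟩
        rw [lineConst_single, lineConst_single, lineConst_single, if_pos ha,
          if_neg (fun hb => h1 (ha.trans hb.symm)), if_neg (fun hc => h2 (ha.trans hc.symm)),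
          shiftVec_spec]
        refine ne_of_eq_of_ne ?_ (br_id_ne_zero h4)
        ring
    · apply hmove
      simp only [F, Sum.elim_inr]
      rcases a with _ | ⟨g, e⟩
      · exact (h1 rfl).elim
      · refine ⟨g, shiftVec K (lineDir (some (g, e) : s.Line)), ?_⟩
        rw [lineConst_single, if_pos (show block (some (g, e) : s.Line) = some g from rfl),
          shiftVec_spec]
        ring_nf
        simp)
  refine ⟨T, fun a b h1 h2 => ?_, fun a b c h1 h2 h3 h4 h5 =>
    hT (Sum.inr (Sum.inl ⟨(a, b, c), h1, h2, h3, h4, h5⟩)), fun a ha h => ?_, fun a ha h => ?_⟩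
  · exact sub_ne_zero.1 (hT (Sum.inl ⟨(a, b), h1, h2⟩))
  · exact hT (Sum.inr (Sum.inr ⟨(a, 0), ha, Or.inl rfl⟩)) (sub_eq_zero.2 h.symm)
  · exact hT (Sum.inr (Sum.inr ⟨(a, 1), ha, Or.inr rfl⟩)) (sub_eq_zero.2 h.symm)

/-! ### Incidences of a generic arrangement -/

theorem eq_of_onLine {V : {q // q ∈ s.L} → Fin 4 → K × K} {a b : s.Line} {P Q : K × K}
    (hne : lineDir a ≠ lineDir b) (h1 : OnLine id V a P) (h2 : OnLine id V b P)
    (h3 : OnLine id V a Q) (h4 : OnLine id V b Q) : P = Q :=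
  eq_of_br_isUnit (br_id_ne_zero hne).isUnit (h1.trans h3.symm) (h2.trans h4.symm)

section
variable {T : {q // q ∈ s.L} → K × K} (hT : Generic T)
include hT

/-- Across blocks this is genericity. Within a quadrangle, equal constants would put every end of
one edge on the other edge, against `onLine_vert_iff`. -/
theorem Generic.lineConst_ne {a b : s.Line} (hab : a ≠ b) (hd : lineDir a = lineDir b) :
    lineConst id (vert T) a ≠ lineConst id (vert T) b := by
  by_cases hb : block a = block b
  · intro hc
    rcases a with _ | ⟨g, e⟩
    · rcases b with _ | ⟨g', e'⟩
      · exact hab rfl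
      · simp [block] at hb
    · rcases b with _ | ⟨g', e'⟩
      · simp [block] at hb
      · obtain rfl : g = g' := by simpa [block] using hb
        have hne : e ≠ e' := fun h => hab (h ▸ rfl)
        obtain ⟨i, h1, h2⟩ := exists_isEnd_not_isEnd e e' hne
        refine h2 ((onLine_vert_iff T g e i).1 ?_)
        have := (onLine_vert_iff T g e' i).2 h1
        rw [OnLine] at this ⊢
        rw [hd, hc, this]
  · exact hT.parallel a b hb hd

theorem Generic.lineDir_ne {a b : s.Line} {P : K × K} (hab : a ≠ b)
    (ha : OnLine id (vert T) a P) (hb : OnLine id (vert T) b P) : lineDir a ≠ lineDir b := by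
  intro hd
  refine hT.lineConst_ne hab hd ?_
  rw [← ha, ← hb, hd]

/-- Concurrent distinct lines have different directions; if they came from different blocks, the
concurrency determinant would vanish against genericity. -/
theorem Generic.block_eq {a b c : s.Line} {P : K × K} (hab : a ≠ b) (hac : a ≠ c) (hbc : b ≠ c)
    (ha : OnLine id (vert T) a P) (hb : OnLine id (vert T) b P) (hc : OnLine id (vert T) c P) :
    block a = block b := by
  by_contra h
  by_cases h' : block a = block c
  · exact hT.concurrent b c a (fun e => h (h'.trans e.symm)) (Ne.symm h) (hT.lineDir_ne hbc hb hc)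
      (hT.lineDir_ne hac.symm hc ha) (hT.lineDir_ne hab ha hb) (concurrency_eq_zero hb hc ha)
  · exact hT.concurrent a b c h h' (hT.lineDir_ne hab ha hb) (hT.lineDir_ne hbc hb hc)
      (hT.lineDir_ne hac.symm hc ha) (concurrency_eq_zero ha hb hc)

/-- Two adjacent edges already pass through the vertex, so any further line through it belongs to
the same quadrangle. -/
theorem Generic.isEnd_of_onLine_vert {a : s.Line} {g : {q // q ∈ s.L}} {i : Fin 4}
    (h : OnLine id (vert T) a (vert T g i)) : ∃ e, a = some (g, e) ∧ IsEnd i e := by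
  obtain ⟨e, e', hee, h1, h2⟩ := exists_adjacent_of_isEnd i
  have k1 := (onLine_vert_iff T g e i).2 h1
  have k2 := (onLine_vert_iff T g e' i).2 h2
  by_cases ha : a = some (g, e)
  · exact ⟨e, ha, h1⟩
  by_cases ha' : a = some (g, e')
  · exact ⟨e', ha', h2⟩
  have := hT.block_eq ha ha' (by simpa using hee.1) h k1 k2
  rcases a with _ | ⟨g', e''⟩
  · simp [block] at this
  · obtain rfl : g' = g := by simpa [block] using this
    exact ⟨e'', rfl, (onLine_vert_iff T _ e'' i).1 h⟩

/-- A point of the arrangement that is not a vertex is on at most two lines. -/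
theorem Generic.eq_or_eq {a b c : s.Line} {P : K × K} (hP : ∀ g i, P ≠ vert T g i) (hab : a ≠ b)
    (ha : OnLine id (vert T) a P) (hb : OnLine id (vert T) b P) (hc : OnLine id (vert T) c P) :
    c = a ∨ c = b := by
  by_contra! h
  obtain ⟨hca, hcb⟩ := h
  have h1 := hT.block_eq hab hca.symm hcb.symm ha hb hc
  have h2 := hT.block_eq hca hcb hab hc ha hb
  rcases a with _ | ⟨g, e⟩
  · rcases b with _ | ⟨g', e'⟩
    · exact hab rfl
    · simp [block] at h1
  rcases b with _ | ⟨g', e'⟩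
  · simp [block] at h1
  rcases c with _ | ⟨g'', e''⟩
  · simp [block] at h2
  obtain rfl : g = g' := by simpa [block] using h1
  obtain rfl : g'' = g := by simpa [block] using h2
  have key : ∀ e₁ e₂, Adjacent e₁ e₂ → OnLine id (vert T) (some (g'', e₁) : s.Line) P →
      OnLine id (vert T) (some (g'', e₂) : s.Line) P → False := by
    intro e₁ e₂ h12 k1 k2
    obtain ⟨i, hi1, hi2⟩ := exists_isEnd_of_adjacent e₁ e₂ h12
    exact hP g'' i (eq_of_onLine (hT.lineDir_ne (by simpa using h12.1) k1 k2) k1 k2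
      ((onLine_vert_iff T g'' e₁ i).2 hi1) ((onLine_vert_iff T g'' e₂ i).2 hi2))
  rcases adjacent_or_adjacent e e' e'' (fun h => hab (h ▸ rfl)) (fun h => hca (h ▸ rfl))
    (fun h => hcb (h ▸ rfl)) with h | h
  · exact key _ _ h ha hb
  · exact key _ _ h ha hc

end

end SlopeSystem

/-! ### Labeling a finite configuration -/

/-- Allows points and lines to be indexed by convenient finite types; the enumeration is only
required to begin with the four anchors. -/
theorem exists_incidenceData {Pt Ln : Type} [Finite Pt] [Finite Ln] (q : Fin 4 → Pt)
    (hq : Function.Injective q) (inc : Pt → Ln → Prop)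
    (hcommon : ∀ j j', j ≠ j' → ∃ i, inc i j ∧ inc i j')
    (hthree : ∀ j, ∃ f : Fin 3 → Pt, Function.Injective f ∧ ∀ k, inc (f k) j) :
    ∃ (D : IncidenceData) (e : Fin D.M ≃ Pt) (e' : Fin D.N ≃ Ln),
      (∀ k, e (Fin.castLE D.four_le k) = q k) ∧ ∀ i j, D.inc i j ↔ inc (e i) (e' j) := by
  classical
  have := Fintype.ofFinite Pt
  have h4 : 4 ≤ Nat.card Pt := by
    simpa using Nat.card_le_card_of_injective q hq
  let ι : Fin 4 → Fin (Nat.card Pt) := Fin.castLE h4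
  have hι : Function.Injective ι := Fin.castLE_injective h4
  -- The default `q 0` does not matter: the enumeration below agrees with `f` only on the first four
  -- indices.
  let f : Fin (Nat.card Pt) → Pt := fun x => if h : ∃ k, ι k = x then q h.choose else q 0
  have hf : ∀ k, f (ι k) = q k := fun k => by
    have h : ∃ k', ι k' = ι k := ⟨k, rfl⟩
    simp only [f, dif_pos h]
    rw [hι h.choose_spec]
  obtain ⟨e, he⟩ := Finset.exists_equiv_extend_of_card_eq (t := (Finset.univ : Finset Pt))
    (s := Finset.univ.image ι) (f := f) (by simp) (by simp) (by
      intro x hx y hy hxy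
      simp only [Finset.coe_image, Finset.coe_univ, Set.image_univ, Set.mem_range] at hx hy
      obtain ⟨k, rfl⟩ := hx
      obtain ⟨k', rfl⟩ := hy
      rw [hf, hf] at hxy
      rw [hq hxy])
  let e₁ : Fin (Nat.card Pt) ≃ Pt := e.trans (Equiv.subtypeUnivEquiv Finset.mem_univ)
  let e' : Fin (Nat.card Ln) ≃ Ln := (Finite.equivFin Ln).symm
  refine ⟨⟨Nat.card Pt, Nat.card Ln, h4, fun i j => inc (e₁ i) (e' j), fun j j' hj => ?_,
    fun j => ?_⟩, e₁, e', fun k => ?_, fun i j => Iff.rfl⟩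
  · obtain ⟨i, h1, h2⟩ := hcommon (e' j) (e' j') (fun h => hj (e'.injective h))
    exact ⟨e₁.symm i, by simpa using h1, by simpa using h2⟩
  · obtain ⟨g, hg, hg'⟩ := hthree (e' j)
    have h1 : Set.range (e₁.symm ∘ g) ⊆ {i | inc (e₁ i) (e' j)} := by
      rintro _ ⟨k, rfl⟩
      simpa using hg' k
    have h2 := Set.ncard_le_ncard h1 (Set.toFinite _)
    rwa [Set.ncard_eq_toFinset_card', Set.toFinset_range, Finset.card_image_of_injective _
      (e₁.symm.injective.comp hg), Finset.card_univ, Fintype.card_fin] at h2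
  · exact (he (ι k) (by simp)).trans (hf k)

/-! ### Marked points and lines of the arrangement -/

namespace SlopeSystem
variable {K : Type} [Field K] {s : SlopeSystem K}

/-- The affine points of the arrangement. -/
def affinePts (T : {q // q ∈ s.L} → K × K) : Set (K × K) :=
  {P | P = (0, 0) ∨ P = (1, 1) ∨ ∃ a b : s.Line, lineDir a ≠ lineDir b ∧
    OnLine id (vert T) a P ∧ OnLine id (vert T) b P}

instance (T : {q // q ∈ s.L} → K × K) : Finite (affinePts T) := by
  have h : affinePts T ⊆ {(0, 0)} ∪ ({(1, 1)} ∪ ⋃ p : s.Line × s.Line,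
      {P | lineDir p.1 ≠ lineDir p.2 ∧ OnLine id (vert T) p.1 P ∧ OnLine id (vert T) p.2 P}) := by
    rintro P (rfl | rfl | ⟨a, b, h⟩)
    · exact Or.inl rfl
    · exact Or.inr (Or.inl rfl)
    · exact Or.inr (Or.inr (Set.mem_iUnion.2 ⟨(a, b), h⟩))
  refine Set.Finite.subset ?_ h
  refine (Set.finite_singleton _).union ((Set.finite_singleton _).union
    (Set.finite_iUnion fun p => Set.Subsingleton.finite ?_))
  rintro P ⟨h1, h2, h3⟩ Q ⟨-, h2', h3'⟩
  exact eq_of_onLine h1 h2 h3 h2' h3'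

/-- The points of the configuration: the directions and the affine points. -/
abbrev Pt (T : {q // q ∈ s.L} → K × K) : Type := Option {k // k ∈ s.E} ⊕ affinePts T

variable (s) in
/-- The lines of the configuration: the line at infinity and the affine lines. -/
abbrev Ln : Type := Option s.Line

/-- The required incidences. -/
def Inc (T : {q // q ∈ s.L} → K × K) : Pt T → s.Ln → Prop
  | Sum.inl _, none => True
  | Sum.inl δ, some a => δ.map Subtype.val = lineDir a
  | Sum.inr _, none => False
  | Sum.inr P, some a => OnLine id (vert T) a P

variable (T : {q // q ∈ s.L} → K × K)

/-- The origin of the affine plane. -/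
def ptZero : affinePts T := ⟨(0, 0), Or.inl rfl⟩

/-- The point `(1, 1)` of the affine plane. -/
def ptOne : affinePts T := ⟨(1, 1), Or.inr (Or.inl rfl)⟩

theorem ptZero_ne_ptOne : ptZero T ≠ ptOne T := fun h =>
  zero_ne_one (α := K) (congrArg (fun P : affinePts T => P.1.1) h)

/-- The four anchor points. -/
def anchorPt : Fin 4 → Pt T :=
  ![Sum.inr (ptZero T), Sum.inl none, Sum.inl (some ⟨0, s.zero_mem⟩), Sum.inr (ptOne T)]

theorem anchorPt_injective : Function.Injective (anchorPt T) := by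
  intro i j h
  have h1 := ptZero_ne_ptOne T
  have h2 := h1.symm
  fin_cases i <;> fin_cases j <;> simp_all [anchorPt]

theorem exists_dirPt (a : s.Line) : ∃ δ : Option {k // k ∈ s.E},
    δ.map Subtype.val = lineDir a := by
  rcases h : lineDir a with _ | k
  · exact ⟨none, rfl⟩
  · exact ⟨some ⟨k, lineDir_mem a k h⟩, rfl⟩

theorem vert_mem (g : {q // q ∈ s.L}) (i : Fin 4) : vert T g i ∈ affinePts T := by
  obtain ⟨e, e', h, h1, h2⟩ := exists_adjacent_of_isEnd i
  exact Or.inr (Or.inr ⟨some (g, e), some (g, e'), (s.valid _ g.2).dir_ne h,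
    (onLine_vert_iff T g e i).2 h1, (onLine_vert_iff T g e' i).2 h2⟩)

theorem vert_injective (g : {q // q ∈ s.L}) : Function.Injective (vert T g) := by
  have key : ∀ i i' : Fin 4, i ≠ i' → ∃ e, IsEnd i e ∧ ¬ IsEnd i' e := by decide
  intro i i' h
  by_contra hne
  obtain ⟨e, h1, h2⟩ := key i i' hne
  exact h2 ((onLine_vert_iff T g e i').1 (h ▸ (onLine_vert_iff T g e i).2 h1))

theorem exists_common_pt (j j' : s.Ln) (h : j ≠ j') : ∃ i, Inc T i j ∧ Inc T i j' := by
  rcases j with _ | a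
  · rcases j' with _ | b
    · exact (h rfl).elim
    · obtain ⟨δ, hδ⟩ := exists_dirPt b
      exact ⟨Sum.inl δ, trivial, hδ⟩
  · rcases j' with _ | b
    · obtain ⟨δ, hδ⟩ := exists_dirPt a
      exact ⟨Sum.inl δ, hδ, trivial⟩
    · by_cases hd : lineDir a = lineDir b
      · obtain ⟨δ, hδ⟩ := exists_dirPt a
        exact ⟨Sum.inl δ, hδ, hδ.trans hd⟩
      · obtain ⟨P, h1, h2⟩ := exists_of_br_isUnit (br_id_ne_zero hd).isUnit
          (lineConst id (vert T) a) (lineConst id (vert T) b)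
        exact ⟨Sum.inr ⟨P, Or.inr (Or.inr ⟨a, b, hd, h1, h2⟩)⟩, h1, h2⟩

/-- An affine line carries its direction at infinity and two affine points: the two affine anchors
on the diagonal, the two ends on an edge. -/
theorem exists_three_pts (j : s.Ln) :
    ∃ f : Fin 3 → Pt T, Function.Injective f ∧ ∀ k, Inc T (f k) j := by
  rcases j with _ | a
  · refine ⟨![Sum.inl none, Sum.inl (some ⟨0, s.zero_mem⟩), Sum.inl (some ⟨1, s.one_mem⟩)],
      fun i j h => ?_, fun k => ?_⟩
    · fin_cases i <;> fin_cases j <;> simp_all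
    · fin_cases k <;> trivial
  · obtain ⟨δ, hδ⟩ := exists_dirPt a
    obtain ⟨P, Q, hPQ, h1, h2⟩ : ∃ P Q : affinePts T, P ≠ Q ∧ OnLine id (vert T) a P ∧
        OnLine id (vert T) a Q := by
      rcases a with _ | ⟨g, e⟩
      · refine ⟨ptZero T, ptOne T, ptZero_ne_ptOne T, ?_, ?_⟩ <;>
          simp [ptZero, ptOne, OnLine, lineConst, lineDir]
      · refine ⟨⟨_, vert_mem T g (edgeEnds e).1⟩, ⟨_, vert_mem T g (edgeEnds e).2⟩, fun h => ?_,
          (onLine_vert_iff T g e _).2 (isEnd_fst e), (onLine_vert_iff T g e _).2 (isEnd_snd e)⟩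
        have hne : ∀ e : Fin 6, (edgeEnds e).1 ≠ (edgeEnds e).2 := by decide
        exact hne e (vert_injective T g (congrArg Subtype.val h))
    refine ⟨![Sum.inl δ, Sum.inr P, Sum.inr Q], fun i j h => ?_, fun k => ?_⟩
    · have := hPQ.symm
      fin_cases i <;> fin_cases j <;> simp_all
    · fin_cases k
      exacts [hδ, h1, h2]

/-! ### Affine and homogeneous coordinates -/

/-- The normalized coordinate of a point. -/
def ptChart : Pt T → Fin 3
  | Sum.inl none => 1
  | Sum.inl (some _) => 0
  | Sum.inr _ => 2

/-- The normalized coordinate of a line. -/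
def lnChart : s.Ln → Fin 3
  | none => 2
  | some a => if lineDir a = none then 0 else 1

/-- Slopes, points and constant terms over `R` satisfying the required incidences. -/
structure IsAff {R : Type} [CommRing R] (y : K → R) (c : s.Line → R) (P : affinePts T → R × R) :
    Prop where
  zero : y 0 = 0
  one : y 1 = 1
  diag : c none = 0
  ptZero : P (ptZero T) = (0, 0)
  ptOne : P (ptOne T) = (1, 1)
  onLine : ∀ (X : affinePts T) a, OnLine id (vert T) a X.1 →
    nx y (lineDir a) * (P X).1 + ny R (lineDir a) * (P X).2 = c a

/-- Homogeneous coordinates of the points. -/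
def ptCoords {R : Type} [CommRing R] (y : K → R) (P : affinePts T → R × R) : Pt T → Fin 3 → R
  | Sum.inl none => ![0, 1, 0]
  | Sum.inl (some k) => ![1, y k, 0]
  | Sum.inr X => ![(P X).1, (P X).2, 1]

/-- Homogeneous coordinates of the lines. -/
def lnCoords {R : Type} [CommRing R] (y : K → R) (c : s.Line → R) : s.Ln → Fin 3 → R
  | none => ![0, 0, 1]
  | some a => ![nx y (lineDir a), ny R (lineDir a), -c a]

variable {T}
variable {D : IncidenceData} (e : Fin D.M ≃ Pt T) (e' : Fin D.N ≃ s.Ln)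
  (he : ∀ k, e (Fin.castLE D.four_le k) = anchorPt T k)
  (hinc : ∀ i j, D.inc i j ↔ Inc T (e i) (e' j))

include he in
theorem anchorCoords_ptChart (k : Fin 4) :
    anchorCoords k (ptChart T (e (Fin.castLE D.four_le k))) = 1 := by
  rw [he]
  fin_cases k <;> simp [anchorPt, ptChart, anchorCoords]

include he hinc in
theorem IsAff.isConfig {R : Type} [CommRing R] {y : K → R} {c : s.Line → R}
    {P : affinePts T → R × R} (h : IsAff T y c P) :
    IsConfig D (fun i => ptChart T (e i)) (fun j => lnChart (e' j))
      (fun i => ptCoords T y P (e i)) (fun j => lnCoords y c (e' j)) where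
  pt_one i := by
    rcases e i with (_ | k) | X <;> simp [ptChart, ptCoords]
  ln_one j := by
    rcases e' j with _ | a
    · simp [lnChart, lnCoords]
    · rcases ha : lineDir a with _ | k <;> simp [lnChart, lnCoords, ha]
  anchor k t := by
    rw [he]
    fin_cases k <;> fin_cases t <;>
      simp [anchorPt, ptCoords, anchorCoords, h.zero, h.ptZero, h.ptOne]
  incident i j hij := by
    rw [hinc] at hij
    rw [Fin.sum_univ_three]
    rcases hi : e i with (_ | k) | X <;> rcases hj : e' j with _ | a <;> rw [hi, hj] at hij
    · simp [ptCoords, lnCoords]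
    · have hij : none = lineDir a := hij
      simp [ptCoords, lnCoords, ← hij]
    · simp [ptCoords, lnCoords]
    · have hij : some k.1 = lineDir a := hij
      simp [ptCoords, lnCoords, ← hij]
    · exact hij.elim
    · have := h.onLine X a hij
      simp only [ptCoords, lnCoords, Fin.isValue, Matrix.cons_val]
      linear_combination this

-- Anchors and incidences force the shape of the coordinates. Two anchors on the line at infinity
-- make it `[0, 0, 1]`, so the directions have last coordinate zero; the direction on an affine line
-- fixes its normal vector. The diagonal through `(0, 0)` and `(1, 1)` gives the slope `1` the value
-- one.
include he hinc in
theorem exists_isAff {R : Type} [CommRing R] {p : Fin D.M → Fin 3 → R} {l : Fin D.N → Fin 3 → R}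
    (h : IsConfig D (fun i => ptChart T (e i)) (fun j => lnChart (e' j)) p l) :
    ∃ (y : K → R) (c : s.Line → R) (P : affinePts T → R × R), IsAff T y c P ∧
      (p = fun i => ptCoords T y P (e i)) ∧ (l = fun j => lnCoords y c (e' j)) ∧
      (∀ k : {k // k ∈ s.E}, y k = p (e.symm (Sum.inl (some k))) 1) ∧
      ∀ X, P X = (p (e.symm (Sum.inr X)) 0, p (e.symm (Sum.inr X)) 1) := by
  classical
  let p' : Pt T → Fin 3 → R := fun i => p (e.symm i)
  let l' : s.Ln → Fin 3 → R := fun j => l (e'.symm j)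
  have hp : ∀ i, p' i (ptChart T i) = 1 := fun i => by simpa [p'] using h.pt_one (e.symm i)
  have hl : ∀ j, l' j (lnChart j) = 1 := fun j => by simpa [l'] using h.ln_one (e'.symm j)
  have ha : ∀ k t, p' (anchorPt T k) t = anchorCoords k t := fun k t => by
    rw [← he]; simpa [p'] using h.anchor k t
  have hi : ∀ i j, Inc T i j → p' i 0 * l' j 0 + p' i 1 * l' j 1 + p' i 2 * l' j 2 = 0 := by
    intro i j hij
    have := h.incident (e.symm i) (e'.symm j) ((hinc _ _).2 (by simpa using hij))
    rwa [Fin.sum_univ_three] at this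
  have a0 := fun t => ha 0 t
  have a1 := fun t => ha 1 t
  have a2 := fun t => ha 2 t
  have a3 := fun t => ha 3 t
  simp only [anchorPt, Fin.isValue, Matrix.cons_val, anchorCoords] at a0 a1 a2 a3
  have v0 : p' (Sum.inl none) = ![0, 1, 0] := by
    funext t; rw [a1]; fin_cases t <;> simp
  have v2 : p' (Sum.inl (some ⟨0, s.zero_mem⟩)) = ![1, 0, 0] := by
    funext t; rw [a2]; fin_cases t <;> simp
  have w0 : p' (Sum.inr (ptZero T)) = ![0, 0, 1] := by
    funext t; rw [a0]; fin_cases t <;> simp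
  have w1 : p' (Sum.inr (ptOne T)) = ![1, 1, 1] := by
    funext t; rw [a3]; fin_cases t <;> simp
  have linf : l' none = ![0, 0, 1] := by
    have h1 := hi (Sum.inl none) none trivial
    have h2 := hi (Sum.inl (some ⟨0, s.zero_mem⟩)) none trivial
    have h3 := hl none
    rw [v0] at h1
    rw [v2] at h2
    simp only [Fin.isValue, Matrix.cons_val, zero_mul, one_mul, zero_add, add_zero] at h1 h2
    funext t
    fin_cases t
    · simpa using h2
    · simpa using h1
    · simpa [lnChart] using h3
  have v1 : ∀ k, p' (Sum.inl (some k)) = ![1, p' (Sum.inl (some k)) 1, 0] := fun k => by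
    have h1 := hi (Sum.inl (some k)) none trivial
    have h2 := hp (Sum.inl (some k))
    rw [linf] at h1
    simp only [Fin.isValue, Matrix.cons_val, mul_zero, mul_one, zero_add] at h1
    funext t
    fin_cases t
    · simpa [ptChart] using h2
    · rfl
    · simpa using h1
  -- Only slopes in `s.E` occur in the arrangement, so the default value is harmless.
  let y : K → R := fun k => if hk : k ∈ s.E then p' (Sum.inl (some ⟨k, hk⟩)) 1 else 0
  have hy : ∀ k : {k // k ∈ s.E}, y k = p' (Sum.inl (some k)) 1 := fun k => by simp [y]
  have hln : ∀ a, l' (some a) = ![nx y (lineDir a), ny R (lineDir a), -(-l' (some a) 2)] := by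
    intro a
    obtain ⟨δ, hδ⟩ := exists_dirPt a
    have h1 := hi (Sum.inl δ) (some a) hδ
    have h2 := hl (some a)
    rcases δ with _ | k
    · have hδ' : lineDir a = none := hδ.symm
      rw [v0] at h1
      simp only [Fin.isValue, Matrix.cons_val, zero_mul, one_mul, zero_add, add_zero] at h1
      simp only [lnChart, hδ', if_true] at h2
      rw [hδ']
      funext t
      fin_cases t
      · simpa using h2
      · simpa using h1
      · simp
    · have hδ' : lineDir a = some k.1 := hδ.symm
      rw [v1] at h1
      simp only [lnChart, hδ', reduceCtorEq, if_false] at h2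
      rw [hδ']
      funext t
      fin_cases t
      · simp only [Fin.isValue, Matrix.cons_val, zero_mul, one_mul, add_zero, h2, mul_one] at h1
        simp only [Fin.zero_eta, Fin.isValue, Matrix.cons_val, nx_some]
        rw [hy]
        linear_combination h1
      · simpa using h2
      · simp
  have hX : ∀ X : affinePts T, p' (Sum.inr X) 2 = 1 := fun X => hp (Sum.inr X)
  have hon : ∀ X a, OnLine id (vert T) a X.1 →
      nx y (lineDir a) * p' (Sum.inr X) 0 + ny R (lineDir a) * p' (Sum.inr X) 1 =
        -l' (some a) 2 := by
    intro X a hXa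
    have h1 := hi (Sum.inr X) (some a) hXa
    have h2 := congrFun (hln a) 0
    have h3 := congrFun (hln a) 1
    simp only [Fin.isValue, Matrix.cons_val] at h2 h3
    rw [h2, h3, hX] at h1
    linear_combination h1
  have hc : -l' (some none) 2 = 0 := by
    have := hon (ptZero T) none (by simp [ptZero, OnLine, lineConst])
    rw [← this, w0]
    simp
  refine ⟨y, fun a => -l' (some a) 2, fun X => (p' (Sum.inr X) 0, p' (Sum.inr X) 1),
    ⟨?_, ?_, hc, ?_, ?_, hon⟩, ?_, ?_, hy, fun X => rfl⟩
  · have := hy ⟨0, s.zero_mem⟩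
    rw [v2] at this
    simpa using this
  · have := hon (ptOne T) none (by simp [ptOne, OnLine, lineConst, lineDir])
    rw [hc, w1] at this
    simp only [lineDir, nx_some, ny_some, Fin.isValue, Matrix.cons_val, mul_one] at this
    linear_combination -this
  · rw [w0]; simp
  · rw [w1]; simp
  · funext i
    obtain ⟨x, rfl⟩ := e.symm.surjective i
    rw [e.apply_symm_apply]
    change p' x = _
    rcases x with (_ | k) | X
    · exact v0
    · rw [v1, ptCoords, hy]
    · funext t
      fin_cases t
      · rfl
      · rfl
      · exact hX X
  · funext j
    obtain ⟨x, rfl⟩ := e'.symm.surjective j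
    rw [e'.apply_symm_apply]
    change l' x = _
    rcases x with _ | a
    · exact linf
    · exact hln a

end SlopeSystem

/-! ### Discriminant, lifting and the universal configuration -/

namespace SlopeSystem
variable {K : Type} [Field K] {s : SlopeSystem K} {T : {q // q ∈ s.L} → K × K}

theorem IsAff.map {R S : Type} [CommRing R] [CommRing S] {y : K → R} {c : s.Line → R}
    {P : affinePts T → R × R} (h : IsAff T y c P) (f : R →+* S) :
    IsAff T (fun k => f (y k)) (fun a => f (c a)) (fun X => (f (P X).1, f (P X).2)) where
  zero := by rw [h.zero, map_zero]
  one := by rw [h.one, map_one]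
  diag := by rw [h.diag, map_zero]
  ptZero := by rw [h.ptZero, map_zero]
  ptOne := by rw [h.ptOne, map_one]
  onLine X a hX := by
    rw [← h.onLine X a hX, map_add, map_mul, map_mul, map_nx f y _ _ fun _ _ => rfl, map_ny]

open Classical in
variable (T) in
/-- The discriminant of a configuration, vanishing if two slopes agree or one of the quadrangles
degenerates. -/
def disc {R : Type} [CommRing R] (y : K → R) (P : affinePts T → R × R) : R :=
  (∏ k ∈ s.E.offDiag, (y k.1 - y k.2)) * ∏ g : {q // q ∈ s.L},
    quadSize y (g.1.dir 0) (P ⟨_, vert_mem T g 0⟩) (P ⟨_, vert_mem T g 1⟩)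

theorem map_disc {R S : Type} [CommRing R] [CommRing S] (f : R →+* S) (y : K → R)
    (P : affinePts T → R × R) :
    f (disc T y P) = disc T (fun k => f (y k)) (fun X => (f (P X).1, f (P X).2)) := by
  simp only [disc, quadSize, map_mul, map_prod, map_sub, map_ny,
    map_nx f y (fun k => f (y k)) _ fun _ _ => rfl]

section
variable {R : Type} [CommRing R] {y : K → R} {c : s.Line → R} {P : affinePts T → R × R}

theorem isUnit_sub_of_disc (hd : IsUnit (disc T y P)) :
    ∀ i ∈ (s.E : Set K), ∀ j ∈ (s.E : Set K), i ≠ j → IsUnit (y i - y j) := by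
  classical
  intro i hi j hj hij
  have h1 := isUnit_of_mul_isUnit_left hd
  rw [IsUnit.prod_iff] at h1
  exact h1 (i, j) (Finset.mem_offDiag.2 ⟨hi, hj, hij⟩)

theorem isUnit_quadSize_of_disc (hd : IsUnit (disc T y P)) (g : {q // q ∈ s.L}) :
    IsUnit (quadSize y (g.1.dir 0) (P ⟨_, vert_mem T g 0⟩) (P ⟨_, vert_mem T g 1⟩)) := by
  have h1 := isUnit_of_mul_isUnit_right hd
  rw [IsUnit.prod_iff] at h1
  exact h1 g (Finset.mem_univ _)

/-- Invertibility of the discriminant makes adjacent edges transversal and the first edge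
nondegenerate, so the quadrangle is standard and its closing relation is the relation between the
slopes. -/
theorem IsAff.exists_eq_vertex (h : IsAff T y c P) (hd : IsUnit (disc T y P))
    (g : {q // q ∈ s.L}) : g.1.Holds y ∧
      ∃ σ, ∀ i, P ⟨_, vert_mem T g i⟩ = P ⟨_, vert_mem T g 0⟩ + vertex y g.1.dir σ i := by
  have hv := s.valid _ g.2
  obtain ⟨h1, h2⟩ := MnevSturmfels.exists_eq_vertex (g.1.dir_zero_normal h.zero)
    (fun e e' hee => isUnit_br (isUnit_sub_of_disc hd) (hv.dir_mem s.zero_mem e)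
      (hv.dir_mem s.zero_mem e') (hv.dir_ne hee)) (fun i => P ⟨_, vert_mem T g i⟩)
    (fun e => (h.onLine ⟨_, vert_mem T g (edgeEnds e).1⟩ (some (g, e))
      ((onLine_vert_iff T g e _).2 (isEnd_fst e))).trans
      (h.onLine ⟨_, vert_mem T g (edgeEnds e).2⟩ (some (g, e))
      ((onLine_vert_iff T g e _).2 (isEnd_snd e))).symm)
    (isUnit_quadSize_of_disc hd g)
  exact ⟨(g.1.closes_iff h.zero).1 h1, h2⟩

theorem IsAff.isSol (h : IsAff T y c P) (hd : IsUnit (disc T y P)) : s.IsSol y :=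
  ⟨h.zero, h.one, fun q hq => (h.exists_eq_vertex hd ⟨q, hq⟩).1⟩

end

/-- Configurations with invertible discriminant lift along infinitesimal thickenings as soon as
the slopes lift. -/
theorem exists_lift_isAff (hT : Generic T) {R S : Type} [CommRing R] [CommRing S] (f : R →+* S)
    (hf : Function.Surjective f) (hu : ∀ r, IsUnit (f r) → IsUnit r) {z : K → S}
    {c : s.Line → S} {P : affinePts T → S × S} (h : IsAff T z c P) (hd : IsUnit (disc T z P))
    {y : K → R} (hy : s.IsSol y) (hyz : ∀ k ∈ s.E, f (y k) = z k) :
    ∃ (c' : s.Line → R) (P' : affinePts T → R × R), IsAff T y c' P' ∧ (∀ a, f (c' a) = c a) ∧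
      ∀ X, (f (P' X).1, f (P' X).2) = P X := by
  choose hz σ hσ using h.exists_eq_vertex hd
  -- Sizes and base points of the quadrangles lift freely; the lifted quadrangles close because `y`
  -- satisfies the relations.
  choose σ' hσ' using fun g => hf (σ g)
  choose t₁ ht₁ using fun g => hf (P ⟨_, vert_mem T g 0⟩).1
  choose t₂ ht₂ using fun g => hf (P ⟨_, vert_mem T g 0⟩).2
  let V : {q // q ∈ s.L} → Fin 4 → R × R := fun g i => (t₁ g, t₂ g) + vertex y g.1.dir (σ' g) i
  have hfx : ∀ a : s.Line, f (nx y (lineDir a)) = nx z (lineDir a) := fun a =>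
    map_nx f y z _ fun k hk => hyz k (lineDir_mem a k hk)
  have hV : ∀ g i, (f (V g i).1, f (V g i).2) = P ⟨_, vert_mem T g i⟩ := fun g i => by
    have h1 := map_vertex f (y := y) (z := z) (d := g.1.dir) (fun e k hk => hyz k
      ((s.valid _ g.2).dir_mem s.zero_mem e k hk)) (σ' g) i
    rw [hσ', Prod.ext_iff] at h1
    rw [hσ]
    apply Prod.ext
    · simp only [V, Prod.fst_add, map_add, ht₁, ← h1.1]
    · simp only [V, Prod.snd_add, map_add, ht₂, ← h1.2]
  have hVe : ∀ g e i, IsEnd i e → nx y (g.1.dir e) * (V g i).1 + ny R (g.1.dir e) * (V g i).2 =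
      lineConst y V (some (g, e) : s.Line) := fun g e i hi => by
    have := vertex_mem_edge ((g.1.closes_iff hy.zero).2 (hy.rel _ g.2)) (σ' g) hi
    simp only [V, lineConst, Prod.fst_add, Prod.snd_add]
    linear_combination this
  have hc : ∀ a, f (lineConst y V a) = c a := by
    rintro (_ | ⟨g, e⟩)
    · rw [lineConst, map_zero, h.diag]
    · rw [← h.onLine ⟨_, vert_mem T g (edgeEnds e).1⟩ (some (g, e))
        ((onLine_vert_iff T g e _).2 (isEnd_fst e)), ← hV, lineConst, map_add, map_mul, map_mul,
        map_ny, ← hfx]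
      rfl
  -- Genericity lets the points be lifted independently: the affine anchors lie on no line but the
  -- diagonal, a vertex lies only on edges of its own quadrangle, and any other point lies on two
  -- lines only, which stay transversal over `R`.
  have key : ∀ X : affinePts T, ∃ Z : R × R, (f Z.1, f Z.2) = P X ∧
      (∀ a, OnLine id (vert T) a X.1 →
        nx y (lineDir a) * Z.1 + ny R (lineDir a) * Z.2 = lineConst y V a) ∧
      (X = ptZero T → Z = (0, 0)) ∧ (X = ptOne T → Z = (1, 1)) := by
    intro X
    by_cases h0 : X = ptZero T
    · refine ⟨(0, 0), by rw [h0, h.ptZero, map_zero], fun a ha => ?_, fun _ => rfl,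
        fun h1 => (ptZero_ne_ptOne T (h0.symm.trans h1)).elim⟩
      have ha' : a = none := by
        by_contra hne
        exact hT.zero a hne (by rw [h0] at ha; exact ha)
      simp [ha', lineConst]
    by_cases h1 : X = ptOne T
    · refine ⟨(1, 1), by rw [h1, h.ptOne, map_one], fun a ha => ?_, fun h => (h0 h).elim,
        fun _ => rfl⟩
      have ha' : a = none := by
        by_contra hne
        exact hT.one a hne (by rw [h1] at ha; exact ha)
      simp [ha', lineConst, lineDir, hy.one]
    by_cases hX : ∃ g i, X.1 = vert T g i
    · obtain ⟨g, i, hX⟩ := hX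
      refine ⟨V g i, (hV g i).trans (congrArg P (Subtype.ext hX.symm)), fun a ha => ?_,
        fun h => (h0 h).elim, fun h => (h1 h).elim⟩
      rw [hX] at ha
      obtain ⟨e, rfl, he⟩ := hT.isEnd_of_onLine_vert ha
      exact hVe g e i he
    · push Not at hX
      obtain ⟨a, b, hab, ha, hb⟩ : ∃ a b : s.Line, lineDir a ≠ lineDir b ∧
          OnLine id (vert T) a X.1 ∧ OnLine id (vert T) b X.1 := by
        rcases X.2 with h | h | h
        · exact (h0 (Subtype.ext h)).elim
        · exact (h1 (Subtype.ext h)).elim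
        · exact h
      have hub : IsUnit (br z (lineDir a) (lineDir b)) :=
        isUnit_br (isUnit_sub_of_disc hd) (lineDir_mem a) (lineDir_mem b) hab
      have hub' : IsUnit (br y (lineDir a) (lineDir b)) := hu _ <| by
        rwa [map_br f y z _ _ (fun k hk => hyz k (lineDir_mem a k hk))
          (fun k hk => hyz k (lineDir_mem b k hk))]
      obtain ⟨Z, hZa, hZb⟩ := exists_of_br_isUnit hub' (lineConst y V a) (lineConst y V b)
      refine ⟨Z, eq_of_br_isUnit hub ?_ ?_, fun d hd => ?_, fun h => (h0 h).elim,
        fun h => (h1 h).elim⟩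
      · rw [h.onLine X a ha, ← hc, ← hZa, map_add, map_mul, map_mul, map_ny, hfx]
      · rw [h.onLine X b hb, ← hc, ← hZb, map_add, map_mul, map_mul, map_ny, hfx]
      · rcases hT.eq_or_eq hX (fun h => hab (congrArg lineDir h)) ha hb hd with rfl | rfl
        · exact hZa
        · exact hZb
  choose P' hP1 hP2 hP3 hP4 using key
  exact ⟨lineConst y V, P', ⟨hy.zero, hy.one, rfl, hP3 _ rfl, hP4 _ rfl, hP2⟩, hc, hP1⟩

theorem map_ptCoords {R S : Type} [CommRing R] [CommRing S] (f : R →+* S) {y : K → R} {z : K → S}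
    {P : affinePts T → R × R} {Q : affinePts T → S × S} (hy : ∀ k ∈ s.E, f (y k) = z k)
    (hP : ∀ X, (f (P X).1, f (P X).2) = Q X) (i : Pt T) (t : Fin 3) :
    f (ptCoords T y P i t) = ptCoords T z Q i t := by
  rcases i with (_ | k) | X
  · fin_cases t <;> simp [ptCoords]
  · fin_cases t <;> simp [ptCoords, hy]
  · fin_cases t <;> simp [ptCoords, ← hP]

theorem map_lnCoords {R S : Type} [CommRing R] [CommRing S] (f : R →+* S) {y : K → R} {z : K → S}
    {c : s.Line → R} {c' : s.Line → S} (hy : ∀ k ∈ s.E, f (y k) = z k)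
    (hc : ∀ a, f (c a) = c' a) (j : s.Ln) (t : Fin 3) :
    f (lnCoords y c j t) = lnCoords z c' j t := by
  rcases j with _ | a
  · fin_cases t <;> simp [lnCoords]
  · fin_cases t <;> simp [lnCoords, hc, map_ny,
      map_nx f y z (lineDir a) fun k hk => hy k (lineDir_mem a k hk)]

/-! ### The configuration over the field -/

variable (T) in
theorem isAff_id : IsAff T (id : K → K) (lineConst id (vert T)) Subtype.val :=
  ⟨rfl, rfl, rfl, rfl, rfl, fun _ _ h => h⟩

-- Over `K` the slopes are distinct by definition, and all quadrangles have size parameter one.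
variable (T) in
theorem disc_id_ne_zero : disc T (id : K → K) Subtype.val ≠ 0 := by
  classical
  rw [disc]
  refine mul_ne_zero (Finset.prod_ne_zero_iff.2 fun k hk =>
    sub_ne_zero.2 (Finset.mem_offDiag.1 hk).2.2) (Finset.prod_ne_zero_iff.2 fun g _ => ?_)
  have hv := s.valid _ g.2
  have h1 := g.1.dir_zero_normal (y := (id : K → K)) rfl
  have h2 := br_id_ne_zero (hv.dir_ne (e := 1) (e' := 3) (by decide))
  have h3 := br_id_ne_zero (hv.dir_ne (e := 2) (e' := 4) (by decide))
  have : quadSize id (g.1.dir 0) (vert T g 0) (vert T g 1) =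
      br id (g.1.dir 1) (g.1.dir 3) * br id (g.1.dir 2) (g.1.dir 4) := by
    simp only [quadSize, vert, vertex, Prod.fst_add, Prod.snd_add, Fin.isValue, Matrix.cons_val]
    linear_combination br id (g.1.dir 1) (g.1.dir 3) * br id (g.1.dir 2) (g.1.dir 4) * h1
  rw [this]
  exact mul_ne_zero h2 h3

/-- `Inc` records exactly the incidences that hold over `K`, so no other incidence occurs.
Genericity is needed only to keep parallel lines distinct. -/
theorem isOpenConfig_id (hT : Generic T) {D : IncidenceData} (e : Fin D.M ≃ Pt T)
    (e' : Fin D.N ≃ s.Ln) (hinc : ∀ i j, D.inc i j ↔ Inc T (e i) (e' j)) :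
    IsOpenConfig D (fun i => ptCoords T (id : K → K) Subtype.val (e i))
      (fun j => lnCoords id (lineConst id (vert T)) (e' j)) where
  not_incident i j hij := by
    rw [hinc] at hij
    rw [Fin.sum_univ_three]
    rcases hi : e i with δ | X
    · rcases hj : e' j with _ | a <;> rw [hi, hj] at hij
      · exact (hij trivial).elim
      · have hij : δ.map Subtype.val ≠ lineDir a := hij
        have := br_id_ne_zero hij
        rcases δ with _ | k
        · simpa [ptCoords, lnCoords, br] using this
        · simp only [Option.map_some, br, nx_some, ny_some] at this
          simp only [ptCoords, lnCoords, Fin.isValue, Matrix.cons_val]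
          intro h
          apply this
          simp only [id] at h ⊢
          linear_combination -h
    · rcases hj : e' j with _ | a <;> rw [hi, hj] at hij
      · simp [ptCoords, lnCoords]
      · intro h
        apply hij
        simp only [ptCoords, lnCoords, Fin.isValue, Matrix.cons_val] at h
        simp only [Inc, OnLine]
        linear_combination h
  pt_ne i i' hne := by
    have hne : e i ≠ e i' := fun h => hne (e.injective h)
    rcases hi : e i with (_ | k) | X <;> rcases hi' : e i' with (_ | k') | X' <;>
      rw [hi, hi'] at hne
    · exact (hne rfl).elim
    · exact ⟨0, 1, by simp [ptCoords]⟩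
    · exact ⟨1, 2, by simp [ptCoords]⟩
    · exact ⟨0, 1, by simp [ptCoords]⟩
    · refine ⟨0, 1, fun h => hne ?_⟩
      simp only [ptCoords, Fin.isValue, Matrix.cons_val, one_mul, mul_one, id] at h
      rw [Subtype.ext h]
    · exact ⟨0, 2, by simp [ptCoords]⟩
    · exact ⟨1, 2, by simp [ptCoords]⟩
    · exact ⟨0, 2, by simp [ptCoords]⟩
    · by_cases h0 : X.1.1 = X'.1.1
      · refine ⟨1, 2, fun h => hne ?_⟩
        simp only [ptCoords, Fin.isValue, Matrix.cons_val, one_mul, mul_one] at h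
        rw [Subtype.ext (Prod.ext h0 h)]
      · exact ⟨0, 2, by simpa [ptCoords] using h0⟩
  ln_ne j j' hne := by
    have hne : e' j ≠ e' j' := fun h => hne (e'.injective h)
    have key : ∀ a : s.Line, nx (id : K → K) (lineDir a) ≠ 0 ∨ ny K (lineDir a) ≠ 0 := fun a => by
      rcases lineDir a with _ | k <;> simp
    rcases hj : e' j with _ | a <;> rcases hj' : e' j' with _ | b <;> rw [hj, hj'] at hne
    · exact (hne rfl).elim
    · rcases key b with h | h
      · exact ⟨2, 0, by simpa [lnCoords] using h⟩
      · exact ⟨2, 1, by simpa [lnCoords] using h⟩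
    · rcases key a with h | h
      · exact ⟨0, 2, by simpa [lnCoords] using h⟩
      · exact ⟨1, 2, by simpa [lnCoords] using h⟩
    · have hab : a ≠ b := fun h => hne (h ▸ rfl)
      by_cases hd : lineDir a = lineDir b
      · have hc := hT.lineConst_ne hab hd
        rcases key a with h | h
        · refine ⟨0, 2, fun h' => hc ?_⟩
          simp only [lnCoords, Fin.isValue, Matrix.cons_val, ← hd] at h'
          exact mul_left_cancel₀ h (by linear_combination h')
        · refine ⟨1, 2, fun h' => hc ?_⟩
          simp only [lnCoords, Fin.isValue, Matrix.cons_val, ← hd] at h'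
          exact mul_left_cancel₀ h (by linear_combination h')
      · refine ⟨0, 1, fun h' => br_id_ne_zero hd ?_⟩
        simp only [lnCoords, Fin.isValue, Matrix.cons_val] at h'
        rw [br]
        linear_combination h'

/-! ### The universal configuration with invertible discriminant -/

theorem map_disc_of_agree {R S : Type} [CommRing R] [CommRing S] (f : R →+* S) {y : K → R}
    {z : K → S} {P : affinePts T → R × R} {Q : affinePts T → S × S}
    (hy : ∀ k ∈ s.E, f (y k) = z k) (hP : ∀ X, (f (P X).1, f (P X).2) = Q X) :
    f (disc T y P) = disc T z Q := by
  simp only [disc, quadSize, map_mul, map_prod, map_sub, map_ny, ← hP]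
  congr 1
  · refine Finset.prod_congr rfl fun k hk => ?_
    rw [hy _ (Finset.mem_offDiag.1 hk).1, hy _ (Finset.mem_offDiag.1 hk).2.1]
  · refine Finset.prod_congr rfl fun g _ => ?_
    rw [map_nx f y z _ fun k hk => hy k ((s.valid _ g.2).dir_mem s.zero_mem 0 k hk)]

/-- The configurations with invertible discriminant are represented by a localization of the
configuration ring. -/
theorem exists_universal_isAff {D : IncidenceData} (e : Fin D.M ≃ Pt T) (e' : Fin D.N ≃ s.Ln)
    (he : ∀ k, e (Fin.castLE D.four_le k) = anchorPt T k)
    (hinc : ∀ i j, D.inc i j ↔ Inc T (e i) (e' j)) :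
    ∃ (h : ConfigRing D (fun i => ptChart T (e i)) (fun j => lnChart (e' j)))
      (y : K → Localization.Away h) (c : s.Line → Localization.Away h)
      (P : affinePts T → Localization.Away h × Localization.Away h),
      IsAff T y c P ∧ IsUnit (disc T y P) ∧
      (∀ {B : Type} [CommRing B] {z : K → B} {c' : s.Line → B} {Q : affinePts T → B × B}
        (hz : IsAff T z c' Q), IsUnit (disc T z Q) → ∃ g : Localization.Away h →+* B,
          g.comp (algebraMap _ _) = (hz.isConfig e e' he hinc).hom ∧
          (∀ k ∈ s.E, g (y k) = z k) ∧ (∀ a, g (c a) = c' a) ∧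
          ∀ X, (g (P X).1, g (P X).2) = Q X) ∧
      ∀ {B : Type} [CommRing B] (g g' : Localization.Away h →+* B),
        (∀ k ∈ s.E, g (y k) = g' (y k)) → (∀ a, g (c a) = g' (c a)) →
        (∀ X, (g (P X).1, g (P X).2) = (g' (P X).1, g' (P X).2)) → g = g' := by
  obtain ⟨y, c, P, hA, hp, hl, hyp, hPp⟩ := exists_isAff e e' he hinc (isConfig_univ D _ _)
  let h := disc T y P
  let κ := algebraMap (ConfigRing D (fun i => ptChart T (e i)) fun j => lnChart (e' j))
    (Localization.Away h)
  refine ⟨h, fun k => κ (y k), fun a => κ (c a), fun X => (κ (P X).1, κ (P X).2), hA.map κ, ?_,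
    fun {B} _ z c' Q hz hd => ?_, fun {B} _ g g' hy hc hP => ?_⟩
  · rw [← map_disc]
    exact IsLocalization.Away.algebraMap_isUnit h
  · let g₀ := (hz.isConfig e e' he hinc).hom
    have h1 : ∀ k ∈ s.E, g₀ (y k) = z k := fun k hk => by
      rw [hyp ⟨k, hk⟩, IsConfig.hom_univPt, e.apply_symm_apply]
      simp [ptCoords]
    have h2 : ∀ X, (g₀ (P X).1, g₀ (P X).2) = Q X := fun X => by
      rw [hPp, IsConfig.hom_univPt, IsConfig.hom_univPt, e.apply_symm_apply]
      simp [ptCoords]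
    have h3 : ∀ a, g₀ (c a) = c' a := fun a => by
      have h4 : univLn D _ _ (e'.symm (some a)) 2 = -c a := by
        rw [hl]
        simp [lnCoords]
      have h5 : g₀ (-c a) = -c' a := by
        rw [← h4]
        refine (IsConfig.hom_univLn _ _ _).trans ?_
        simp [lnCoords]
      rwa [map_neg, neg_inj] at h5
    have hu : IsUnit (g₀ h) := by rwa [map_disc_of_agree g₀ h1 h2]
    have hg : ∀ r, IsLocalization.Away.lift h hu (κ r) = g₀ r :=
      IsLocalization.Away.lift_eq h hu
    exact ⟨IsLocalization.Away.lift h hu, IsLocalization.Away.lift_comp h hu,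
      fun k hk => (hg _).trans (h1 k hk), fun a => (hg _).trans (h3 a),
      fun X => by rw [← h2, hg, hg]⟩
  · refine IsLocalization.ringHom_ext (Submonoid.powers h)
      (configRing_hom_ext (fun i t => ?_) fun j t => ?_)
    · rw [hp]
      exact (map_ptCoords (g.comp κ) hy hP (e i) t).trans
        (map_ptCoords (g'.comp κ) (fun _ _ => rfl) (fun _ => rfl) (e i) t).symm
    · rw [hl]
      exact (map_lnCoords (g.comp κ) hy hc (e' j) t).trans
        (map_lnCoords (g'.comp κ) (fun _ _ => rfl) (fun _ => rfl) (e' j) t).symm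

end SlopeSystem

/-! ### Smoothness of the configuration space over the given ring -/

open SlopeSystem in
/-- Every point of an affine scheme of finite type over `ℤ` has the singularity type of an open
configuration. -/
theorem hasSmoothConfig (A : Type) [CommRing A] [Algebra.FiniteType ℤ A] (K : Type) [Field K]
    [Infinite K] (φ : A →+* K) : HasSmoothConfig φ := by
  obtain ⟨s, n, π, u, t, t', hπ, huE, hφ, hrel, hlift⟩ := SlopeSystem.exists_encoding φ
  obtain ⟨T, hT⟩ := SlopeSystem.exists_generic (s := s)
  obtain ⟨D, e, e', he, hinc⟩ := exists_incidenceData (anchorPt T) (anchorPt_injective T) (Inc T)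
    (exists_common_pt T) (exists_three_pts T)
  obtain ⟨h, y, c, P, hA, hd, huniv, hext⟩ := exists_universal_isAff e e' he hinc
  obtain ⟨θ, hθ, hθy, -, -⟩ := huniv (isAff_id T) (disc_id_ne_zero T).isUnit
  let ev : MvPolynomial (Fin n) ℤ →+* Localization.Away h :=
    MvPolynomial.eval₂Hom (Int.castRingHom _) fun i => y (u i) - y (t i) - y (t' i)
  -- The relations of `A` hold for these images because a configuration with invertible discriminant
  -- solves the slope system.
  let j : A →+* Localization.Away h :=
    RingHom.liftOfSurjective π hπ ⟨ev, fun f hf => RingHom.mem_ker.2 (hrel y (hA.isSol hd) f hf)⟩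
  have hj : ∀ i, j (π (MvPolynomial.X i)) = y (u i) - y (t i) - y (t' i) := fun i => by
    refine (RingHom.liftOfRightInverse_comp_apply _ _ _ _ _).trans ?_
    exact MvPolynomial.eval₂Hom_X' _ _ _
  have hhom : ∀ {B : Type} [CommRing B] (g g' : A →+* B),
      (∀ i, g (π (MvPolynomial.X i)) = g' (π (MvPolynomial.X i))) → g = g' := by
    intro B _ g g' H
    exact RingHom.cancel_right hπ |>.1 (MvPolynomial.ringHom_ext (fun n => by simp) H)
  refine ⟨D, _, _, _, _, anchorCoords_ptChart e he, (isAff_id T).isConfig e e' he hinc,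
    isOpenConfig_id hT e e' hinc, h, j, ?_, θ, hθ, hhom _ _ fun i => ?_⟩
  · let := j.toAlgebra
    have hnoeth : IsNoetherianRing A := Algebra.FiniteType.isNoetherianRing ℤ A
    have hft : Algebra.FiniteType ℤ (Localization.Away h) :=
      Algebra.FiniteType.trans (S := ConfigRing D _ _) inferInstance
        (IsLocalization.finiteType_of_monoid_fg (Submonoid.powers h) _)
    have hft' : j.FiniteType := by
      refine RingHom.FiniteType.of_comp_finiteType (f := algebraMap ℤ A) ?_
      rw [Subsingleton.elim (j.comp (algebraMap ℤ A)) (algebraMap ℤ (Localization.Away h))]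
      exact RingHom.finiteType_algebraMap.2 hft
    -- Over the Noetherian ring `A`, finite type gives finite presentation. For formal smoothness, a
    -- homomorphism to `B ⧸ I` with `I` of square zero is a configuration there; the slopes are
    -- lifted to `B` compatibly with `A`, then the points and lines.
    refine ⟨Algebra.FormallySmooth.of_comp_surjective fun B _ _ I hI g => ?_,
      Algebra.FinitePresentation.of_finiteType.1 hft'⟩
    have hgA := hA.map (g : Localization.Away h →+* B ⧸ I)
    have hgd : IsUnit (disc T (fun k => g (y k)) fun X => (g (P X).1, g (P X).2)) := by
      have := hd.map (g : Localization.Away h →+* B ⧸ I)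
      rwa [map_disc] at this
    -- Units can be tested modulo a nilpotent ideal; this also makes the discriminant of the lifted
    -- configuration invertible.
    have hu : ∀ r, IsUnit (Ideal.Quotient.mk I r) → IsUnit r := fun r hr =>
      (IsNilpotent.isUnit_quotient_mk_iff ⟨2, hI⟩).1 hr
    obtain ⟨y', hy', hay', hyz⟩ := hlift (Ideal.Quotient.mk I) Ideal.Quotient.mk_surjective _
      (hgA.isSol hgd) (algebraMap A B) fun i => by
        have h1 : Ideal.Quotient.mk I (algebraMap A B (π (MvPolynomial.X i))) =
          g (algebraMap A _ (π (MvPolynomial.X i))) := (g.commutes _).symm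
        rw [h1]
        have h2 : algebraMap A (Localization.Away h) (π (MvPolynomial.X i)) = _ := hj i
        rw [h2, map_sub, map_sub]
        rfl
    obtain ⟨c', P', hA', hc', hP'⟩ := exists_lift_isAff hT (Ideal.Quotient.mk I)
      Ideal.Quotient.mk_surjective hu hgA hgd hy' hyz
    obtain ⟨G, -, hGy, hGc, hGP⟩ := huniv hA' <| hu _ <| by
      rwa [map_disc_of_agree _ hyz hP']
    have hG : G.comp j = algebraMap A B := hhom _ _ fun i => by
      rw [RingHom.comp_apply, hj, hay', map_sub, map_sub, hGy _ (huE i).1, hGy _ (huE i).2.1,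
        hGy _ (huE i).2.2]
    refine ⟨{ G with commutes' := fun r => RingHom.congr_fun hG r }, ?_⟩
    have h3 : (Ideal.Quotient.mk I).comp G = (g : Localization.Away h →+* B ⧸ I) := by
      refine hext _ _ (fun k hk => ?_) (fun a => ?_) fun X => ?_
      · rw [RingHom.comp_apply, hGy k hk]; exact hyz k hk
      · rw [RingHom.comp_apply, hGc]; exact hc' a
      · rw [RingHom.comp_apply, RingHom.comp_apply, ← hP', ← hGP]
    exact AlgHom.ext fun r => RingHom.congr_fun h3 r
  · rw [RingHom.comp_apply, hj, hφ, map_sub, map_sub, hθy _ (huE i).1, hθy _ (huE i).2.1,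
      hθy _ (huE i).2.2]
    rfl

end MnevSturmfels

/-- Mnëv–Sturmfels universality for schemes: the disjoint union of all incidence schemes
satisfies Murphy's Law. -/
theorem theorem1p3 :
    MnevSturmfels.MurphysLaw
      (∐ fun D : MnevSturmfels.IncidenceData => D.incidenceScheme) :=
  MnevSturmfels.murphysLaw_of_hasSmoothConfig MnevSturmfels.hasSmoothConfig

end
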